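/- All spaces are over $\mathbb C$. A Leibniz superalgebra is a $\mathbb Z_2$-graded space $L=L_0\oplus L_1$ with a bilinear product such that $[L_a,L_b]\subseteq L_{a+b}$ and $[x,[y,z]]=[[x,y],z]-(-1)^{ab}[[x,z],y]$ for $x\in L$, $y\in L_a$, $z\in L_b$. Isomorphisms are the linear bijections that preserve the grading and the product. Put $L^1=L$, $L^{k+1}=[L^k,L]$; the nilindex is the least $s\ge 1$ with $L^s=0$. For nilpotent $L$ and $x\in L_0$ let $C_a(x)$ be the descending sequence of the sizes of the Jordan blocks of $R_x=[\,\cdot\,,x]$ on $L_a$; the characteristic sequence of $L$ is $\big(\max C_0(x)\mid\max C_1(x)\big)$, where both maxima are lexicographic and taken (separately) over $x\in L_0\setminus[L_0,L_0]$. Let $n\ge 2$, $r=\lfloor\frac{n+4}2\rfloor$. For complex numbers $\gamma,\beta_r,\dots,\beta_n,\beta$ let $L(\gamma,\beta_r,\dots,\beta_n,\beta)$ be the superalgebra with basis $x_1,\dots,x_n$ of the even part, basis $y_1,\dots,y_{n+1}$ of the odd part, and products $$[x_i,x_1]=x_{i+1},\quad [y_j,x_1]=y_{j+1},\quad [x_i,y_1]=\tfrac12y_{i+1}\quad(1\le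 i,j\le n-1),\qquad [y_j,y_1]=x_j\quad(1\le j\le n),$$ $$[y_{n+1},y_{n+1}]=\gamma x_n,\qquad [x_i,y_{n+1}]=\sum_{k=r}^{n+1-i}\beta_k\,y_{k-1+i}\quad(1\le i\le\lfloor\tfrac{n-1}2\rfloor),$$ $$[y_1,y_{n+1}]=-2\sum_{k=r}^{n}\beta_k\,x_{k-1}+\beta x_n,\qquad [y_j,y_{n+1}]=-2\sum_{k=r}^{n+2-j}\beta_k\,x_{k-2+j}\quad(2\le j\le\lfloor\tfrac{n+1}2\rfloor),$$ all other products of basis vectors being zero. For $t\ge1$ let $S_{m,t}=\cos\frac{2\pi m}t+i\sin\frac{2\pi m}t$, and for $\delta=\pm1$ let $\sqrt[j]{\delta}$ be the principal root. For $k\ge 0$, $1\le j\le k$ and $\alpha_1,\alpha_2,\dots\in\mathbb C$ define the following vectors of length $k$: $V^0_{j,k}$, $V^1_{j,k}$, $V^2_{j,k}$ have entries $0$ at the positions $i<j$, entry $1$ at the position $j$, and at each position $i$ with $j<i\le k$ the entry $$V^0_{j,k}:\ \delta\,(\sqrt[j]{\delta})^{\,i}S_{m,j}^{\,i}\alpha_i,\qquad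 V^1_{j,k}:\ S_{m,j}^{\,i}\alpha_i,\qquad V^2_{j,k}:\ S_{m,2j-1}^{\,2i-1}\alpha_i ;$$ for $j=k+1$ they are zero vectors. For $1\le s\le k-j$ the vector $W_{s,k}(V^1_{j,k})$ has entries $1$ at the positions $s$ and $s+j$, entries $S_{m,j}^{\,i}\alpha_{s+i}$ at the positions $s+i$ with $j<i\le k-s$, and zeros elsewhere; for $s=k+1-j$ it has an entry $1$ at the position $s$ and zeros elsewhere. Here $0\le m\le j-1$ for $V^0,V^1,W$ and $0\le m\le 2j-2$ for $V^2$. Consider the following list of families. In each family the numbers $j,s$, the number $b$ and the $\alpha_i$ are fixed and arbitrary within the given ranges, and the family consists of the superalgebras obtained for all admissible $m$ and (where it occurs) $\delta\in\{1,-1\}$, the same $\delta$ being used everywhere in one expression. If $n=2q-1$ (the parameters are $\gamma,\beta_{q+1},(\beta_{q+2},\dots,\beta_n,\beta)$): 1. $L(1,\delta b,V^0_{j,q-2},0)$, $b\ne\pm\frac12$, $1\le j\le q-1$; 2. $L(1,\delta b,V^0_{j,q-1})$, $b=\pm\frac12$, $1\le j\le q$; 3. $L(0,1,V^1_{j,q-2},0)$,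 $1\le j\le q-1$; 4. $L(0,0,W_{s,q-1}(V^1_{j,q-1}))$, $1\le j\le q-1$, $1\le s\le q-j$; 5. $L(0,0,\dots,0)$. If $n=2q$ (the parameters are $\gamma,(\beta_{q+2},\dots,\beta_n,\beta)$): 1. $L(1,V^2_{j,q-1},0)$, $1\le j\le q$; 2. $L(0,W_{s,q}(V^1_{j,q}))$, $1\le j\le q$, $1\le s\le q+1-j$; 3. $L(0,0,\dots,0)$. **Theorem 3.3.** Let $n\ge2$ and $m=n+1$. (a) Every Leibniz superalgebra $L$ with $\dim L_0=n$, $\dim L_1=m$, characteristic sequence $(n\mid m-1,1)$ and nilindex $n+m$ is isomorphic to a member of some family in the list for $n$. (b) Every member of every family in the list for $n$ is a Leibniz superalgebra with these properties. (c) Two members of families in the list for $n$ are isomorphic if and only if the families to which they belong coincide as sets of superalgebras $L(\gamma,\beta_r,\dots,\beta_n,\beta)$ (that is, as sets of parameters). So the members of one family are isomorphic to each other, different families have no isomorphic members, and $L$ belongs to exactly one family up to isomorphism. -/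

import Mathlib

namespace LeibnizSuper

/-- A `ℤ/2`-indexed pair of subspaces of a complex vector space together with a bilinear product
`[x, y] = mul x y`. The laws of a Leibniz superalgebra are in `IsLeibniz`. -/
structure SuperProduct (L : Type*) [AddCommGroup L] [Module ℂ L] where
  part : ZMod 2 → Submodule ℂ L
  mul : L →ₗ[ℂ] L →ₗ[ℂ] L

section General

variable {L : Type*} [AddCommGroup L] [Module ℂ L] {M : Type*} [AddCommGroup M] [Module ℂ M]

/-- Leibniz superalgebras: `L = L₀ ⊕ L₁`, the product respects the grading, and the graded
Leibniz identity holds. -/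
structure IsLeibniz (A : SuperProduct L) : Prop where
  isCompl : IsCompl (A.part 0) (A.part 1)
  mul_mem : ∀ (a b : ZMod 2) (x y : L), x ∈ A.part a → y ∈ A.part b →
    A.mul x y ∈ A.part (a + b)
  leibniz : ∀ (a b : ZMod 2) (x y z : L), y ∈ A.part a → z ∈ A.part b →
    A.mul x (A.mul y z) =
      A.mul (A.mul x y) z - (-1 : ℂ) ^ (a.val * b.val) • A.mul (A.mul x z) y

/-- Isomorphism of superalgebras: a linear bijection that preserves parity and products. -/
def Iso (A : SuperProduct L) (B : SuperProduct M) : Prop :=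
  ∃ f : L ≃ₗ[ℂ] M, (∀ (a : ZMod 2) (x : L), x ∈ A.part a → f x ∈ B.part a) ∧
    ∀ x y : L, f (A.mul x y) = B.mul (f x) (f y)

/-- The descending central sequence `L¹ = L`, `Lᵏ⁺¹ = [Lᵏ, L]` (the value at `0` is not used). -/
def power (A : SuperProduct L) : ℕ → Submodule ℂ L
  | 0 => ⊤
  | 1 => ⊤
  | k + 2 => Submodule.map₂ A.mul (power A (k + 1)) ⊤

/-- `L` is nilpotent and `s` is its index of nilpotency: the least `s ≥ 1` with `Lˢ = 0`. -/
def HasNilindex (A : SuperProduct L) (s : ℕ) : Prop :=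
  IsLeast {t : ℕ | 1 ≤ t ∧ power A t = ⊥} s

/-- The restriction of `f` to the subspace `W` is nilpotent, and `s` is the descending sequence of
the sizes of its Jordan blocks: `W` has a basis that is a union of chains
`e₁ ↦ e₂ ↦ ⋯ ↦ e_d ↦ 0`, one chain for each member `d` of `s`. -/
def HasJordanBlocks (f : L →ₗ[ℂ] L) (W : Submodule ℂ L) (s : List ℕ) : Prop :=
  s.Pairwise (· ≥ ·) ∧ (∀ d ∈ s, 0 < d) ∧
    ∃ e : Module.Basis (Σ i : Fin s.length, Fin (s.get i)) ℂ W,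
      ∀ (i : Fin s.length) (k : Fin (s.get i)),
        f (e ⟨i, k⟩) = if h : (k : ℕ) + 1 < s.get i then (e ⟨i, ⟨k + 1, h⟩⟩ : L) else 0

/-- The sequences `C_a(x)` of Jordan block sizes of right multiplication by `x` on `L_a`, for
`x ∈ L₀ \ [L₀, L₀]`. -/
def jordanSequences (A : SuperProduct L) (a : ZMod 2) : Set (List ℕ) :=
  {s | ∃ x ∈ A.part 0, x ∉ Submodule.map₂ A.mul (A.part 0) (A.part 0) ∧
    HasJordanBlocks (A.mul.flip x) (A.part a) s}

/-- The characteristic sequence of `L` is `(s | t)`; lists are ordered lexicographically. -/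
def HasCharSeq (A : SuperProduct L) (s t : List ℕ) : Prop :=
  IsGreatest (jordanSequences A 0) s ∧ IsGreatest (jordanSequences A 1) t

/-- Leibniz superalgebras with `dim L₀ = n`, `dim L₁ = m`, characteristic sequence
`(n | m - 1, 1)` and nilindex `n + m`. -/
structure IsOfType (n m : ℕ) (A : SuperProduct L) : Prop where
  isLeibniz : IsLeibniz A
  finrank_even : Module.finrank ℂ (A.part 0) = n
  finrank_odd : Module.finrank ℂ (A.part 1) = m
  charSeq : HasCharSeq A [n] [m - 1, 1]
  nilindex : HasNilindex A (n + m)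

end General

/-- The space with basis `x₁, …, xₙ, y₁, …, yₙ₊₁`. -/
abbrev Carrier (n : ℕ) : Type := Fin n ⊕ Fin (n + 1) → ℂ

/-- The basis vector `xᵢ`, `1 ≤ i ≤ n` (and `0` for any other `i`). -/
noncomputable def X (n i : ℕ) : Carrier n :=
  if h : 1 ≤ i ∧ i ≤ n then Pi.single (Sum.inl ⟨i - 1, by omega⟩) 1 else 0

/-- The basis vector `yⱼ`, `1 ≤ j ≤ n + 1` (and `0` for any other `j`). -/
noncomputable def Y (n j : ℕ) : Carrier n :=
  if h : 1 ≤ j ∧ j ≤ n + 1 then Pi.single (Sum.inr ⟨j - 1, by omega⟩) 1 else 0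

/-- The parameters `(γ, β)`. The superalgebra `L(γ, β_r, …, β_n, β)`, `r = ⌊(n + 4) / 2⌋`, is given
by `γ` and the numbers `β k`, `r ≤ k ≤ n + 1`, where `β (n + 1)` is the last parameter. -/
abbrev Param : Type := ℂ × (ℕ → ℂ)

/-- `[xᵢ, xⱼ]` -/
noncomputable def mulXX (n i j : ℕ) : Carrier n :=
  if j = 1 ∧ i + 1 ≤ n then X n (i + 1) else 0

/-- `[yⱼ, xᵢ]` -/
noncomputable def mulYX (n j i : ℕ) : Carrier n :=
  if i = 1 ∧ j + 1 ≤ n then Y n (j + 1) else 0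

/-- `[xᵢ, yⱼ]` -/
noncomputable def mulXY (n : ℕ) (P : Param) (i j : ℕ) : Carrier n :=
  if j = 1 ∧ i + 1 ≤ n then (1 / 2 : ℂ) • Y n (i + 1)
  else if j = n + 1 ∧ i ≤ (n - 1) / 2 then
    ∑ k ∈ Finset.Icc ((n + 4) / 2) (n + 1 - i), P.2 k • Y n (k - 1 + i)
  else 0

/-- `[yᵢ, yⱼ]` -/
noncomputable def mulYY (n : ℕ) (P : Param) (i j : ℕ) : Carrier n :=
  if j = 1 ∧ i ≤ n then X n i
  else if j = n + 1 ∧ i = n + 1 then P.1 • X n n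
  else if j = n + 1 ∧ i = 1 then
    (-2 : ℂ) • ∑ k ∈ Finset.Icc ((n + 4) / 2) n, P.2 k • X n (k - 1) + P.2 (n + 1) • X n n
  else if j = n + 1 ∧ 2 ≤ i ∧ i ≤ (n + 1) / 2 then
    (-2 : ℂ) • ∑ k ∈ Finset.Icc ((n + 4) / 2) (n + 2 - i), P.2 k • X n (k - 2 + i)
  else 0

/-- The products of the basis vectors; the indices of `Fin` are shifted by one. -/
noncomputable def table (n : ℕ) (P : Param) :
    Fin n ⊕ Fin (n + 1) → Fin n ⊕ Fin (n + 1) → Carrier n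
  | Sum.inl i, Sum.inl j => mulXX n (i + 1) (j + 1)
  | Sum.inl i, Sum.inr j => mulXY n P (i + 1) (j + 1)
  | Sum.inr i, Sum.inl j => mulYX n (i + 1) (j + 1)
  | Sum.inr i, Sum.inr j => mulYY n P (i + 1) (j + 1)

/-- The superalgebra `L(γ, β_r, …, β_n, β)`, with even part spanned by the `xᵢ` and odd part
spanned by the `yⱼ`. -/
noncomputable def family (n : ℕ) (P : Param) : SuperProduct (Carrier n) where
  part := fun a =>
    if a = 0 then LinearMap.ker (LinearMap.funLeft ℂ ℂ (Sum.inr : Fin (n + 1) → Fin n ⊕ Fin (n + 1)))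
    else LinearMap.ker (LinearMap.funLeft ℂ ℂ (Sum.inl : Fin n → Fin n ⊕ Fin (n + 1)))
  mul := (Pi.basisFun ℂ (Fin n ⊕ Fin (n + 1))).constr ℂ fun a =>
    (Pi.basisFun ℂ (Fin n ⊕ Fin (n + 1))).constr ℂ fun b => table n P a b

/-- The root of unity `S_{m,t} = cos (2πm/t) + i sin (2πm/t)`. -/
noncomputable def S (m t : ℕ) : ℂ := Complex.exp (2 * Real.pi * Complex.I * m / t)

/-! Vectors of length `k` are functions of the position `1 ≤ i ≤ k`, extended by `0`. -/

/-- `V⁰_{j,k}(α₁, …, αₖ)`: zeros before position `j`, then `1` at position `j`, then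
`δ (δ^{1/j})^i S_{m,j}^i αᵢ` at the positions `j < i ≤ k`. For `j = k + 1` it is zero. -/
noncomputable def V0 (j k : ℕ) (δ : ℂ) (m : ℕ) (α : ℕ → ℂ) : ℕ → ℂ := fun i =>
  if i = j ∧ i ≤ k then 1
  else if j < i ∧ i ≤ k then δ * (δ ^ (1 / (j : ℂ))) ^ i * S m j ^ i * α i
  else 0

/-- `V¹_{j,k}(α₁, …, αₖ)`, with `S_{m,j}^i αᵢ` after the entry `1` at position `j`. -/
noncomputable def V1 (j k : ℕ) (m : ℕ) (α : ℕ → ℂ) : ℕ → ℂ := fun i =>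
  if i = j ∧ i ≤ k then 1
  else if j < i ∧ i ≤ k then S m j ^ i * α i
  else 0

/-- `V²_{j,k}(α₁, …, αₖ)`, with `S_{m,2j-1}^{2i-1} αᵢ` after the entry `1` at position `j`. -/
noncomputable def V2 (j k : ℕ) (m : ℕ) (α : ℕ → ℂ) : ℕ → ℂ := fun i =>
  if i = j ∧ i ≤ k then 1
  else if j < i ∧ i ≤ k then S m (2 * j - 1) ^ (2 * i - 1) * α i
  else 0

/-- `W_{s,k}(V¹_{j,k}(α₁, …, αₖ))`: an entry `1` at position `s`, an entry `1` at position `s + j`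
and `S_{m,j}^i α_{s+i}` at the positions `s + i` with `j < i ≤ k - s`, all other entries zero.
For `s = k + 1 - j` only the `1` at position `s` remains. -/
noncomputable def W (s j k : ℕ) (m : ℕ) (α : ℕ → ℂ) : ℕ → ℂ := fun i =>
  if i = s then 1
  else if s < i ∧ i ≤ k then V1 j (k - s) m (fun t => α (s + t)) (i - s)
  else 0

/-- The parameters `(γ, c, v₁, v₂, …)` for `n = 2q - 1`: `β_{q+1} = c` and `β_{q+1+i} = vᵢ`. -/
def oddParam (q : ℕ) (γ c : ℂ) (v : ℕ → ℂ) : Param :=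
  (γ, fun k => if k = q + 1 then c else v (k - (q + 1)))

/-- The parameters `(γ, v₁, v₂, …)` for `n = 2q`: `β_{q+1+i} = vᵢ`. -/
def evenParam (q : ℕ) (γ : ℂ) (v : ℕ → ℂ) : Param :=
  (γ, fun k => v (k - (q + 1)))

/-- The list for `n = 2q - 1`. A member of the list is the set of all parameters which one
expression denotes, as the sign `δ` and the number `m` of the root of unity vary. Since
`β_{n+1} = v_{q-1}`, a vector `v` of length `q - 2` has the last parameter `0`. -/
def oddList (q : ℕ) : Set (Set Param) :=
  {F | (∃ (b : ℂ) (j : ℕ) (α : ℕ → ℂ), b ≠ 1 / 2 ∧ b ≠ -1 / 2 ∧ 1 ≤ j ∧ j ≤ q - 1 ∧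
        F = {P | ∃ (δ : ℂ) (m : ℕ), (δ = 1 ∨ δ = -1) ∧ m < j ∧
          P = oddParam q 1 (δ * b) (V0 j (q - 2) δ m α)}) ∨
    (∃ (b : ℂ) (j : ℕ) (α : ℕ → ℂ), (b = 1 / 2 ∨ b = -1 / 2) ∧ 1 ≤ j ∧ j ≤ q ∧
        F = {P | ∃ (δ : ℂ) (m : ℕ), (δ = 1 ∨ δ = -1) ∧ m < j ∧
          P = oddParam q 1 (δ * b) (V0 j (q - 1) δ m α)}) ∨
    (∃ (j : ℕ) (α : ℕ → ℂ), 1 ≤ j ∧ j ≤ q - 1 ∧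
        F = {P | ∃ m : ℕ, m < j ∧ P = oddParam q 0 1 (V1 j (q - 2) m α)}) ∨
    (∃ (j s : ℕ) (α : ℕ → ℂ), 1 ≤ j ∧ j ≤ q - 1 ∧ 1 ≤ s ∧ s ≤ q - j ∧
        F = {P | ∃ m : ℕ, m < j ∧ P = oddParam q 0 0 (W s j (q - 1) m α)}) ∨
    F = {(0, 0)}}

/-- The list for `n = 2q`, in the same form. Since `β_{n+1} = v_q`, a vector `v` of length `q - 1`
has the last parameter `0`. -/
def evenList (q : ℕ) : Set (Set Param) :=
  {F | (∃ (j : ℕ) (α : ℕ → ℂ), 1 ≤ j ∧ j ≤ q ∧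
        F = {P | ∃ m : ℕ, m < 2 * j - 1 ∧ P = evenParam q 1 (V2 j (q - 1) m α)}) ∨
    (∃ (j s : ℕ) (α : ℕ → ℂ), 1 ≤ j ∧ j ≤ q ∧ 1 ≤ s ∧ s ≤ q + 1 - j ∧
        F = {P | ∃ m : ℕ, m < j ∧ P = evenParam q 0 (W s j q m α)}) ∨
    F = {(0, 0)}}

/-- The list for `n`. -/
def classList (n : ℕ) : Set (Set Param) :=
  {F | (∃ q : ℕ, n = 2 * q - 1 ∧ Odd n ∧ F ∈ oddList q) ∨ (∃ q : ℕ, n = 2 * q ∧ F ∈ evenList q)}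

end LeibnizSuper

/-! The Leibniz identity says that `R_{[u,v]}` is, up to sign, the supercommutator of `R_v` and
`R_u`. For an odd `y` put `x = [y, y]` and `X = R_x = 2 R_y²`. The operators `X` and `R_y` commute,
so the elements `Xⁱ x` and `Xⁱ y` with `i ≥ 1` act trivially from the right. An algebra of the given
type turns out to have a basis `Xⁱ x`, `Xⁱ y` (`0 ≤ i < n`), `z` with `z` odd, `[z, y] = 0`, `[y, z]
= ψ(X) x` and `[z, z] = γ Xⁿ⁻¹ x`, where `ψ` has no terms of degree `i` with `2i + 1 < n`. All
products are then determined by `ψ` modulo `Xⁿ` and by `γ` (`IsGen.mul_comb`), so equal constants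
give isomorphic algebras (`IsGen.iso`). The algebras `L(γ, β)` realize all such constants.

Existence of such generators (`IsOfType.exists_isGen`). The nilindex equals the dimension, which
forces `dim Lᵏ = 2n + 1 - k` for `k ≥ 2`; thus there are two generators. The characteristic sequence
provides an even `x` with `X` a single block on `L₀` and `Xⁿ = 0` on `L`. If `x ∉ L²`, one generator
is even and one odd, and following the powers downwards leads to a contradiction. If `x ∈ L²`, both
generators are odd, and the coefficient of `x` in `[u, v]` defines a symmetric bilinear form on the
odd part. On the span of the two generators it is nonzero, and it cannot be nondegenerate, since an
isotropic pair would give `L³ = L⁴`. Hence it has rank one: `y` is a nonisotropic vector, and `z`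
spans the radical up to a correction making `[z, y] = 0`. The vanishing of `R_z²` and of `R_y R_z +
R_z R_y` restricts `ψ` and `[z, z]`.

Isomorphism. Another normalized pair has the form `y' = a y + b z + ⋯`, `z' = d z + ⋯`. Comparing
products yields `a^{2i+1} ψ'_i = d ψ_i` for `i < n - 1`, `a^{2n} γ' = d² γ`, and one equation for
the last coefficient, into which `b` enters multiplied by `γ - ψ_{(n-1)/2}²` for odd `n` and by `γ`
for even `n` (`changeRel_iff`, `iso_family_iff`). If this factor is nonzero, `b` removes the last
parameter; otherwise `b` has no effect. What remains is the action `γ ↦ u² γ`, `β_k ↦ u t^{2k-n-3}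
β_k` of a two-dimensional torus (`ParamRel.orbit`).

Normal forms. One makes `γ` equal to `0` or `1` and the leading entries equal to `1`. The torus
elements which keep these normalizations are governed by signs and roots of unity, so the normalized
points of one orbit are exactly one family of the list (`mem_classList_iff`). Two families either
coincide or lie in different orbits. -/

namespace LeibnizSuper

/-! ### Right multiplications in a Leibniz superalgebra -/

section General

variable {L : Type*} [AddCommGroup L] [Module ℂ L] {M : Type*} [AddCommGroup M] [Module ℂ M]

/-- Right multiplication `R_v = [·, v]`. -/
abbrev R (A : SuperProduct L) : L →ₗ[ℂ] Module.End ℂ L := A.mul.flip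

namespace IsLeibniz

variable {A : SuperProduct L} (hA : IsLeibniz A)
include hA

theorem odd_odd_mem {u v : L} (hu : u ∈ A.part 1) (hv : v ∈ A.part 1) : A.mul u v ∈ A.part 0 :=
  hA.mul_mem 1 1 u v hu hv

theorem odd_even_mem {u v : L} (hu : u ∈ A.part 1) (hv : v ∈ A.part 0) : A.mul u v ∈ A.part 1 :=
  hA.mul_mem 1 0 u v hu hv

theorem even_odd_mem {u v : L} (hu : u ∈ A.part 0) (hv : v ∈ A.part 1) : A.mul u v ∈ A.part 1 :=
  hA.mul_mem 0 1 u v hu hv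

theorem even_even_mem {u v : L} (hu : u ∈ A.part 0) (hv : v ∈ A.part 0) : A.mul u v ∈ A.part 0 :=
  hA.mul_mem 0 0 u v hu hv

theorem mul_even_mem {a : ZMod 2} {u v : L} (hu : u ∈ A.part a) (hv : v ∈ A.part 0) :
    A.mul u v ∈ A.part a := by
  simpa using hA.mul_mem a 0 u v hu hv

/-- This and `R_mul_even` are the Leibniz identity read as an identity of operators; all later
computations use it in this form. -/
theorem R_mul_odd_odd {u v : L} (hu : u ∈ A.part 1) (hv : v ∈ A.part 1) :
    R A (A.mul u v) = R A v * R A u + R A u * R A v := by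
  ext w
  have := hA.leibniz 1 1 w u v hu hv
  have h1 : (1 : ZMod 2).val = 1 := rfl
  simpa [h1] using this

theorem R_mul_even {a : ZMod 2} {u v : L} (hu : u ∈ A.part a) (hv : v ∈ A.part 0) :
    R A (A.mul u v) = R A v * R A u - R A u * R A v := by
  ext w
  have := hA.leibniz a 0 w u v hu hv
  simpa using this

theorem disjoint {v : L} (h0 : v ∈ A.part 0) (h1 : v ∈ A.part 1) : v = 0 :=
  Submodule.disjoint_def.1 hA.isCompl.disjoint v h0 h1

theorem exists_add (v : L) : ∃ u ∈ A.part 0, ∃ w ∈ A.part 1, u + w = v :=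
  Submodule.mem_sup.1 (hA.isCompl.sup_eq_top ▸ Submodule.mem_top)

end IsLeibniz

/-- The action of a polynomial in the right multiplication by `[y, y]`. -/
noncomputable abbrev polyAct (A : SuperProduct L) (y : L) : Polynomial ℂ →ₐ[ℂ] Module.End ℂ L :=
  Polynomial.aeval (R A (A.mul y y))

theorem aeval_apply_mem {f : Module.End ℂ L} {N : Submodule ℂ L} (h : ∀ v ∈ N, f v ∈ N)
    (p : Polynomial ℂ) {v : L} (hv : v ∈ N) : Polynomial.aeval f p v ∈ N := by
  induction p using Polynomial.induction_on' with
  | add p q hp hq => simpa using N.add_mem hp hq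
  | monomial k c =>
    rw [Polynomial.aeval_monomial]
    have : (f ^ k) v ∈ N := by
      induction k with
      | zero => simpa
      | succ k ih => rw [pow_succ']; exact h _ ih
    simpa [Module.algebraMap_end_apply] using N.smul_mem c this

theorem aeval_commute {f g : Module.End ℂ L} (h : Commute f g) (p : Polynomial ℂ) :
    Commute (Polynomial.aeval f p) g := by
  induction p using Polynomial.induction_on' with
  | add p q hp hq => simpa using hp.add_left hq
  | monomial k c =>
    rw [Polynomial.aeval_monomial]
    exact (Algebra.commute_algebraMap_left _ _).mul_left (h.pow_left k)

namespace IsLeibniz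

variable {A : SuperProduct L} (hA : IsLeibniz A) {y : L} (hy : y ∈ A.part 1)
include hA

/-- Polynomials without constant term in an even right multiplication kill the right
multiplication by a homogeneous element which commutes with it. -/
theorem R_aeval {a : ZMod 2} {x v : L} (hx : x ∈ A.part 0) (hv : v ∈ A.part a)
    (h : Commute (R A x) (R A v)) (p : Polynomial ℂ) :
    R A (Polynomial.aeval (R A x) p v) = p.coeff 0 • R A v := by
  have key : ∀ k : ℕ, ((R A x) ^ k) v ∈ A.part a ∧
      R A (((R A x) ^ k) v) = if k = 0 then R A v else 0 := by
    intro k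
    induction k with
    | zero => simpa
    | succ k ih =>
      obtain ⟨h1, h2⟩ := ih
      have e : ((R A x) ^ (k + 1)) v = A.mul (((R A x) ^ k) v) x := by
        rw [pow_succ']; rfl
      rw [e]
      refine ⟨hA.mul_even_mem h1 hx, ?_⟩
      rw [hA.R_mul_even h1 hx, h2]
      rw [if_neg (Nat.succ_ne_zero k)]
      -- For `k = 0` the commutator of `R_x` with `R_v` vanishes by hypothesis; for `k > 0` the
      -- right multiplication by `R_xᵏ v` is already zero.
      split_ifs
      · rw [h.eq, sub_self]
      · simp
  induction p using Polynomial.induction_on' with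
  | add p q hp hq => simp [add_smul, hp, hq]
  | monomial k c =>
    rw [Polynomial.aeval_monomial]
    have := (key k).2
    rw [Module.End.mul_apply, Module.algebraMap_end_apply, map_smul, this,
      Polynomial.coeff_monomial]
    split_ifs <;> simp

include hy

theorem sq_mem : A.mul y y ∈ A.part 0 := hA.odd_odd_mem hy hy

theorem R_sq : R A (A.mul y y) = (2 : ℂ) • (R A y * R A y) := by
  rw [hA.R_mul_odd_odd hy hy, two_smul]

theorem commute_sq : Commute (R A (A.mul y y)) (R A y) := by
  rw [hA.R_sq hy]
  exact Commute.smul_left (Commute.mul_left (Commute.refl _) (Commute.refl _)) _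

theorem R_polyAct_left (p : Polynomial ℂ) : R A (polyAct A y p y) = p.coeff 0 • R A y :=
  hA.R_aeval (hA.sq_mem hy) hy (hA.commute_sq hy) p

theorem R_polyAct_sq (p : Polynomial ℂ) :
    R A (polyAct A y p (A.mul y y)) = p.coeff 0 • R A (A.mul y y) :=
  hA.R_aeval (hA.sq_mem hy) (hA.sq_mem hy) (Commute.refl _) p

theorem polyAct_mem {a : ZMod 2} (p : Polynomial ℂ) {v : L} (hv : v ∈ A.part a) :
    polyAct A y p v ∈ A.part a :=
  aeval_apply_mem (f := R A (A.mul y y)) (N := A.part a)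
    (fun u (h : u ∈ A.part a) => hA.mul_even_mem h (hA.sq_mem hy)) p hv

end IsLeibniz

/-- The element `p(X) [y, y] + q(X) y + b z`, where `X` is the right multiplication by `[y, y]`. -/
noncomputable def comb (A : SuperProduct L) (y z : L) (p q : Polynomial ℂ) (b : ℂ) : L :=
  polyAct A y p (A.mul y y) + polyAct A y q y + b • z

/-- Normalized odd generators `y`, `z` of a superalgebra of dimension `2n + 1`. With `x = [y, y]`
and `X = [·, x]` the remaining structure is given by `[y, z] = ψ(X) x` and `[z, z] = γ Xⁿ⁻¹ x`. -/
structure IsGen (A : SuperProduct L) (n : ℕ) (y z : L) (ψ : Polynomial ℂ) (γ : ℂ) : Prop where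
  left_mem : y ∈ A.part 1
  right_mem : z ∈ A.part 1
  mul_right_left : A.mul z y = 0
  mul_left_right : A.mul y z = polyAct A y ψ (A.mul y y)
  mul_right_right : A.mul z z = γ • polyAct A y (Polynomial.X ^ (n - 1)) (A.mul y y)
  nilpotent : polyAct A y (Polynomial.X ^ n) y = 0
  span : ∀ v : L, ∃ p q b, v = comb A y z p q b
  coeff_eq_zero : ∀ i, 2 * i + 1 < n → ψ.coeff i = 0
  finrank : Module.finrank ℂ L = 2 * n + 1

/-! ### The multiplication table of a normalized pair of generators -/

namespace IsGen

variable {A : SuperProduct L} {n : ℕ} {y z : L} {ψ : Polynomial ℂ} {γ : ℂ}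

section

variable (hA : IsLeibniz A) (h : IsGen A n y z ψ γ) (hn : 2 ≤ n)
include h

theorem R_left_right : R A y z = 0 := h.mul_right_left

include hA

theorem R_sq_right : R A (A.mul y y) z = 0 := by
  rw [hA.R_sq h.left_mem]
  simp [h.mul_right_left]

theorem R_left_polyAct (p : Polynomial ℂ) (v : L) :
    R A y (polyAct A y p v) = polyAct A y p (R A y v) :=
  (LinearMap.congr_fun (aeval_commute (hA.commute_sq h.left_mem) p).eq v).symm

theorem nilpotent_sq : polyAct A y (Polynomial.X ^ n) (A.mul y y) = 0 := by
  have : A.mul y y = R A y y := rfl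
  rw [this, ← h.R_left_polyAct hA, h.nilpotent, map_zero]

theorem R_left_sq : R A y (A.mul y y) = (1 / 2 : ℂ) • polyAct A y Polynomial.X y := by
  rw [Polynomial.aeval_X, hA.R_sq h.left_mem]
  simp

theorem polyAct_of_dvd {p : Polynomial ℂ} (hp : Polynomial.X ^ n ∣ p) :
    polyAct A y p y = 0 ∧ polyAct A y p (A.mul y y) = 0 := by
  obtain ⟨r, rfl⟩ := hp
  rw [mul_comm, map_mul]
  simp only [Module.End.mul_apply]
  rw [h.nilpotent, h.nilpotent_sq hA]
  simp

/-- `X = 2 R_y²` kills `z` because `[z, y] = 0`, so only the constant term acts. -/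
theorem polyAct_right (p : Polynomial ℂ) : polyAct A y p z = p.coeff 0 • z := by
  conv_lhs => rw [← Polynomial.divX_mul_X_add p]
  rw [map_add, map_mul, Polynomial.aeval_X, Polynomial.aeval_C, LinearMap.add_apply,
    Module.End.mul_apply, h.R_sq_right hA, map_zero, zero_add, Module.algebraMap_end_apply]

/-- From the right only the classes of `x`, `y` and `z` count: multiples of `X` act trivially. This
is why products depend on the second factor through three numbers. -/
theorem R_comb (p q : Polynomial ℂ) (b : ℂ) : R A (comb A y z p q b) =
    p.coeff 0 • R A (A.mul y y) + q.coeff 0 • R A y + b • R A z := by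
  rw [comb, map_add, map_add, map_smul, hA.R_polyAct_sq h.left_mem, hA.R_polyAct_left h.left_mem]

theorem polyAct_comb (r p q : Polynomial ℂ) (b : ℂ) :
    polyAct A y r (comb A y z p q b) = comb A y z (r * p) (r * q) (r.coeff 0 * b) := by
  rw [comb, comb, map_add, map_add, map_smul, h.polyAct_right hA, map_mul, map_mul, smul_smul,
    mul_comm b]
  rfl

include hn

omit hA in
theorem coeff_zero : ψ.coeff 0 = 0 := h.coeff_eq_zero 0 (by omega)

/-- The element `[y, z] = ψ(X) x` acts trivially from the right since `ψ` has no constant term. -/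
theorem anticommute : R A z * R A y = -(R A y * R A z) := by
  have := hA.R_mul_odd_odd h.left_mem h.right_mem
  rw [h.mul_left_right, hA.R_polyAct_sq h.left_mem, h.coeff_zero hn, zero_smul] at this
  exact eq_neg_of_add_eq_zero_left this.symm

theorem R_right_sq_eq_zero : R A z * R A z = 0 := by
  have := hA.R_mul_odd_odd h.right_mem h.right_mem
  rw [h.mul_right_right, map_smul, hA.R_polyAct_sq h.left_mem, Polynomial.coeff_X_pow,
    if_neg (by omega), zero_smul, smul_zero] at this
  have h2 : (2 : ℂ) • (R A z * R A z) = 0 := by rw [two_smul, ← this]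
  simpa using h2

theorem commute_right : Commute (R A (A.mul y y)) (R A z) := by
  have e := h.anticommute hA hn
  rw [hA.R_sq h.left_mem]
  refine Commute.smul_left ?_ _
  change R A y * R A y * R A z = R A z * (R A y * R A y)
  rw [← mul_assoc, e, neg_mul, mul_assoc (R A y) (R A z), e, mul_assoc]
  simp

theorem R_right_polyAct (p : Polynomial ℂ) (v : L) :
    R A z (polyAct A y p v) = polyAct A y p (R A z v) :=
  (LinearMap.congr_fun (aeval_commute (h.commute_right hA hn) p).eq v).symm

/-- Move `R_z` past `R_y` in `[x, z] = R_z R_y y` and use `[y, z] = ψ(X) x`. -/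
theorem R_right_sq : R A z (A.mul y y) = (-1 / 2 : ℂ) • polyAct A y (ψ * Polynomial.X) y := by
  have e : R A z (A.mul y y) = -(R A y (R A z y)) :=
    LinearMap.congr_fun (h.anticommute hA hn) y
  have e2 : R A z y = polyAct A y ψ (A.mul y y) := h.mul_left_right
  rw [e, e2, h.R_left_polyAct hA, h.R_left_sq hA, map_mul, Module.End.mul_apply, map_smul,
    ← neg_smul]
  congr 1
  norm_num

/-- The full product in coordinates. Only `ψ`, `γ` and `n` occur, so these constants determine the
algebra. -/
theorem mul_comb (p q p' q' : Polynomial ℂ) (b b' : ℂ) :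
    A.mul (comb A y z p q b) (comb A y z p' q' b') =
      comb A y z (Polynomial.C (p'.coeff 0) * (Polynomial.X * p) + Polynomial.C (q'.coeff 0) * q +
          Polynomial.C b' * (q * ψ + Polynomial.C (b * γ) * Polynomial.X ^ (n - 1)))
        (Polynomial.C (p'.coeff 0) * (Polynomial.X * q) +
          Polynomial.C (q'.coeff 0 / 2) * (p * Polynomial.X) -
          Polynomial.C (b' / 2) * (p * (ψ * Polynomial.X))) 0 := by
  change R A (comb A y z p' q' b') (comb A y z p q b) = _
  have e2 : R A z y = polyAct A y ψ (A.mul y y) := h.mul_left_right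
  have e3 : R A z z = γ • polyAct A y (Polynomial.X ^ (n - 1)) (A.mul y y) := h.mul_right_right
  have e4 : R A y y = A.mul y y := rfl
  have e5 := h.polyAct_comb hA Polynomial.X p q b
  rw [Polynomial.aeval_X] at e5
  rw [h.R_comb hA, LinearMap.add_apply, LinearMap.add_apply, LinearMap.smul_apply,
    LinearMap.smul_apply, LinearMap.smul_apply, e5]
  simp only [comb, map_add, map_smul, h.R_left_polyAct hA, h.R_right_polyAct hA hn, e2, e3, e4,
    h.R_left_sq hA, h.R_right_sq hA hn, h.R_left_right, smul_zero, add_zero, map_mul, map_sub,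
    Polynomial.aeval_C, Module.End.mul_apply, LinearMap.add_apply, LinearMap.sub_apply,
    Module.algebraMap_end_apply, Polynomial.coeff_X_zero, zero_mul, zero_smul, smul_add, smul_smul]
  module

end

end IsGen

end General

end LeibnizSuper

namespace LeibnizSuper

/-! ### Coordinates with respect to normalized generators -/

section General

variable {L : Type*} [AddCommGroup L] [Module ℂ L] {M : Type*} [AddCommGroup M] [Module ℂ M]

theorem zmod_two_eq : ∀ a : ZMod 2, a = 0 ∨ a = 1 := by decide

theorem X_pow_dvd_sub_sum (n : ℕ) (p : Polynomial ℂ) :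
    Polynomial.X ^ n ∣ p - ∑ i : Fin n, Polynomial.C (p.coeff i) * Polynomial.X ^ (i : ℕ) := by
  rw [Polynomial.X_pow_dvd_iff]
  intro d hd
  simp only [Polynomial.coeff_sub, Polynomial.finsetSum_coeff, Polynomial.coeff_C_mul,
    Polynomial.coeff_X_pow]
  rw [Finset.sum_eq_single (⟨d, hd⟩ : Fin n)]
  · simp
  · intro b _ hb
    rw [if_neg (fun h => hb (Fin.ext h.symm)), mul_zero]
  · simp

theorem comb_sub (A : SuperProduct L) (y z : L) (p q p' q' : Polynomial ℂ) (b b' : ℂ) :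
    comb A y z p q b - comb A y z p' q' b' = comb A y z (p - p') (q - q') (b - b') := by
  simp only [comb, map_sub, LinearMap.sub_apply, sub_smul]
  abel

theorem comb_add (A : SuperProduct L) (y z : L) (p q p' q' : Polynomial ℂ) (b b' : ℂ) :
    comb A y z p q b + comb A y z p' q' b' = comb A y z (p + p') (q + q') (b + b') := by
  simp only [comb, map_add, LinearMap.add_apply, add_smul]
  abel

theorem comb_smul (A : SuperProduct L) (y z : L) (p q : Polynomial ℂ) (b c : ℂ) :
    c • comb A y z p q b = comb A y z (Polynomial.C c * p) (Polynomial.C c * q) (c * b) := by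
  simp only [comb, map_mul, Polynomial.aeval_C, Module.End.mul_apply, Module.algebraMap_end_apply,
    smul_add, smul_smul]

theorem comb_zero_zero_one (A : SuperProduct L) (y z : L) : comb A y z 0 0 1 = z := by
  simp [comb]

theorem comb_zero_one_zero (A : SuperProduct L) (y z : L) : comb A y z 0 1 0 = y := by
  simp [comb]

namespace IsGen

variable {A : SuperProduct L} {n : ℕ} {y z : L} {ψ : Polynomial ℂ} {γ : ℂ}

/-- The vectors `Xⁱ [y, y]`, `Xⁱ y`, `z`. -/
noncomputable def basisVec (A : SuperProduct L) (n : ℕ) (y z : L) : Fin n ⊕ (Fin n ⊕ Unit) → L :=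
  Sum.elim (fun i => polyAct A y (Polynomial.X ^ (i : ℕ)) (A.mul y y))
    (Sum.elim (fun i => polyAct A y (Polynomial.X ^ (i : ℕ)) y) fun _ => z)

section

variable (hA : IsLeibniz A) (h : IsGen A n y z ψ γ)
include hA h

theorem polyAct_eq_sum (p : Polynomial ℂ) :
    polyAct A y p y = ∑ i : Fin n, p.coeff i • polyAct A y (Polynomial.X ^ (i : ℕ)) y ∧
    polyAct A y p (A.mul y y) =
      ∑ i : Fin n, p.coeff i • polyAct A y (Polynomial.X ^ (i : ℕ)) (A.mul y y) := by
  have := h.polyAct_of_dvd hA (X_pow_dvd_sub_sum n p)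
  simpa only [map_sub, map_sum, LinearMap.sub_apply, LinearMap.sum_apply, map_mul,
    Polynomial.aeval_C, Module.End.mul_apply, Module.algebraMap_end_apply, sub_eq_zero] using this

theorem comb_eq_sum (p q : Polynomial ℂ) (b : ℂ) : comb A y z p q b =
    ∑ i, (Sum.elim (fun i : Fin n => p.coeff i)
      (Sum.elim (fun i : Fin n => q.coeff i) fun _ : Unit => b) i) • basisVec A n y z i := by
  rw [comb, (h.polyAct_eq_sum hA p).2, (h.polyAct_eq_sum hA q).1]
  simp [basisVec, add_assoc]

theorem top_le_span : ⊤ ≤ Submodule.span ℂ (Set.range (basisVec A n y z)) := by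
  intro v _
  obtain ⟨p, q, b, rfl⟩ := h.span v
  rw [h.comb_eq_sum hA]
  exact Submodule.sum_mem _ fun i _ => Submodule.smul_mem _ _ (Submodule.subset_span ⟨i, rfl⟩)

/-- The `2n + 1` vectors span a space of dimension `2n + 1`. -/
theorem linearIndependent : LinearIndependent ℂ (basisVec A n y z) :=
  linearIndependent_of_top_le_span_of_card_eq_finrank (h.top_le_span hA)
    (by simp [h.finrank]; omega)

/-- The basis formed by `Xⁱ [y, y]`, `Xⁱ y`, `z`. -/
noncomputable def basis : Module.Basis (Fin n ⊕ (Fin n ⊕ Unit)) ℂ L :=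
  Module.Basis.mk (h.linearIndependent hA) (h.top_le_span hA)

theorem comb_eq_zero_iff {p q : Polynomial ℂ} {b : ℂ} :
    comb A y z p q b = 0 ↔ Polynomial.X ^ n ∣ p ∧ Polynomial.X ^ n ∣ q ∧ b = 0 := by
  constructor
  · intro h0
    rw [h.comb_eq_sum hA] at h0
    have := Fintype.linearIndependent_iff.1 (h.linearIndependent hA) _ h0
    refine ⟨Polynomial.X_pow_dvd_iff.2 fun d hd => this (Sum.inl ⟨d, hd⟩),
      Polynomial.X_pow_dvd_iff.2 fun d hd => this (Sum.inr (Sum.inl ⟨d, hd⟩)),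
      this (Sum.inr (Sum.inr ()))⟩
  · rintro ⟨hp, hq, rfl⟩
    rw [comb, (h.polyAct_of_dvd hA hp).2, (h.polyAct_of_dvd hA hq).1]
    simp

theorem comb_eq_iff {p q p' q' : Polynomial ℂ} {b b' : ℂ} :
    comb A y z p q b = comb A y z p' q' b' ↔
      Polynomial.X ^ n ∣ p - p' ∧ Polynomial.X ^ n ∣ q - q' ∧ b = b' := by
  rw [← sub_eq_zero, comb_sub, h.comb_eq_zero_iff hA, sub_eq_zero (a := b)]

theorem comb_even_mem (p : Polynomial ℂ) : comb A y z p 0 0 ∈ A.part 0 := by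
  simpa [comb] using hA.polyAct_mem h.left_mem p (hA.sq_mem h.left_mem)

theorem comb_odd_mem (q : Polynomial ℂ) (b : ℂ) : comb A y z 0 q b ∈ A.part 1 := by
  simpa [comb] using Submodule.add_mem _ (hA.polyAct_mem h.left_mem q h.left_mem)
    (Submodule.smul_mem _ b h.right_mem)

theorem exists_odd {v : L} (hv : v ∈ A.part 1) : ∃ q b, v = comb A y z 0 q b := by
  obtain ⟨p, q, b, rfl⟩ := h.span v
  refine ⟨q, b, ?_⟩
  have e : comb A y z p q b - comb A y z 0 q b = comb A y z p 0 0 := by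
    rw [comb_sub]; simp
  rw [← sub_eq_zero]
  refine hA.disjoint ?_ (Submodule.sub_mem _ hv (h.comb_odd_mem hA q b))
  rw [e]
  exact h.comb_even_mem hA p

end

/-- Superalgebras with the same structure constants are isomorphic. -/
theorem iso {B : SuperProduct M} {y' z' : M} (hA : IsLeibniz A) (hB : IsLeibniz B) (hn : 2 ≤ n)
    (h : IsGen A n y z ψ γ) (h' : IsGen B n y' z' ψ γ) : Iso A B := by
  let f := (h.basis hA).equiv (h'.basis hB) (Equiv.refl _)
  have hf : ∀ p q b, f (comb A y z p q b) = comb B y' z' p q b := by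
    intro p q b
    rw [h.comb_eq_sum hA, h'.comb_eq_sum hB, map_sum]
    refine Finset.sum_congr rfl fun i _ => ?_
    rw [map_smul]
    congr 1
    have e1 : basisVec A n y z i = h.basis hA i := by simp [basis]
    have e2 : basisVec B n y' z' i = h'.basis hB i := by simp [basis]
    rw [e1, e2]
    simp [f]
  refine ⟨f, ?_, ?_⟩
  · intro a v hv
    obtain ⟨p, q, b, rfl⟩ := h.span v
    rw [hf]
    have hs : comb A y z p q b = comb A y z p 0 0 + comb A y z 0 q b := by rw [comb_add]; simp
    have hs' : comb B y' z' p q b = comb B y' z' p 0 0 + comb B y' z' 0 q b := by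
      rw [comb_add]; simp
    have h0 := h.comb_even_mem hA p
    have h1 := h.comb_odd_mem hA q b
    have h0' := h'.comb_even_mem hB p
    have h1' := h'.comb_odd_mem hB q b
    obtain rfl | rfl := zmod_two_eq a
    -- The component of the wrong parity vanishes in the first algebra. The criterion for this
    -- involves only `p`, `q`, `b`, so the corresponding component vanishes in the second algebra as
    -- well.
    · have : comb A y z 0 q b = 0 := by
        refine hA.disjoint ?_ h1
        rw [hs] at hv
        exact (Submodule.add_mem_iff_right _ h0).1 hv
      have h2 := (h.comb_eq_zero_iff hA).1 this
      rw [hs', (h'.comb_eq_zero_iff hB).2 h2, add_zero]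
      exact h0'
    · have : comb A y z p 0 0 = 0 := by
        refine hA.disjoint h0 ?_
        rw [hs] at hv
        exact (Submodule.add_mem_iff_left _ h1).1 hv
      have h2 := (h.comb_eq_zero_iff hA).1 this
      rw [hs', (h'.comb_eq_zero_iff hB).2 h2, zero_add]
      exact h1'
  · intro u v
    obtain ⟨p, q, b, rfl⟩ := h.span u
    obtain ⟨p', q', b', rfl⟩ := h.span v
    rw [h.mul_comb hA hn, hf, hf, hf, h'.mul_comb hB hn]

/-- Normalized generators are transported by isomorphisms. -/
theorem map {B : SuperProduct M} (h : IsGen A n y z ψ γ) (f : L ≃ₗ[ℂ] M)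
    (hf : ∀ (a : ZMod 2) (x : L), x ∈ A.part a → f x ∈ B.part a)
    (hm : ∀ u v : L, f (A.mul u v) = B.mul (f u) (f v)) : IsGen B n (f y) (f z) ψ γ := by
  have hp : ∀ (p : Polynomial ℂ) (v : L), f (polyAct A y p v) = polyAct B (f y) p (f v) := by
    intro p v
    induction p using Polynomial.induction_on' generalizing v with
    | add p q hp hq => simp [hp, hq]
    | monomial k c =>
      have : f (((R A (A.mul y y)) ^ k) v) = ((R B (B.mul (f y) (f y))) ^ k) (f v) := by
        induction k with
        | zero => simp
        | succ k ih =>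
          rw [pow_succ', pow_succ', Module.End.mul_apply, Module.End.mul_apply, ← ih, ← hm]
          exact hm _ _
      rw [Polynomial.aeval_monomial, Polynomial.aeval_monomial]
      simp [Module.algebraMap_end_apply, this]
  have hc : ∀ p q b, f (comb A y z p q b) = comb B (f y) (f z) p q b := by
    intro p q b
    simp only [comb, map_add, map_smul, hp, hm]
  refine ⟨hf _ _ h.left_mem, hf _ _ h.right_mem, ?_, ?_, ?_, ?_, ?_, h.coeff_eq_zero, ?_⟩
  · rw [← hm, h.mul_right_left, map_zero]
  · rw [← hm, h.mul_left_right, hp, hm]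
  · rw [← hm, h.mul_right_right, map_smul, hp, hm]
  · rw [← hp, h.nilpotent, map_zero]
  · intro v
    obtain ⟨p, q, b, e⟩ := h.span (f.symm v)
    exact ⟨p, q, b, by rw [← hc, ← e, f.apply_symm_apply]⟩
  · rw [← f.finrank_eq, h.finrank]

end IsGen

end General

end LeibnizSuper

namespace LeibnizSuper

/-! ### Change of generators -/

section General

variable {L : Type*} [AddCommGroup L] [Module ℂ L]

theorem polyAct_eq_comp {A : SuperProduct L} {y y' : L} {s : ℂ}
    (h : R A (A.mul y' y') = s • R A (A.mul y y)) (p : Polynomial ℂ) :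
    polyAct A y' p = polyAct A y (p.comp (Polynomial.C s * Polynomial.X)) := by
  rw [Polynomial.aeval_comp, polyAct, h]
  congr 1
  simp [Algebra.smul_def]

/-- A polynomial with nonzero constant term is a unit modulo `Xⁿ`. -/
theorem dvd_of_X_pow_dvd_mul {n : ℕ} {p q : Polynomial ℂ} (hq : q.coeff 0 ≠ 0)
    (h : Polynomial.X ^ n ∣ q * p) : Polynomial.X ^ n ∣ p := by
  refine Polynomial.prime_X.pow_dvd_of_dvd_mul_left n ?_ h
  rwa [Polynomial.X_dvd_iff]

/-- The relation between the structure constants for two normalized pairs of generators, the new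
pair being `a y + b z + ⋯`, `d z + ⋯`. -/
def ChangeRel (n : ℕ) (ψ : Polynomial ℂ) (γ : ℂ) (ψ' : Polynomial ℂ) (γ' a b d : ℂ) : Prop :=
  γ' * a ^ (2 * n) = d ^ 2 * γ ∧ Polynomial.X ^ n ∣
    Polynomial.C d * (Polynomial.C a * ψ + Polynomial.C (b * γ) * Polynomial.X ^ (n - 1)) -
      ψ'.comp (Polynomial.C (a ^ 2) * Polynomial.X) *
        (Polynomial.C (a ^ 2) + Polynomial.C (a * b) * ψ)

theorem comb_zero_left (A : SuperProduct L) (y z : L) (q : Polynomial ℂ) :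
    comb A y z 0 q 0 = polyAct A y q y := by
  simp [comb]

namespace IsGen

variable {A : SuperProduct L} {n : ℕ} {y z : L} {ψ : Polynomial ℂ} {γ : ℂ}

theorem X_dvd (hn : 2 ≤ n) (h : IsGen A n y z ψ γ) : Polynomial.X ∣ ψ :=
  Polynomial.X_dvd_iff.2 (h.coeff_zero hn)

theorem mul_odd (hA : IsLeibniz A) (h : IsGen A n y z ψ γ) (hn : 2 ≤ n) (q q' : Polynomial ℂ)
    (b b' : ℂ) : A.mul (comb A y z 0 q b) (comb A y z 0 q' b') =
      comb A y z (Polynomial.C (q'.coeff 0) * q +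
        Polynomial.C b' * (q * ψ + Polynomial.C (b * γ) * Polynomial.X ^ (n - 1))) 0 0 := by
  rw [h.mul_comb hA hn]
  simp

/-- Only the constant term of the coordinate of the square along `x` matters, and there `ψ` and
`Xⁿ⁻¹` contribute nothing. So the operator `X` is merely rescaled when the generators change. -/
theorem R_sq_odd (hA : IsLeibniz A) (h : IsGen A n y z ψ γ) (hn : 2 ≤ n) (q : Polynomial ℂ)
    (b : ℂ) : R A (A.mul (comb A y z 0 q b) (comb A y z 0 q b)) =
      (q.coeff 0 ^ 2) • R A (A.mul y y) := by
  rw [h.mul_odd hA hn, h.R_comb hA]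
  have := h.coeff_zero hn
  simp [Polynomial.mul_coeff_zero, this, Polynomial.coeff_X_pow, show ¬ (0 = n - 1) by omega, sq]

theorem polyAct_sq_odd (hA : IsLeibniz A) (h : IsGen A n y z ψ γ) (hn : 2 ≤ n)
    (q r : Polynomial ℂ) (b : ℂ) :
    polyAct A (comb A y z 0 q b) r (A.mul (comb A y z 0 q b) (comb A y z 0 q b)) =
      comb A y z (r.comp (Polynomial.C (q.coeff 0 ^ 2) * Polynomial.X) *
        (Polynomial.C (q.coeff 0) * q +
          Polynomial.C b * (q * ψ + Polynomial.C (b * γ) * Polynomial.X ^ (n - 1)))) 0 0 := by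
  rw [polyAct_eq_comp (h.R_sq_odd hA hn q b), h.mul_odd hA hn, h.polyAct_comb hA]
  simp

/-- Any two normalized pairs of generators of one superalgebra are related. -/
theorem exists_changeRel {y' z' : L} {ψ' : Polynomial ℂ} {γ' : ℂ} (hA : IsLeibniz A) (hn : 2 ≤ n)
    (h : IsGen A n y z ψ γ) (h' : IsGen A n y' z' ψ' γ') :
    ∃ a b d : ℂ, a ≠ 0 ∧ d ≠ 0 ∧ ChangeRel n ψ γ ψ' γ' a b d := by
  obtain ⟨q, b, rfl⟩ := h.exists_odd hA h'.left_mem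
  obtain ⟨q', d, rfl⟩ := h.exists_odd hA h'.right_mem
  have hψ := h.coeff_zero hn
  have hψ' := h'.coeff_zero hn
  have hXψ' := h'.X_dvd hn
  have hXX : Polynomial.X ^ n = Polynomial.X * (Polynomial.X : Polynomial ℂ) ^ (n - 1) := by
    rw [← pow_succ']; congr; omega
  -- Otherwise the new operator `X'` would be zero, although `X' y' ≠ 0` because `n ≥ 2`.
  have ha : q.coeff 0 ≠ 0 := by
    intro ha
    have h1 := h.R_sq_odd hA hn q b
    rw [ha, zero_pow two_ne_zero, zero_smul] at h1
    have h2 := (h'.comb_eq_zero_iff hA (p := 0) (q := Polynomial.X) (b := 0)).1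
      (by rw [comb_zero_left, Polynomial.aeval_X, h1, LinearMap.zero_apply])
    have := Polynomial.X_pow_dvd_iff.1 h2.2.1 1 (by omega)
    simp at this
  -- In `[[y, z'], z'] = 0` the coefficient of `X y` is half the square of this number.
  have hc : q'.coeff 0 = 0 := by
    have h1 : A.mul (A.mul (comb A y z 0 1 0) (comb A y z 0 q' d)) (comb A y z 0 q' d) = 0 :=
      LinearMap.congr_fun (h'.R_right_sq_eq_zero hA hn) _
    rw [h.mul_odd hA hn, h.mul_comb hA hn, h.comb_eq_zero_iff hA] at h1
    have h2 := Polynomial.X_pow_dvd_iff.1 h1.2.1 1 (by omega)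
    rw [← mul_assoc] at h2
    have h3 : ((1 : Polynomial ℂ).coeff 0) = 1 := by simp
    simpa [Polynomial.coeff_C_mul, Polynomial.coeff_mul_X, Polynomial.mul_coeff_zero, hψ,
      ← mul_assoc] using h2
  -- If `d = 0`, then `z'` is a polynomial without constant term in `X` applied to `y`. In the
  -- coordinates of the new pair such an element has no component along `z'`, a contradiction.
  have hd : d ≠ 0 := by
    rintro rfl
    obtain ⟨r, rfl⟩ := Polynomial.X_dvd_iff.2 hc
    obtain ⟨s, t, hy⟩ := h'.exists_odd hA h.left_mem
    have h1 : R A (A.mul y y) = ((q.coeff 0 ^ 2)⁻¹) •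
        R A (A.mul (comb A y z 0 q b) (comb A y z 0 q b)) := by
      rw [h.R_sq_odd hA hn, smul_smul, inv_mul_cancel₀ (pow_ne_zero _ ha), one_smul]
    set P := (Polynomial.X * r).comp (Polynomial.C (q.coeff 0 ^ 2)⁻¹ * Polynomial.X) with hP
    have h3 : comb A (comb A y z 0 q b) (comb A y z 0 (Polynomial.X * r) 0) 0 0 1 =
        polyAct A (comb A y z 0 q b) P y := by
      rw [comb_zero_zero_one, comb_zero_left, polyAct_eq_comp h1]
    have h4 := (congrArg (polyAct A (comb A y z 0 q b) P) hy).trans (h'.polyAct_comb hA P _ _ _)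
    rw [h4, h'.comb_eq_iff hA] at h3
    have := h3.2.2
    rw [Polynomial.coeff_zero_eq_eval_zero] at this
    simp [hP] at this
  have e1 := h'.mul_right_left
  rw [h.mul_odd hA hn, h.comb_eq_zero_iff hA] at e1
  have e2 := h'.mul_left_right
  rw [h.mul_odd hA hn, h.polyAct_sq_odd hA hn, h.comb_eq_iff hA] at e2
  have e3 := h'.mul_right_right
  rw [h.mul_odd hA hn, h.polyAct_sq_odd hA hn, comb_smul, h.comb_eq_iff hA] at e3
  replace e1 := e1.1
  replace e2 := e2.1
  replace e3 := e3.1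
  rw [hc, Polynomial.C_0, zero_mul, zero_add] at e2 e3
  refine ⟨q.coeff 0, b, d, ha, hd, ?_, ?_⟩
  -- Multiply the equation for `[z', y'] = 0` by `X`: the term with `Xⁿ⁻¹` disappears and a unit
  -- times `X q'` remains. So `q'` is divisible by `Xⁿ⁻¹`, and `ψ` by `X`.
  · have hq' : Polynomial.X ^ n ∣ q' * ψ := by
      have h1 : Polynomial.X ^ n ∣ (Polynomial.C (q.coeff 0) + Polynomial.C b * ψ) *
          (Polynomial.X * q') := by
        have h2 := (e1.mul_left Polynomial.X).sub
          (Dvd.intro (Polynomial.C (b * (d * γ))) rfl : Polynomial.X ^ n ∣ _)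
        refine h2.trans (dvd_of_eq ?_)
        rw [hXX]
        simp only [Polynomial.C_mul]
        ring
      have h2 := dvd_of_X_pow_dvd_mul (by simp [hψ, ha]) h1
      rw [hXX] at h2 ⊢
      have h3 := (mul_dvd_mul_iff_left Polynomial.X_ne_zero).1 h2
      rw [mul_comm q']
      exact mul_dvd_mul (h.X_dvd hn) h3
    have h1 := Polynomial.X_pow_dvd_iff.1 e3 (n - 1) (by omega)
    have h2 := Polynomial.X_pow_dvd_iff.1 hq' (n - 1) (by omega)
    have h3 : ((Polynomial.X : Polynomial ℂ) ^ (n - 1)).comp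
        (Polynomial.C (q.coeff 0 ^ 2) * Polynomial.X) =
        Polynomial.C ((q.coeff 0 ^ 2) ^ (n - 1)) * Polynomial.X ^ (n - 1) := by
      simp [mul_pow]
    rw [h3] at h1
    have h4 : ∀ (s : ℂ) (r : Polynomial ℂ),
        (Polynomial.C s * Polynomial.X ^ (n - 1) * r).coeff (n - 1) = s * r.coeff 0 := by
      intro s r
      rw [mul_assoc, Polynomial.coeff_C_mul]
      congr 1
      simpa using Polynomial.coeff_X_pow_mul r (n - 1) 0
    have h5 : ((Polynomial.X : Polynomial ℂ) ^ (n - 1)).coeff 0 = 0 := by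
      rw [Polynomial.coeff_X_pow, if_neg (by omega)]
    rw [Polynomial.coeff_sub, Polynomial.coeff_C_mul, Polynomial.coeff_add, h2,
      Polynomial.coeff_C_mul, Polynomial.coeff_C_mul, h4,
      Polynomial.coeff_X_pow, if_pos rfl] at h1
    simp only [Polynomial.coeff_add, Polynomial.mul_coeff_zero, Polynomial.coeff_C_zero, hψ,
      h5] at h1
    have h6 : q.coeff 0 ^ (2 * n) = (q.coeff 0 ^ 2) ^ (n - 1) * q.coeff 0 ^ 2 := by
      rw [← pow_mul, ← pow_add]; congr 1; omega
    rw [h6]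
    linear_combination -h1
  -- As `q` is a unit modulo `Xⁿ`, the relation may be multiplied by `q`. The result differs from
  -- `a` times the equation for `[y', z']` only by multiples of `Xⁿ⁻¹ (a - q)` and `Xⁿ⁻¹ ψ'(a² X)`,
  -- which are divisible by `Xⁿ`.
  · refine dvd_of_X_pow_dvd_mul ha ?_
    obtain ⟨r, hr⟩ : Polynomial.X ∣ ψ'.comp (Polynomial.C (q.coeff 0 ^ 2) * Polynomial.X) := by
      rw [Polynomial.X_dvd_iff, Polynomial.coeff_zero_eq_eval_zero, Polynomial.eval_comp]
      simpa [← Polynomial.coeff_zero_eq_eval_zero] using hψ'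
    obtain ⟨s, hs⟩ : Polynomial.X ∣ Polynomial.C (q.coeff 0) - q := by
      rw [Polynomial.X_dvd_iff]; simp
    have h1 := (e2.mul_left (Polynomial.C (q.coeff 0))).sub
      (Dvd.intro (Polynomial.C (d * (b * γ)) * s - Polynomial.C (q.coeff 0 * b * (b * γ)) * r) rfl :
        Polynomial.X ^ n ∣ _)
    refine h1.trans (dvd_of_eq ?_)
    rw [hXX]
    simp only [Polynomial.C_mul, Polynomial.C_pow] at hr ⊢
    rw [hr]
    linear_combination
      (Polynomial.C d * Polynomial.C b * Polynomial.C γ * Polynomial.X ^ (n - 1)) * hs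

/-- Related structure constants occur for a pair of generators of the same superalgebra. -/
theorem of_changeRel (hA : IsLeibniz A) (hn : 2 ≤ n) (h : IsGen A n y z ψ γ) {a b d : ℂ}
    (ha : a ≠ 0) (hd : d ≠ 0) {ψ' : Polynomial ℂ} {γ' : ℂ}
    (hψ' : ∀ i, 2 * i + 1 < n → ψ'.coeff i = 0) (hr : ChangeRel n ψ γ ψ' γ' a b d) :
    ∃ y' z', IsGen A n y' z' ψ' γ' := by
  obtain ⟨hγ, hr⟩ := hr
  -- The new pair is `a y + b z` and `t(X) y + d z`. The summand `t` cancels the contribution `b d γ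
  -- Xⁿ⁻¹ x` of `[z, z]` to `[z', y']`.
  set t : Polynomial ℂ := Polynomial.C (-(b * d * γ / a)) * Polynomial.X ^ (n - 1) with ht
  set q : Polynomial ℂ := Polynomial.C a with hq
  have hq0 : q.coeff 0 = a := by simp [hq]
  have ht0 : t.coeff 0 = 0 := by
    rw [ht, Polynomial.coeff_C_mul, Polynomial.coeff_X_pow, if_neg (by omega), mul_zero]
  have hψ := h.coeff_zero hn
  have hXX : Polynomial.X ^ n = Polynomial.X * (Polynomial.X : Polynomial ℂ) ^ (n - 1) := by
    rw [← pow_succ']; congr; omega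
  obtain ⟨ρ, hρ⟩ := h.X_dvd hn
  obtain ⟨r, hX'⟩ : Polynomial.X ∣ ψ'.comp (Polynomial.C (a ^ 2) * Polynomial.X) := by
    rw [Polynomial.X_dvd_iff, Polynomial.coeff_zero_eq_eval_zero, Polynomial.eval_comp]
    simpa [← Polynomial.coeff_zero_eq_eval_zero] using hψ' 0 (by omega)
  have hR := h.R_sq_odd hA hn q b
  rw [hq0] at hR
  refine ⟨comb A y z 0 q b, comb A y z 0 t d, h.comb_odd_mem hA _ _, h.comb_odd_mem hA _ _,
    ?_, ?_, ?_, ?_, ?_, hψ', h.finrank⟩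
  · rw [h.mul_odd hA hn, h.comb_eq_zero_iff hA]
    refine ⟨?_, dvd_zero _, rfl⟩
    rw [hq0, hρ, ht, hXX]
    refine Dvd.intro (-Polynomial.C (b * (b * d * γ / a)) * ρ) ?_
    have e : Polynomial.C b * (Polynomial.C (d * γ)) =
        Polynomial.C a * Polynomial.C (b * d * γ / a) := by
      rw [← Polynomial.C_mul, ← Polynomial.C_mul]; congr 1; field_simp
    have e' : Polynomial.C (b * (b * d * γ / a)) =
        Polynomial.C b * Polynomial.C (b * d * γ / a) := Polynomial.C_mul
    rw [e', Polynomial.C_neg]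
    linear_combination (-Polynomial.X ^ (n - 1)) * e
  · rw [h.mul_odd hA hn, h.polyAct_sq_odd hA hn, h.comb_eq_iff hA]
    refine ⟨?_, by simp, rfl⟩
    rw [hq0, ht0]
    have h1 := hr.sub (Dvd.intro (Polynomial.C (b * (b * γ)) * r) rfl : Polynomial.X ^ n ∣ _)
    refine h1.trans (dvd_of_eq ?_)
    rw [hX', hXX, hq]
    simp only [Polynomial.C_mul, Polynomial.C_pow, Polynomial.C_0]
    ring
  · rw [h.mul_odd hA hn, h.polyAct_sq_odd hA hn, comb_smul, h.comb_eq_iff hA]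
    refine ⟨?_, by simp, by simp⟩
    rw [hq0, ht0]
    have h3 : ((Polynomial.X : Polynomial ℂ) ^ (n - 1)).comp
        (Polynomial.C (a ^ 2) * Polynomial.X) =
        Polynomial.C ((a ^ 2) ^ (n - 1)) * Polynomial.X ^ (n - 1) := by
      simp [mul_pow]
    have e : Polynomial.C d * Polynomial.C (d * γ) = Polynomial.C γ' *
        (Polynomial.C ((a ^ 2) ^ (n - 1)) * (Polynomial.C a * Polynomial.C a)) := by
      simp only [← Polynomial.C_mul]
      congr 1
      have h6 : a ^ (2 * n) = (a ^ 2) ^ (n - 1) * a ^ 2 := by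
        rw [← pow_mul, ← pow_add]; congr 1; omega
      rw [h6] at hγ
      linear_combination -hγ
    obtain ⟨m, hm⟩ : ∃ m, n - 1 = m + 1 := ⟨n - 2, by omega⟩
    rw [h3, hXX]
    rw [hm] at e
    rw [ht, hm]
    refine Dvd.intro (-(Polynomial.C d * Polynomial.C (b * d * γ / a) * ρ) -
      Polynomial.C γ' * Polynomial.C ((a ^ 2) ^ (m + 1)) * (Polynomial.C b * (Polynomial.C a * ρ +
        Polynomial.C (b * γ) * Polynomial.X ^ m))) ?_
    rw [hρ, hq]
    simp only [Polynomial.C_neg, Polynomial.C_0]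
    linear_combination (-Polynomial.X ^ (m + 1)) * e
  · rw [polyAct_eq_comp hR, h.polyAct_comb hA, h.comb_eq_zero_iff hA]
    have h3 : ((Polynomial.X : Polynomial ℂ) ^ n).comp
        (Polynomial.C (a ^ 2) * Polynomial.X) =
        Polynomial.C ((a ^ 2) ^ n) * Polynomial.X ^ n := by
      simp [mul_pow]
    rw [h3]
    refine ⟨by simp, (Dvd.intro_left _ rfl).mul_right _, ?_⟩
    rw [Polynomial.coeff_C_mul, Polynomial.coeff_X_pow, if_neg (by omega)]
    simp
  · set y' := comb A y z 0 q b with hy'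
    set z' := comb A y z 0 t d with hz'
    have hR' : R A (A.mul y y) = (a ^ 2)⁻¹ • R A (A.mul y' y') := by
      rw [hR, smul_smul, inv_mul_cancel₀ (pow_ne_zero _ ha), one_smul]
    have hz'0 : R A (A.mul y' y') z' = 0 := by
      rw [hR, LinearMap.smul_apply]
      have := h.polyAct_comb hA Polynomial.X 0 t d
      rw [Polynomial.aeval_X] at this
      rw [hz', this, (h.comb_eq_zero_iff hA).2, smul_zero]
      refine ⟨by simp, ?_, by simp⟩
      rw [ht, hXX]
      exact Dvd.intro_left (Polynomial.C (-(b * d * γ / a))) (by ring)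
    have hz'p : ∀ p : Polynomial ℂ, polyAct A y' p z' = p.coeff 0 • z' := by
      intro p
      conv_lhs => rw [← Polynomial.divX_mul_X_add p]
      rw [map_add, map_mul, Polynomial.aeval_X, Polynomial.aeval_C, LinearMap.add_apply,
        Module.End.mul_apply, hz'0, map_zero, zero_add, Module.algebraMap_end_apply]
    have hcl : ∀ r v, (∃ p q b, v = comb A y' z' p q b) →
        ∃ p q b, polyAct A y r v = comb A y' z' p q b := by
      rintro r v ⟨p, q, b, rfl⟩
      rw [polyAct_eq_comp hR']
      set r' := r.comp (Polynomial.C (a ^ 2)⁻¹ * Polynomial.X)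
      refine ⟨r' * p, r' * q, r'.coeff 0 * b, ?_⟩
      simp only [comb, map_add, map_smul, hz'p, map_mul, Module.End.mul_apply, smul_smul]
      rw [mul_comm b]
    have hadd : ∀ u v, (∃ p q b, u = comb A y' z' p q b) → (∃ p q b, v = comb A y' z' p q b) →
        ∃ p q b, u + v = comb A y' z' p q b := by
      rintro u v ⟨p, q, b, rfl⟩ ⟨p', q', b', rfl⟩
      exact ⟨_, _, _, comb_add _ _ _ _ _ _ _ _ _⟩
    have hsmul : ∀ (c : ℂ) u, (∃ p q b, u = comb A y' z' p q b) →
        ∃ p q b, c • u = comb A y' z' p q b := by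
      rintro c u ⟨p, q, b, rfl⟩
      exact ⟨_, _, _, comb_smul _ _ _ _ _ _ _⟩
    have my' : ∃ p q b, y' = comb A y' z' p q b := ⟨0, 1, 0, (comb_zero_one_zero _ _ _).symm⟩
    have mz' : ∃ p q b, z' = comb A y' z' p q b := ⟨0, 0, 1, (comb_zero_zero_one _ _ _).symm⟩
    have mx' : ∃ p q b, A.mul y' y' = comb A y' z' p q b := ⟨1, 0, 0, by simp [comb]⟩
    -- Up to the factor `d`, `z` is `z'` minus a multiple of `Xⁿ⁻¹ y`; the latter is a multiple of
    -- `Xⁿ⁻¹ y'`, since `Xⁿ⁻¹` kills `z`.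
    have mz : ∃ p q b, z = comb A y' z' p q b := by
      have e1 := hcl (Polynomial.X ^ (n - 1)) y' my'
      rw [hy', h.polyAct_comb hA, Polynomial.coeff_X_pow, if_neg (by omega), zero_mul,
        mul_zero] at e1
      have e2 := hadd _ _ (hsmul d⁻¹ z' mz') (hsmul (d⁻¹ * (b * d * γ / a) * a⁻¹) _ e1)
      have e3 : z = d⁻¹ • z' + (d⁻¹ * (b * d * γ / a) * a⁻¹) •
          comb A y z 0 (Polynomial.X ^ (n - 1) * q) 0 := by
        nth_rw 1 [← comb_zero_zero_one A y z]
        rw [hz', comb_smul, comb_smul, comb_add]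
        congr 1
        · simp
        · rw [ht, hq]
          have e : Polynomial.C a⁻¹ * Polynomial.C a = 1 := by
            rw [← Polynomial.C_mul, inv_mul_cancel₀ ha, Polynomial.C_1]
          simp only [Polynomial.C_mul, Polynomial.C_neg]
          linear_combination (-Polynomial.C d⁻¹ * Polynomial.C (b * d * γ / a) *
            Polynomial.X ^ (n - 1)) * e
        · field_simp; simp
      rw [e3]
      exact e2
    have my : ∃ p q b, y = comb A y' z' p q b := by
      have e3 : y = a⁻¹ • y' + (-(a⁻¹ * b)) • z := by
        have e0 : y' = a • y + b • z := by simp [hy', comb, hq]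
        rw [e0, smul_add, smul_smul, inv_mul_cancel₀ ha, one_smul, smul_smul, neg_smul,
          add_neg_cancel_right]
      rw [e3]
      exact hadd _ _ (hsmul _ _ my') (hsmul _ _ mz)
    -- `[y', y'] = p₀(X) [y, y]` with constant term `a² ≠ 0`; a Bézout relation with `Xⁿ` inverts
    -- `p₀`.
    have mx : ∃ p q b, A.mul y y = comb A y' z' p q b := by
      set p0 : Polynomial ℂ := Polynomial.C a * Polynomial.C a + Polynomial.C b *
        (Polynomial.C a * ψ + Polynomial.C (b * γ) * Polynomial.X ^ (n - 1)) with hp0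
      have e1 : A.mul y' y' = polyAct A y p0 (A.mul y y) := by
        rw [hy', h.mul_odd hA hn, hq0]
        simp [comb, hp0, hq]
      have hco : IsCoprime p0 (Polynomial.X ^ n) := by
        refine IsCoprime.pow_right (IsCoprime.symm ?_)
        rw [Polynomial.irreducible_X.coprime_iff_not_dvd, Polynomial.X_dvd_iff]
        simp [hp0, hψ, Polynomial.coeff_X_pow, show ¬ (0 = n - 1) by omega, ha]
      obtain ⟨u, v, huv⟩ := hco
      have e2 := hcl u _ mx'
      rw [e1, ← Module.End.mul_apply, ← map_mul, eq_sub_of_add_eq huv, map_sub, map_one,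
        LinearMap.sub_apply, (h.polyAct_of_dvd hA (Dvd.intro_left _ rfl)).2, sub_zero] at e2
      exact e2
    intro v
    obtain ⟨p, q, b, rfl⟩ := h.span v
    exact hadd _ _ (hadd _ _ (hcl _ _ mx) (hcl _ _ my)) (hsmul _ _ mz)

end IsGen

/-- The relation between structure constants in terms of coefficients. -/
theorem changeRel_iff {n : ℕ} (hn : 2 ≤ n) {ψ ψ' : Polynomial ℂ} {γ γ' a b d : ℂ} (ha : a ≠ 0)
    (hψ : ∀ i, 2 * i + 1 < n → ψ.coeff i = 0) (hψ' : ∀ i, 2 * i + 1 < n → ψ'.coeff i = 0) :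
    ChangeRel n ψ γ ψ' γ' a b d ↔ γ' * a ^ (2 * n) = d ^ 2 * γ ∧
      (∀ i < n - 1, a ^ (2 * i + 1) * ψ'.coeff i = d * ψ.coeff i) ∧
      a ^ (2 * n) * ψ'.coeff (n - 1) = d * (a * ψ.coeff (n - 1) +
        b * (γ - if Odd n then ψ.coeff ((n - 1) / 2) ^ 2 else 0)) := by
  have hc : ∀ i, (Polynomial.C d * (Polynomial.C a * ψ +
      Polynomial.C (b * γ) * Polynomial.X ^ (n - 1)) -
      ψ'.comp (Polynomial.C (a ^ 2) * Polynomial.X) *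
        (Polynomial.C (a ^ 2) + Polynomial.C (a * b) * ψ)).coeff i =
      d * (a * ψ.coeff i + if i = n - 1 then b * γ else 0) - a * (a ^ (2 * i + 1) * ψ'.coeff i) -
        a * b * ∑ x ∈ Finset.HasAntidiagonal.antidiagonal i,
          ψ'.coeff x.1 * a ^ (2 * x.1) * ψ.coeff x.2 := by
    intro i
    rw [mul_add (ψ'.comp _), mul_left_comm, mul_comm (ψ'.comp _) (Polynomial.C _)]
    simp only [Polynomial.coeff_sub, Polynomial.coeff_C_mul, Polynomial.coeff_add,
      Polynomial.coeff_X_pow, Polynomial.comp_C_mul_X_coeff]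
    rw [Polynomial.coeff_mul]
    simp only [Polynomial.comp_C_mul_X_coeff, ← pow_mul]
    split_ifs <;> ring
  -- Both `ψ` and `ψ'` start in degree at least `(n - 1) / 2` (exact division). Hence their product
  -- has no terms below degree `n - 1`, and in degree `n - 1` only the product of the two middle
  -- coefficients, which exists for odd `n`.
  have h1 : ∀ i < n - 1,
      ∑ x ∈ Finset.HasAntidiagonal.antidiagonal i,
        ψ'.coeff x.1 * a ^ (2 * x.1) * ψ.coeff x.2 = 0 := by
    intro i hi
    refine Finset.sum_eq_zero fun x hx => ?_
    have := Finset.HasAntidiagonal.mem_antidiagonal.1 hx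
    by_cases hx1 : 2 * x.1 + 1 < n
    · rw [hψ' _ hx1]; ring
    · rw [hψ x.2 (by omega)]; ring
  have h2 : ∑ x ∈ Finset.HasAntidiagonal.antidiagonal (n - 1),
      ψ'.coeff x.1 * a ^ (2 * x.1) * ψ.coeff x.2 =
      if Odd n then ψ'.coeff ((n - 1) / 2) * a ^ (2 * ((n - 1) / 2)) * ψ.coeff ((n - 1) / 2)
      else 0 := by
    split_ifs with ho
    · obtain ⟨k, rfl⟩ := ho
      have e : (2 * k + 1 - 1) / 2 = k := by omega
      rw [e]
      rw [Finset.sum_eq_single (k, k)]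
      · intro x hx hne
        have := Finset.HasAntidiagonal.mem_antidiagonal.1 hx
        by_cases hx1 : 2 * x.1 + 1 < 2 * k + 1
        · rw [hψ' _ hx1]; ring
        · rw [hψ x.2]
          · ring
          · by_contra hcon
            exact hne (Prod.ext (by simp; omega) (by simp; omega))
      · intro hx
        exact absurd (Finset.HasAntidiagonal.mem_antidiagonal.2 (by simp; omega)) hx
    · refine Finset.sum_eq_zero fun x hx => ?_
      have := Finset.HasAntidiagonal.mem_antidiagonal.1 hx
      rw [Nat.not_odd_iff_even] at ho
      obtain ⟨k, rfl⟩ := ho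
      by_cases hx1 : 2 * x.1 + 1 < k + k
      · rw [hψ' _ hx1]; ring
      · rw [hψ x.2 (by omega)]; ring
  have hpow : a ^ (2 * n) = a * a ^ (2 * (n - 1) + 1) := by
    rw [← pow_succ']; congr 1; omega
  rw [ChangeRel, Polynomial.X_pow_dvd_iff]
  refine and_congr_right fun _ => ?_
  simp only [hc]
  -- The relation in the middle degree, which is below `n - 1`, replaces the middle coefficient of
  -- `ψ'` by that of `ψ`. This produces the square in the last equation.
  have hlow : (∀ i < n - 1, a ^ (2 * i + 1) * ψ'.coeff i = d * ψ.coeff i) →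
      (d * (a * ψ.coeff (n - 1) + b * γ) - a * (a ^ (2 * (n - 1) + 1) * ψ'.coeff (n - 1)) -
        a * b * (∑ x ∈ Finset.HasAntidiagonal.antidiagonal (n - 1),
          ψ'.coeff x.1 * a ^ (2 * x.1) * ψ.coeff x.2) = 0 ↔
      a ^ (2 * n) * ψ'.coeff (n - 1) = d * (a * ψ.coeff (n - 1) +
        b * (γ - if Odd n then ψ.coeff ((n - 1) / 2) ^ 2 else 0))) := by
    intro hl
    have := hl ((n - 1) / 2) (by omega)
    rw [h2, hpow]
    split_ifs with ho
    · have e : a * b * (ψ'.coeff ((n - 1) / 2) * a ^ (2 * ((n - 1) / 2)) *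
          ψ.coeff ((n - 1) / 2)) = b * d * ψ.coeff ((n - 1) / 2) ^ 2 := by
        rw [pow_succ] at this
        linear_combination (b * ψ.coeff ((n - 1) / 2)) * this
      rw [e]
      constructor <;> intro h <;> linear_combination -h
    · constructor <;> intro h <;> linear_combination -h
  constructor
  · intro h
    have hl : ∀ i < n - 1, a ^ (2 * i + 1) * ψ'.coeff i = d * ψ.coeff i := by
      intro i hi
      have := h i (by omega)
      rw [h1 i hi, if_neg (by omega)] at this
      refine mul_left_cancel₀ ha ?_
      linear_combination -this
    refine ⟨hl, (hlow hl).1 ?_⟩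
    have := h (n - 1) (by omega)
    rwa [if_pos rfl] at this
  · rintro ⟨hl, hlast⟩ i hi
    by_cases hi' : i = n - 1
    · subst hi'
      rw [if_pos rfl]
      exact (hlow hl).2 hlast
    · rw [h1 i (by omega), if_neg hi']
      linear_combination -a * hl i (by omega)

end General

end LeibnizSuper

namespace LeibnizSuper

/-! ### Right multiplications in `L(γ, β)` -/

section Family

variable {n : ℕ}

/-- The basis vector `yⱼ` for `1 ≤ j ≤ n` (and `0` for any other `j`). -/
noncomputable def Ys (n j : ℕ) : Carrier n := if j ≤ n then Y n j else 0

theorem X_of_lt {i : ℕ} (h : n < i) : X n i = 0 := by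
  rw [X, dif_neg (by omega)]

theorem Ys_of_lt {j : ℕ} (h : n < j) : Ys n j = 0 := if_neg (by omega)

theorem single_inl (i : Fin n) :
    (Pi.single (Sum.inl i) 1 : Carrier n) = X n (i + 1) := by
  rw [X, dif_pos (by omega)]
  congr

theorem single_inr (j : Fin (n + 1)) :
    (Pi.single (Sum.inr j) 1 : Carrier n) = Y n (j + 1) := by
  rw [Y, dif_pos (by omega)]
  congr

theorem family_mul_single (P : Param) (a b : Fin n ⊕ Fin (n + 1)) :
    (family n P).mul (Pi.single a 1) (Pi.single b 1) = table n P a b := by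
  have h : ∀ a : Fin n ⊕ Fin (n + 1),
      (Pi.single a 1 : Carrier n) = Pi.basisFun ℂ (Fin n ⊕ Fin (n + 1)) a := by
    intro a; simp
  rw [h, h, family, Module.Basis.constr_basis, Module.Basis.constr_basis]

theorem mul_X_X (P : Param) {i j : ℕ} (hi : 1 ≤ i ∧ i ≤ n) (hj : 1 ≤ j ∧ j ≤ n) :
    (family n P).mul (X n i) (X n j) = mulXX n i j := by
  rw [X, dif_pos hi, X, dif_pos hj, family_mul_single]
  simp only [table]
  congr <;> omega

theorem mul_X_Y (P : Param) {i j : ℕ} (hi : 1 ≤ i ∧ i ≤ n) (hj : 1 ≤ j ∧ j ≤ n + 1) :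
    (family n P).mul (X n i) (Y n j) = mulXY n P i j := by
  rw [X, dif_pos hi, Y, dif_pos hj, family_mul_single]
  simp only [table]
  congr <;> omega

theorem mul_Y_X (P : Param) {i j : ℕ} (hi : 1 ≤ i ∧ i ≤ n + 1) (hj : 1 ≤ j ∧ j ≤ n) :
    (family n P).mul (Y n i) (X n j) = mulYX n i j := by
  rw [X, dif_pos hj, Y, dif_pos hi, family_mul_single]
  simp only [table]
  congr <;> omega

theorem mul_Y_Y (P : Param) {i j : ℕ} (hi : 1 ≤ i ∧ i ≤ n + 1) (hj : 1 ≤ j ∧ j ≤ n + 1) :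
    (family n P).mul (Y n i) (Y n j) = mulYY n P i j := by
  rw [Y, dif_pos hi, Y, dif_pos hj, family_mul_single]
  simp only [table]
  congr <;> omega

theorem carrier_ext {V : Type*} [AddCommGroup V] [Module ℂ V] {f g : Carrier n →ₗ[ℂ] V}
    (hX : ∀ i, 1 ≤ i → i ≤ n → f (X n i) = g (X n i))
    (hY : ∀ j, 1 ≤ j → j ≤ n → f (Ys n j) = g (Ys n j)) (hZ : f (Y n (n + 1)) = g (Y n (n + 1))) :
    f = g := by
  refine (Pi.basisFun ℂ (Fin n ⊕ Fin (n + 1))).ext fun a => ?_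
  rw [Pi.basisFun_apply]
  rcases a with i | j
  · rw [single_inl]
    exact hX _ (by omega) (by omega)
  · rw [single_inr]
    rcases Nat.lt_or_ge j n with h | h
    · have := hY (j + 1) (by omega) (by omega)
      rwa [Ys, if_pos (by omega)] at this
    · have : (j : ℕ) = n := by omega
      rw [this]
      exact hZ

/-- Translates the sums over `k` in the table into sums over the exponent `l = k - 2` of `X`, which
have the same range for every row. -/
theorem sum_range_eq_sum_Icc {V : Type*} [AddCommMonoid V] {r m : ℕ} (hr : 2 ≤ r) (hm : m ≤ n + 1)
    (F : ℕ → V) (h : ∀ l < n, l + 2 < r ∨ m < l + 2 → F l = 0) :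
    ∑ l ∈ Finset.range n, F l = ∑ k ∈ Finset.Icc r m, F (k - 2) := by
  rw [← Finset.sum_filter_of_ne (p := fun l => r ≤ l + 2 ∧ l + 2 ≤ m)]
  · refine Finset.sum_nbij' (· + 2) (· - 2) ?_ ?_ ?_ ?_ ?_
    · intro l hl
      simp only [Finset.mem_filter, Finset.mem_range] at hl
      simp only [Finset.mem_Icc]; omega
    · intro k hk
      simp only [Finset.mem_Icc] at hk
      simp only [Finset.mem_filter, Finset.mem_range]; omega
    · intro l _; simp
    · intro k hk
      simp only [Finset.mem_Icc] at hk
      omega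
    · intro l _; simp
  · intro l hl hne
    rw [Finset.mem_range] at hl
    by_contra hc
    exact hne (h l hl (by omega))

/-- The coefficients `φ` of `[y₁, yₙ₊₁] = ∑ φ_l x_{l+1}`. -/
noncomputable def coef (n : ℕ) (P : Param) (l : ℕ) : ℂ :=
  if l + 2 < (n + 4) / 2 then 0 else if l + 1 = n then P.2 (n + 1) else -2 * P.2 (l + 2)

theorem coef_of_lt {P : Param} {l : ℕ} (h : 2 * l + 1 < n) : coef n P l = 0 :=
  if_pos (by omega)

variable (hn : 2 ≤ n) (P : Param)
include hn

theorem R_X_X {i : ℕ} (hi : 1 ≤ i) : R (family n P) (X n 1) (X n i) = X n (i + 1) := by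
  rcases Nat.lt_or_ge n i with h | h
  · rw [X_of_lt h, X_of_lt (i := i + 1) (by omega), map_zero]
  · rw [LinearMap.flip_apply, mul_X_X P (i := i) (j := 1) ⟨hi, h⟩ ⟨le_rfl, by omega⟩]
    rw [mulXX]
    split_ifs with h'
    · rfl
    · rw [X_of_lt (by omega)]

theorem R_X_Ys {j : ℕ} (hj : 1 ≤ j) : R (family n P) (X n 1) (Ys n j) = Ys n (j + 1) := by
  rcases Nat.lt_or_ge n j with h | h
  · rw [Ys_of_lt h, Ys_of_lt (by omega), map_zero]
  · rw [Ys, if_pos h]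
    rw [LinearMap.flip_apply, mul_Y_X P (i := j) (j := 1) ⟨hj, by omega⟩ ⟨le_rfl, by omega⟩]
    rw [mulYX, Ys]
    split_ifs <;> first | rfl | omega

theorem R_X_Z : R (family n P) (X n 1) (Y n (n + 1)) = 0 := by
  rw [LinearMap.flip_apply, mul_Y_X P (i := n + 1) (j := 1) ⟨by omega, by omega⟩ ⟨le_rfl, by omega⟩]
  rw [mulYX, if_neg (by omega)]

theorem R_Y_X {i : ℕ} (hi : 1 ≤ i) :
    R (family n P) (Y n 1) (X n i) = (1 / 2 : ℂ) • Ys n (i + 1) := by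
  rcases Nat.lt_or_ge n i with h | h
  · rw [X_of_lt h, Ys_of_lt (by omega), map_zero, smul_zero]
  · rw [LinearMap.flip_apply, mul_X_Y P (i := i) (j := 1) ⟨hi, by omega⟩ ⟨le_rfl, by omega⟩]
    rw [mulXY, Ys]
    split_ifs <;> first | rfl | omega | simp

theorem R_Y_Ys {j : ℕ} (hj : 1 ≤ j) : R (family n P) (Y n 1) (Ys n j) = X n j := by
  rcases Nat.lt_or_ge n j with h | h
  · rw [Ys_of_lt h, X_of_lt h, map_zero]
  · rw [Ys, if_pos h]
    rw [LinearMap.flip_apply, mul_Y_Y P (i := j) (j := 1) ⟨hj, by omega⟩ ⟨le_rfl, by omega⟩]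
    rw [mulYY, if_pos ⟨rfl, h⟩]

theorem R_Y_Z : R (family n P) (Y n 1) (Y n (n + 1)) = 0 := by
  rw [LinearMap.flip_apply, mul_Y_Y P (i := n + 1) (j := 1) ⟨by omega, le_rfl⟩ ⟨le_rfl, by omega⟩]
  rw [mulYY, if_neg (by omega), if_neg (by omega), if_neg (by omega), if_neg (by omega)]

theorem R_Z_Z : R (family n P) (Y n (n + 1)) (Y n (n + 1)) = P.1 • X n n := by
  rw [LinearMap.flip_apply, mul_Y_Y P (i := n + 1) (j := n + 1) ⟨by omega, le_rfl⟩
    ⟨by omega, le_rfl⟩]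
  rw [mulYY, if_neg (by omega), if_pos ⟨rfl, rfl⟩]

/-- The bounds in the table cut off only zero terms: a nonzero `coef n P l` needs `2l + 1 ≥ n`, and
`x_{l+j} = 0` for `l + j > n`. So one formula holds for all `j`, and likewise in `R_Z_X`. -/
theorem R_Z_Ys {j : ℕ} (hj : 1 ≤ j) : R (family n P) (Y n (n + 1)) (Ys n j) =
    ∑ l ∈ Finset.range n, coef n P l • X n (l + j) := by
  have hz : ∀ l, n < l + j → coef n P l • X n (l + j) = 0 := fun l hl => by
    rw [X_of_lt hl, smul_zero]
  have hc : ∀ l, l + 2 < (n + 4) / 2 → coef n P l • X n (l + j) = 0 := fun l hl => by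
    rw [coef, if_pos hl, zero_smul]
  rcases Nat.lt_or_ge n j with h | h
  · rw [Ys_of_lt h, map_zero, Finset.sum_eq_zero]
    intro l _
    exact hz l (by omega)
  · rw [Ys, if_pos h]
    rw [LinearMap.flip_apply, mul_Y_Y P (i := j) (j := n + 1) ⟨hj, by omega⟩ ⟨by omega, le_rfl⟩]
    rw [mulYY, if_neg (by omega), if_neg (by omega)]
    split_ifs with h1 h2
    · obtain ⟨-, rfl⟩ := h1
      rw [sum_range_eq_sum_Icc (r := (n + 4) / 2) (m := n + 1) (by omega) le_rfl _
        fun l hl hor => hc l (by omega), Finset.sum_Icc_succ_top (by omega), Finset.smul_sum]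
      congr 1
      · refine Finset.sum_congr rfl fun k hk => ?_
        rw [Finset.mem_Icc] at hk
        rw [coef, if_neg (by omega), if_neg (by omega), smul_smul,
          show k - 2 + 1 = k - 1 by omega, show k - 2 + 2 = k by omega]
      · rw [coef, if_neg (by omega), if_pos (by omega)]
        rw [show n + 1 - 2 + 1 = n by omega]
    · rw [sum_range_eq_sum_Icc (r := (n + 4) / 2) (m := n + 2 - j) (by omega) (by omega) _
        fun l hl hor => ?_, Finset.smul_sum]
      · refine Finset.sum_congr rfl fun k hk => ?_
        rw [Finset.mem_Icc] at hk
        rw [coef, if_neg (by omega), if_neg (by omega), smul_smul, show k - 2 + 2 = k by omega]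
      · rcases hor with h3 | h3
        · exact hc l h3
        · exact hz l (by omega)
    · rw [Finset.sum_eq_zero]
      intro l _
      by_cases h3 : l + 2 < (n + 4) / 2
      · exact hc l h3
      · exact hz l (by omega)

theorem R_Z_X {i : ℕ} (hi : 1 ≤ i) : R (family n P) (Y n (n + 1)) (X n i) =
    (-1 / 2 : ℂ) • ∑ l ∈ Finset.range n, coef n P l • Ys n (l + i + 1) := by
  have hz : ∀ l, n < l + i + 1 → coef n P l • Ys n (l + i + 1) = 0 := fun l hl => by
    rw [Ys_of_lt hl, smul_zero]
  have hc : ∀ l, l + 2 < (n + 4) / 2 → coef n P l • Ys n (l + i + 1) = 0 := fun l hl => by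
    rw [coef, if_pos hl, zero_smul]
  rcases Nat.lt_or_ge n i with h | h
  · rw [X_of_lt h, map_zero, Finset.sum_eq_zero, smul_zero]
    intro l _
    exact hz l (by omega)
  · rw [LinearMap.flip_apply, mul_X_Y P (i := i) (j := n + 1) ⟨hi, by omega⟩ ⟨by omega, le_rfl⟩]
    rw [mulXY, if_neg (by omega)]
    split_ifs with h2
    · rw [sum_range_eq_sum_Icc (r := (n + 4) / 2) (m := n + 1 - i) (by omega) (by omega) _
        fun l hl hor => ?_, Finset.smul_sum]
      · refine Finset.sum_congr rfl fun k hk => ?_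
        rw [Finset.mem_Icc] at hk
        rw [coef, if_neg (by omega), if_neg (by omega), smul_smul, Ys, if_pos (by omega),
          show k - 2 + i + 1 = k - 1 + i by omega, show k - 2 + 2 = k by omega]
        congr 1
        ring
      · rcases hor with h3 | h3
        · exact hc l h3
        · exact hz l (by omega)
    · rw [Finset.sum_eq_zero, smul_zero]
      intro l _
      by_cases h3 : l + 2 < (n + 4) / 2
      · exact hc l h3
      · exact hz l (by omega)

theorem R_X_eq_zero {i : ℕ} (hi : 2 ≤ i) : R (family n P) (X n i) = 0 := by
  rcases Nat.lt_or_ge n i with h | h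
  · rw [X_of_lt h, map_zero]
  refine carrier_ext (fun k h1 h2 => ?_) (fun k h1 h2 => ?_) ?_
  · rw [LinearMap.flip_apply, mul_X_X P (i := k) (j := i) ⟨h1, h2⟩ ⟨by omega, h⟩]
    rw [mulXX, if_neg (by omega)]; rfl
  · rw [Ys, if_pos h2]
    rw [LinearMap.flip_apply, mul_Y_X P (i := k) (j := i) ⟨h1, by omega⟩ ⟨by omega, h⟩]
    rw [mulYX, if_neg (by omega)]; rfl
  · rw [LinearMap.flip_apply, mul_Y_X P (i := n + 1) (j := i) ⟨by omega, by omega⟩ ⟨by omega, h⟩]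
    rw [mulYX, if_neg (by omega)]; rfl

theorem R_Ys_eq_zero {j : ℕ} (hj : 2 ≤ j) : R (family n P) (Ys n j) = 0 := by
  rcases Nat.lt_or_ge n j with h | h
  · rw [Ys_of_lt h, map_zero]
  rw [Ys, if_pos h]
  refine carrier_ext (fun k h1 h2 => ?_) (fun k h1 h2 => ?_) ?_
  · rw [LinearMap.flip_apply, mul_X_Y P (i := k) (j := j) ⟨h1, h2⟩ ⟨by omega, by omega⟩]
    rw [mulXY, if_neg (by omega), if_neg (by omega)]; rfl
  · rw [Ys, if_pos h2]
    rw [LinearMap.flip_apply, mul_Y_Y P (i := k) (j := j) ⟨h1, by omega⟩ ⟨by omega, by omega⟩]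
    rw [mulYY, if_neg (by omega), if_neg (by omega), if_neg (by omega), if_neg (by omega)]; rfl
  · rw [LinearMap.flip_apply, mul_Y_Y P (i := n + 1) (j := j) ⟨by omega, by omega⟩
      ⟨by omega, by omega⟩]
    rw [mulYY, if_neg (by omega), if_neg (by omega), if_neg (by omega), if_neg (by omega)]; rfl

end Family

end LeibnizSuper

namespace LeibnizSuper

/-! ### The Leibniz identity for `L(γ, β)` -/

section Family

variable {n : ℕ}

theorem mem_part_zero {P : Param} {v : Carrier n} :
    v ∈ (family n P).part 0 ↔ ∀ j, v (Sum.inr j) = 0 := by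
  simp [family, funext_iff, LinearMap.funLeft]

theorem mem_part_one {P : Param} {v : Carrier n} :
    v ∈ (family n P).part 1 ↔ ∀ i, v (Sum.inl i) = 0 := by
  simp [family, funext_iff, LinearMap.funLeft]

theorem X_mem (P : Param) (i : ℕ) : X n i ∈ (family n P).part 0 := by
  rw [mem_part_zero]
  intro j
  rw [X]
  split_ifs <;> simp

theorem Y_mem (P : Param) (j : ℕ) : Y n j ∈ (family n P).part 1 := by
  rw [mem_part_one]
  intro i
  rw [Y]
  split_ifs <;> simp

theorem Ys_mem (P : Param) (j : ℕ) : Ys n j ∈ (family n P).part 1 := by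
  rw [Ys]
  split_ifs
  · exact Y_mem P j
  · exact Submodule.zero_mem _

theorem eq_sum_single (v : Carrier n) :
    v = ∑ i, v (Sum.inl i) • X n (i + 1) + ∑ j, v (Sum.inr j) • Y n (j + 1) := by
  have := (Pi.basisFun ℂ (Fin n ⊕ Fin (n + 1))).sum_repr v
  conv_lhs => rw [← this]
  simp only [Fintype.sum_sum_type, Pi.basisFun_apply, Pi.basisFun_repr, single_inl, single_inr]

theorem map_part_zero {P : Param} {V : Type*} [AddCommGroup V] [Module ℂ V] {f : Carrier n →ₗ[ℂ] V}
    {N : Submodule ℂ V} (h : ∀ i, 1 ≤ i → f (X n i) ∈ N) {v : Carrier n}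
    (hv : v ∈ (family n P).part 0) : f v ∈ N := by
  rw [mem_part_zero] at hv
  rw [eq_sum_single v]
  simp only [hv, zero_smul, Finset.sum_const_zero, add_zero, map_sum, map_smul]
  exact Submodule.sum_mem _ fun i _ => Submodule.smul_mem _ _ (h _ (by omega))

theorem map_part_one {P : Param} {V : Type*} [AddCommGroup V] [Module ℂ V] {f : Carrier n →ₗ[ℂ] V}
    {N : Submodule ℂ V} (h : ∀ j, 1 ≤ j → f (Ys n j) ∈ N) (hz : f (Y n (n + 1)) ∈ N)
    {v : Carrier n} (hv : v ∈ (family n P).part 1) : f v ∈ N := by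
  rw [mem_part_one] at hv
  rw [eq_sum_single v]
  simp only [hv, zero_smul, Finset.sum_const_zero, zero_add, map_sum, map_smul]
  refine Submodule.sum_mem _ fun j _ => Submodule.smul_mem _ _ ?_
  rcases Nat.lt_or_ge j n with h' | h'
  · have := h (j + 1) (by omega)
    rwa [Ys, if_pos (by omega)] at this
  · have e : (j : ℕ) = n := by omega
    rw [e]
    exact hz

theorem isCompl_part (P : Param) : IsCompl ((family n P).part 0) ((family n P).part 1) := by
  constructor
  · rw [Submodule.disjoint_def]
    intro v h0 h1
    rw [mem_part_zero] at h0
    rw [mem_part_one] at h1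
    funext a
    rcases a with i | j
    · exact h1 i
    · exact h0 j
  · rw [codisjoint_iff, eq_top_iff]
    intro v _
    rw [eq_sum_single v]
    exact Submodule.add_mem_sup
      (Submodule.sum_mem _ fun i _ => Submodule.smul_mem _ _ (X_mem P _))
      (Submodule.sum_mem _ fun i _ => Submodule.smul_mem _ _ (Y_mem P _))

variable (hn : 2 ≤ n) (P : Param)
include hn

theorem R_Y_sq : R (family n P) (X n 1) =
    (2 : ℂ) • (R (family n P) (Y n 1) * R (family n P) (Y n 1)) := by
  refine carrier_ext (fun i h1 _ => ?_) (fun j h1 _ => ?_) ?_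
  · simp [R_X_X hn P h1, R_Y_X hn P h1, R_Y_Ys hn P (show 1 ≤ i + 1 by omega)]
  · simp [R_X_Ys hn P h1, R_Y_X hn P h1, R_Y_Ys hn P h1]
  · simp [R_X_Z hn P, R_Y_Z hn P]

theorem R_Z_mul_R_Y : R (family n P) (Y n (n + 1)) * R (family n P) (Y n 1) +
    R (family n P) (Y n 1) * R (family n P) (Y n (n + 1)) = 0 := by
  refine carrier_ext (fun i h1 _ => ?_) (fun j h1 _ => ?_) ?_
  · have : ∀ l, R (family n P) (Y n 1) (Ys n (l + i + 1)) = X n (l + i + 1) :=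
      fun l => R_Y_Ys hn P (by omega)
    rw [LinearMap.add_apply, Module.End.mul_apply, Module.End.mul_apply, R_Y_X hn P h1, map_smul,
      R_Z_Ys hn P (by omega), R_Z_X hn P h1, map_smul, map_sum]
    simp only [map_smul, this, LinearMap.zero_apply, ← add_assoc]
    module
  · have : ∀ l, R (family n P) (Y n 1) (X n (l + j)) = (1 / 2 : ℂ) • Ys n (l + j + 1) :=
      fun l => R_Y_X hn P (by omega)
    rw [LinearMap.add_apply, Module.End.mul_apply, Module.End.mul_apply, R_Y_Ys hn P h1,
      R_Z_Ys hn P (by omega), R_Z_X hn P h1, map_sum]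
    simp only [map_smul, this, LinearMap.zero_apply, smul_comm _ (1 / 2 : ℂ), ← Finset.smul_sum]
    module
  · rw [LinearMap.add_apply, Module.End.mul_apply, Module.End.mul_apply, R_Y_Z hn P, map_zero,
      R_Z_Z hn P, map_smul, R_Y_X hn P (by omega), Ys_of_lt (by omega)]
    simp

/-- Two applications shift an index by `l + m + 1` with `2l + 1 ≥ n` and `2m + 1 ≥ n`, hence by at
least `n`, which leaves the range of the basis. -/
theorem R_Z_sq : R (family n P) (Y n (n + 1)) * R (family n P) (Y n (n + 1)) = 0 := by
  refine carrier_ext (fun i h1 _ => ?_) (fun j h1 _ => ?_) ?_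
  · rw [Module.End.mul_apply, R_Z_X hn P h1, map_smul, map_sum, LinearMap.zero_apply,
      Finset.sum_eq_zero, smul_zero]
    intro l _
    by_cases hl : 2 * l + 1 < n
    · rw [coef_of_lt hl, zero_smul, map_zero]
    rw [map_smul, R_Z_Ys hn P (by omega), Finset.sum_eq_zero, smul_zero]
    intro m _
    by_cases hm : 2 * m + 1 < n
    · rw [coef_of_lt hm, zero_smul]
    rw [X_of_lt (by omega), smul_zero]
  · rw [Module.End.mul_apply, R_Z_Ys hn P h1, map_sum, LinearMap.zero_apply, Finset.sum_eq_zero]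
    intro l _
    by_cases hl : 2 * l + 1 < n
    · rw [coef_of_lt hl, zero_smul, map_zero]
    rw [map_smul, R_Z_X hn P (by omega), Finset.sum_eq_zero, smul_zero, smul_zero]
    intro m _
    by_cases hm : 2 * m + 1 < n
    · rw [coef_of_lt hm, zero_smul]
    rw [Ys_of_lt (by omega), smul_zero]
  · rw [Module.End.mul_apply, R_Z_Z hn P, map_smul, R_Z_X hn P (by omega), Finset.sum_eq_zero,
      smul_zero, smul_zero, LinearMap.zero_apply]
    intro m _
    rw [Ys_of_lt (by omega), smul_zero]

/-- All basis vectors except `x₁`, `y₁`, `yₙ₊₁` act trivially from the right. -/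
theorem R_family (v : Carrier n) : R (family n P) v =
    v (Sum.inl ⟨0, by omega⟩) • R (family n P) (X n 1) +
      v (Sum.inr ⟨0, by omega⟩) • R (family n P) (Y n 1) +
      v (Sum.inr ⟨n, by omega⟩) • R (family n P) (Y n (n + 1)) := by
  conv_lhs => rw [eq_sum_single v]
  simp only [map_add, map_sum, map_smul]
  rw [Finset.sum_eq_single (⟨0, by omega⟩ : Fin n),
    Finset.sum_eq_add (⟨0, by omega⟩ : Fin (n + 1)) ⟨n, by omega⟩, add_assoc]
  · simp; omega
  · intro j _ hj
    have h0 : (j : ℕ) ≠ 0 := fun h => hj.1 (Fin.ext h)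
    have h1 : (j : ℕ) ≠ n := fun h => hj.2 (Fin.ext h)
    have := R_Ys_eq_zero hn P (j := j + 1) (by omega)
    rw [Ys, if_pos (by omega)] at this
    rw [this, smul_zero]
  · simp
  · simp
  · intro i _ hi
    have h0 : (i : ℕ) ≠ 0 := fun h => hi (Fin.ext h)
    rw [R_X_eq_zero hn P (by omega), smul_zero]
  · simp

theorem R_X_mem {a : ZMod 2} {v : Carrier n} (hv : v ∈ (family n P).part a) :
    R (family n P) (X n 1) v ∈ (family n P).part a := by
  obtain rfl | rfl := zmod_two_eq a
  · exact map_part_zero (fun i hi => by rw [R_X_X hn P hi]; exact X_mem P _) hv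
  · exact map_part_one (fun i hi => by rw [R_X_Ys hn P hi]; exact Ys_mem P _)
      (by rw [R_X_Z hn P]; exact Submodule.zero_mem _) hv

theorem R_Y_mem {a : ZMod 2} {v : Carrier n} (hv : v ∈ (family n P).part a) :
    R (family n P) (Y n 1) v ∈ (family n P).part (a + 1) := by
  obtain rfl | rfl := zmod_two_eq a
  · exact map_part_zero
      (fun i hi => by rw [R_Y_X hn P hi]; exact Submodule.smul_mem _ _ (Ys_mem P _)) hv
  · exact map_part_one (fun i hi => by rw [R_Y_Ys hn P hi]; exact X_mem P _)
      (by rw [R_Y_Z hn P]; exact Submodule.zero_mem _) hv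

theorem R_Z_mem {a : ZMod 2} {v : Carrier n} (hv : v ∈ (family n P).part a) :
    R (family n P) (Y n (n + 1)) v ∈ (family n P).part (a + 1) := by
  obtain rfl | rfl := zmod_two_eq a
  · refine map_part_zero (fun i hi => ?_) hv
    rw [R_Z_X hn P hi]
    exact Submodule.smul_mem _ _
      (Submodule.sum_mem _ fun l _ => Submodule.smul_mem _ _ (Ys_mem P _))
  · refine map_part_one (fun i hi => ?_) ?_ hv
    · rw [R_Z_Ys hn P hi]
      exact Submodule.sum_mem _ fun l _ => Submodule.smul_mem _ _ (X_mem P _)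
    · rw [R_Z_Z hn P]
      exact Submodule.smul_mem _ _ (X_mem P _)

omit hn in
theorem Ys_apply_zero {j : ℕ} (hj : 2 ≤ j) (h : 0 < n + 1) :
    Ys n j (Sum.inr ⟨0, h⟩) = 0 := by
  rw [Ys, Y]
  split_ifs with h1 h2
  · rw [Pi.single_apply, if_neg]
    simp only [Sum.inr.injEq, Fin.mk.injEq]
    omega
  · rfl
  · rfl

omit hn in
theorem Ys_apply_last (j : ℕ) (h : n < n + 1) : Ys n j (Sum.inr ⟨n, h⟩) = 0 := by
  rw [Ys, Y]
  split_ifs with h1 h2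
  · rw [Pi.single_apply, if_neg]
    simp only [Sum.inr.injEq, Fin.mk.injEq]
    omega
  · rfl
  · rfl

omit hn in
theorem X_apply_inr (i : ℕ) (j : Fin (n + 1)) : X n i (Sum.inr j) = 0 :=
  mem_part_zero.1 (X_mem (0, 0) i) j

omit hn in
theorem X_apply_zero {i : ℕ} (hi : 2 ≤ i) (h : 0 < n) : X n i (Sum.inl ⟨0, h⟩) = 0 := by
  rw [X]
  split_ifs with h1
  · rw [Pi.single_apply, if_neg]
    simp only [Sum.inl.injEq, Fin.mk.injEq]
    omega
  · rfl

omit hn in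
theorem Ys_apply_inl (j : ℕ) (i : Fin n) : Ys n j (Sum.inl i) = 0 :=
  mem_part_one.1 (Ys_mem (0, 0) j) i

/-- No product has a component along `y₁` or `yₙ₊₁`. -/
theorem mul_apply_inr (u v : Carrier n) :
    (family n P).mul u v (Sum.inr ⟨0, by omega⟩) = 0 ∧
    (family n P).mul u v (Sum.inr ⟨n, by omega⟩) = 0 := by
  have key : ∀ k : Fin (n + 1), (∀ j, 2 ≤ j → Ys n j (Sum.inr k) = 0) →
      (family n P).mul u v (Sum.inr k) = 0 := by
    intro k hk
    have e1 : (LinearMap.proj (Sum.inr k) : Carrier n →ₗ[ℂ] ℂ) ∘ₗ R (family n P) (X n 1) = 0 := by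
      refine carrier_ext (fun i h1 _ => ?_) (fun j h1 _ => ?_) ?_
      · simp only [LinearMap.comp_apply, R_X_X hn P h1, LinearMap.proj_apply, X_apply_inr]; rfl
      · simp only [LinearMap.comp_apply, R_X_Ys hn P h1, LinearMap.proj_apply]
        exact hk _ (by omega)
      · simp [R_X_Z hn P]
    have e2 : (LinearMap.proj (Sum.inr k) : Carrier n →ₗ[ℂ] ℂ) ∘ₗ R (family n P) (Y n 1) = 0 := by
      refine carrier_ext (fun i h1 _ => ?_) (fun j h1 _ => ?_) ?_
      · simp only [LinearMap.comp_apply, R_Y_X hn P h1, LinearMap.proj_apply, Pi.smul_apply]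
        rw [hk _ (by omega), smul_zero]; rfl
      · simp only [LinearMap.comp_apply, R_Y_Ys hn P h1, LinearMap.proj_apply, X_apply_inr]; rfl
      · simp [R_Y_Z hn P]
    have e3 : (LinearMap.proj (Sum.inr k) : Carrier n →ₗ[ℂ] ℂ) ∘ₗ
        R (family n P) (Y n (n + 1)) = 0 := by
      refine carrier_ext (fun i h1 _ => ?_) (fun j h1 _ => ?_) ?_
      · simp only [LinearMap.comp_apply, R_Z_X hn P h1, LinearMap.proj_apply, Pi.smul_apply,
          Finset.sum_apply]
        rw [Finset.sum_eq_zero, smul_zero]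
        · rfl
        · intro l _
          rw [hk _ (by omega), smul_zero]
      · simp only [LinearMap.comp_apply, R_Z_Ys hn P h1, LinearMap.proj_apply, Pi.smul_apply,
          Finset.sum_apply, X_apply_inr, smul_zero, Finset.sum_const_zero, LinearMap.zero_apply]
      · simp only [LinearMap.comp_apply, R_Z_Z hn P, LinearMap.proj_apply, Pi.smul_apply,
          X_apply_inr, smul_zero, LinearMap.zero_apply]
    change (LinearMap.proj (Sum.inr k) : Carrier n →ₗ[ℂ] ℂ) (R (family n P) v u) = 0
    rw [R_family hn P v]
    simp only [LinearMap.add_apply, LinearMap.smul_apply, map_add, map_smul]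
    have f1 := LinearMap.congr_fun e1 u
    have f2 := LinearMap.congr_fun e2 u
    have f3 := LinearMap.congr_fun e3 u
    simp only [LinearMap.comp_apply, LinearMap.zero_apply] at f1 f2 f3
    rw [f1, f2, f3]
    simp
  exact ⟨key _ fun j hj => Ys_apply_zero hj _, key _ fun j _ => Ys_apply_last j _⟩

/-- The component of a product along `x₁`. -/
theorem mul_apply_inl (u v : Carrier n) : (family n P).mul u v (Sum.inl ⟨0, by omega⟩) =
    u (Sum.inr ⟨0, by omega⟩) * v (Sum.inr ⟨0, by omega⟩) := by
  set p : Carrier n →ₗ[ℂ] ℂ := LinearMap.proj (Sum.inl ⟨0, by omega⟩) with hp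
  have hp' : ∀ w, p w = w (Sum.inl ⟨0, by omega⟩) := fun _ => rfl
  have e1 : p ∘ₗ R (family n P) (X n 1) = 0 := by
    refine carrier_ext (fun i h1 _ => ?_) (fun j h1 _ => ?_) ?_
    · rw [LinearMap.comp_apply, R_X_X hn P h1, hp', X_apply_zero (by omega)]; rfl
    · rw [LinearMap.comp_apply, R_X_Ys hn P h1, hp', Ys_apply_inl]; rfl
    · simp [R_X_Z hn P]
  have e2 : p ∘ₗ R (family n P) (Y n 1) = LinearMap.proj (Sum.inr ⟨0, by omega⟩) := by
    refine carrier_ext (fun i h1 _ => ?_) (fun j h1 h2 => ?_) ?_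
    · rw [LinearMap.comp_apply, R_Y_X hn P h1, map_smul, hp', Ys_apply_inl, LinearMap.proj_apply,
        X_apply_inr, smul_zero]
    · rw [LinearMap.comp_apply, R_Y_Ys hn P h1, hp', LinearMap.proj_apply]
      rcases Nat.lt_or_ge 1 j with h3 | h3
      · rw [X_apply_zero (by omega), Ys_apply_zero (by omega)]
      · obtain rfl : j = 1 := by omega
        simp [X, Ys, Y, show 1 ≤ n by omega]
    · rw [LinearMap.comp_apply, R_Y_Z hn P, map_zero, LinearMap.proj_apply, Y, dif_pos (by omega),
        Pi.single_apply, if_neg]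
      simp only [Sum.inr.injEq, Fin.mk.injEq]
      omega
  have e3 : p ∘ₗ R (family n P) (Y n (n + 1)) = 0 := by
    refine carrier_ext (fun i h1 _ => ?_) (fun j h1 h2 => ?_) ?_
    · rw [LinearMap.comp_apply, R_Z_X hn P h1, map_smul, map_sum, Finset.sum_eq_zero, smul_zero]
      · rfl
      · intro l _
        rw [map_smul, hp', Ys_apply_inl, smul_zero]
    · rw [LinearMap.comp_apply, R_Z_Ys hn P h1, map_sum, Finset.sum_eq_zero]
      · rfl
      · intro l _
        by_cases hl : 2 * l + 1 < n
        · rw [coef_of_lt hl, zero_smul, map_zero]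
        · rw [map_smul, hp', X_apply_zero (by omega), smul_zero]
    · rw [LinearMap.comp_apply, R_Z_Z hn P, map_smul, hp', X_apply_zero hn, smul_zero]; rfl
  change p (R (family n P) v u) = _
  rw [R_family hn P v]
  simp only [LinearMap.add_apply, LinearMap.smul_apply, map_add, map_smul]
  have f1 := LinearMap.congr_fun e1 u
  have f2 := LinearMap.congr_fun e2 u
  have f3 := LinearMap.congr_fun e3 u
  simp only [LinearMap.comp_apply, LinearMap.zero_apply, LinearMap.proj_apply] at f1 f2 f3
  rw [f1, f2, f3]
  simp [mul_comm]

/-- Every `L(γ, β)` is a Leibniz superalgebra. -/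
theorem family_isLeibniz : IsLeibniz (family n P) := by
  have hR0 : ∀ v ∈ (family n P).part 0,
      R (family n P) v = v (Sum.inl ⟨0, by omega⟩) • R (family n P) (X n 1) := by
    intro v hv
    rw [mem_part_zero] at hv
    rw [R_family hn P v, hv, hv]
    simp
  have hR1 : ∀ v ∈ (family n P).part 1,
      R (family n P) v = v (Sum.inr ⟨0, by omega⟩) • R (family n P) (Y n 1) +
        v (Sum.inr ⟨n, by omega⟩) • R (family n P) (Y n (n + 1)) := by
    intro v hv
    rw [mem_part_one] at hv
    rw [R_family hn P v, hv]
    simp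
  have hmul : ∀ u v, R (family n P) ((family n P).mul u v) =
      (u (Sum.inr ⟨0, by omega⟩) * v (Sum.inr ⟨0, by omega⟩)) • R (family n P) (X n 1) := by
    intro u v
    rw [R_family hn P, mul_apply_inl hn P, (mul_apply_inr hn P u v).1, (mul_apply_inr hn P u v).2]
    simp
  have hXY : R (family n P) (X n 1) * R (family n P) (Y n 1) =
      R (family n P) (Y n 1) * R (family n P) (X n 1) := by
    rw [R_Y_sq hn P, smul_mul_assoc, mul_smul_comm, mul_assoc]
  have hZY := eq_neg_of_add_eq_zero_left (R_Z_mul_R_Y hn P)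
  have hXZ : R (family n P) (X n 1) * R (family n P) (Y n (n + 1)) =
      R (family n P) (Y n (n + 1)) * R (family n P) (X n 1) := by
    have h1 := congrArg (R (family n P) (Y n 1) * ·) (R_Z_mul_R_Y hn P)
    have h2 := congrArg (· * R (family n P) (Y n 1)) (R_Z_mul_R_Y hn P)
    simp only [mul_add, add_mul, mul_zero, zero_mul, ← mul_assoc] at h1 h2
    rw [R_Y_sq hn P, smul_mul_assoc, mul_smul_comm, ← mul_assoc]
    congr 1
    exact add_left_cancel (h1.trans (h2.symm.trans (add_comm _ _)))
  refine ⟨isCompl_part P, ?_, ?_⟩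
  · intro a b u v hu hv
    change R (family n P) v u ∈ _
    obtain rfl | rfl := zmod_two_eq b
    · rw [hR0 v hv, add_zero]
      exact Submodule.smul_mem _ _ (R_X_mem hn P hu)
    · rw [hR1 v hv]
      exact Submodule.add_mem _ (Submodule.smul_mem _ _ (R_Y_mem hn P hu))
        (Submodule.smul_mem _ _ (R_Z_mem hn P hu))
  · intro a b w u v hu hv
    have hval : (1 : ZMod 2).val = 1 := rfl
    -- Both sides are combinations of the three basic right multiplications. The identity follows
    -- from `R_{x₁} = 2 R_{y₁}²`, the anticommutation of `R_{y₁}` and `R_{yₙ₊₁}`, and `R_{yₙ₊₁}² =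
    -- 0`.
    suffices h : R (family n P) ((family n P).mul u v) =
        R (family n P) v * R (family n P) u -
          (-1 : ℂ) ^ (a.val * b.val) • (R (family n P) u * R (family n P) v) from
      LinearMap.congr_fun h w
    rw [hmul]
    obtain rfl | rfl := zmod_two_eq a <;> obtain rfl | rfl := zmod_two_eq b
    · rw [hR0 u hu, hR0 v hv, mem_part_zero.1 hu]
      simp [smul_smul, mul_comm]
    · rw [hR0 u hu, hR1 v hv, mem_part_zero.1 hu]
      simp only [add_mul, mul_add, smul_mul_assoc, mul_smul_comm, hXY, hXZ, ZMod.val_zero,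
        Nat.zero_mul, pow_zero]
      module
    · rw [hR1 u hu, hR0 v hv, mem_part_zero.1 hv]
      simp only [add_mul, mul_add, smul_mul_assoc, mul_smul_comm, hXY, hXZ, ZMod.val_zero,
        Nat.mul_zero, pow_zero]
      module
    · rw [hR1 u hu, hR1 v hv, R_Y_sq hn P]
      simp only [add_mul, mul_add, smul_mul_assoc, mul_smul_comm, hZY, R_Z_sq hn P, hval,
        Nat.mul_one, pow_one]
      module

end Family

end LeibnizSuper

namespace LeibnizSuper

/-! ### The parameters as structure constants -/

section Family

variable {n : ℕ}

/-- The polynomial `ψ` with `[y₁, yₙ₊₁] = ψ(X) x₁` in `L(γ, β)`. -/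
noncomputable def psi (n : ℕ) (P : Param) : Polynomial ℂ :=
  ∑ l ∈ Finset.range n, Polynomial.C (coef n P l) * Polynomial.X ^ l

theorem psi_coeff (P : Param) {i : ℕ} (hi : i < n) : (psi n P).coeff i = coef n P i := by
  simp only [psi, Polynomial.finsetSum_coeff, Polynomial.coeff_C_mul, Polynomial.coeff_X_pow]
  rw [Finset.sum_eq_single i]
  · simp
  · intro b _ hb
    rw [if_neg (fun h => hb h.symm), mul_zero]
  · intro h
    exact absurd (Finset.mem_range.2 hi) h

theorem psi_coeff_eq_zero (P : Param) {i : ℕ} (hi : 2 * i + 1 < n) : (psi n P).coeff i = 0 := by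
  rw [psi_coeff P (by omega), coef_of_lt hi]

/-- The basis consists of the chains `Xⁱ x₁ = x_{i+1}`, `Xⁱ y₁ = y_{i+1}` and of `yₙ₊₁`. -/
theorem family_isGen (hn : 2 ≤ n) (P : Param) :
    IsGen (family n P) n (Y n 1) (Y n (n + 1)) (psi n P) P.1 := by
  have hY : Ys n 1 = Y n 1 := if_pos (by omega)
  have hyy : (family n P).mul (Y n 1) (Y n 1) = X n 1 := by
    have := R_Y_Ys hn P (le_refl 1)
    rwa [hY] at this
  have hX : ∀ i, ((R (family n P) (X n 1)) ^ i) (X n 1) = X n (i + 1) := by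
    intro i
    induction i with
    | zero => rfl
    | succ i ih => rw [pow_succ', Module.End.mul_apply, ih, R_X_X hn P (by omega)]
  have hYs : ∀ i, ((R (family n P) (X n 1)) ^ i) (Y n 1) = Ys n (i + 1) := by
    intro i
    induction i with
    | zero => exact hY.symm
    | succ i ih => rw [pow_succ', Module.End.mul_apply, ih, R_X_Ys hn P (by omega)]
  refine ⟨Y_mem P _, Y_mem P _, R_Y_Z hn P, ?_, ?_, ?_, ?_, fun i hi => psi_coeff_eq_zero P hi, ?_⟩
  · have := R_Z_Ys hn P (le_refl 1)
    rw [hY] at this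
    refine this.trans ?_
    rw [polyAct, hyy, psi, map_sum, LinearMap.sum_apply]
    refine Finset.sum_congr rfl fun l _ => ?_
    rw [map_mul, Polynomial.aeval_C, Polynomial.aeval_X_pow, Module.End.mul_apply, hX,
      Module.algebraMap_end_apply]
  · refine (R_Z_Z hn P).trans ?_
    rw [polyAct, hyy, Polynomial.aeval_X_pow, hX]
    congr 2
    omega
  · rw [polyAct, hyy, Polynomial.aeval_X_pow, hYs, Ys_of_lt (by omega)]
  · intro v
    refine ⟨∑ i : Fin n, Polynomial.C (v (Sum.inl i)) * Polynomial.X ^ (i : ℕ),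
      ∑ i : Fin n, Polynomial.C (v (Sum.inr i.castSucc)) * Polynomial.X ^ (i : ℕ),
      v (Sum.inr (Fin.last n)), ?_⟩
    conv_lhs => rw [eq_sum_single v, Fin.sum_univ_castSucc, ← add_assoc]
    rw [comb, polyAct, hyy]
    simp only [map_sum, map_mul, Polynomial.aeval_C, Polynomial.aeval_X_pow, LinearMap.sum_apply,
      Module.End.mul_apply, hX, hYs, Module.algebraMap_end_apply]
    congr 1
    congr 1
    refine Finset.sum_congr rfl fun i _ => ?_
    rw [Ys, if_pos (by omega)]
    rfl
  · rw [Module.finrank_fintype_fun_eq_card]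
    simp
    omega

/-- The relation between the parameters of isomorphic superalgebras. -/
def ParamRel (n : ℕ) (P Q : Param) : Prop :=
  ∃ a b d : ℂ, a ≠ 0 ∧ d ≠ 0 ∧ Q.1 * a ^ (2 * n) = d ^ 2 * P.1 ∧
    (∀ k, (n + 4) / 2 ≤ k → k ≤ n → a ^ (2 * k - 3) * Q.2 k = d * P.2 k) ∧
    a ^ (2 * n) * Q.2 (n + 1) = d * (a * P.2 (n + 1) +
      b * (P.1 - if Odd n then 4 * P.2 ((n + 3) / 2) ^ 2 else 0))

/-- An isomorphism carries the standard pair of one algebra to a normalized pair of the other, so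
the constants are related. Conversely, related constants occur for a second pair inside the first
algebra, and equal constants give isomorphic algebras. -/
theorem iso_family_iff (hn : 2 ≤ n) (P Q : Param) :
    Iso (family n P) (family n Q) ↔ ParamRel n P Q := by
  have hP := family_isLeibniz hn P
  have hQ := family_isLeibniz hn Q
  have gP := family_isGen hn P
  have gQ := family_isGen hn Q
  have key : ∀ a b d : ℂ, a ≠ 0 → (ChangeRel n (psi n P) P.1 (psi n Q) Q.1 a b d ↔
      Q.1 * a ^ (2 * n) = d ^ 2 * P.1 ∧
      (∀ k, (n + 4) / 2 ≤ k → k ≤ n → a ^ (2 * k - 3) * Q.2 k = d * P.2 k) ∧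
      a ^ (2 * n) * Q.2 (n + 1) = d * (a * P.2 (n + 1) +
        b * (P.1 - if Odd n then 4 * P.2 ((n + 3) / 2) ^ 2 else 0))) := by
    intro a b d ha
    rw [changeRel_iff hn ha (fun i => psi_coeff_eq_zero P) (fun i => psi_coeff_eq_zero Q)]
    refine and_congr_right fun _ => and_congr ?_ ?_
    · constructor
      · intro h k h1 h2
        have := h (k - 2) (by omega)
        rw [psi_coeff _ (by omega), psi_coeff _ (by omega), coef, coef, if_neg (by omega),
          if_neg (by omega), if_neg (by omega), if_neg (by omega),
          show k - 2 + 2 = k by omega, show 2 * (k - 2) + 1 = 2 * k - 3 by omega] at this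
        linear_combination (-1 / 2) * this
      · intro h i hi
        rw [psi_coeff _ (by omega), psi_coeff _ (by omega), coef, coef]
        split_ifs with h1 h2
        · simp
        · omega
        · have := h (i + 2) (by omega) (by omega)
          rw [show 2 * (i + 2) - 3 = 2 * i + 1 by omega] at this
          linear_combination (-2) * this
    · have e1 : ∀ P, coef n P (n - 1) = P.2 (n + 1) := by
        intro P
        rw [coef, if_neg (by omega), if_pos (by omega)]
      rw [psi_coeff _ (by omega), psi_coeff _ (by omega), psi_coeff _ (by omega), e1, e1]
      have e2 : (if Odd n then coef n P ((n - 1) / 2) ^ 2 else 0) =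
          if Odd n then 4 * P.2 ((n + 3) / 2) ^ 2 else 0 := by
        split_ifs with ho
        · obtain ⟨k, rfl⟩ := ho
          rw [coef, if_neg (by omega), if_neg (by omega),
            show (2 * k + 1 - 1) / 2 + 2 = (2 * k + 1 + 3) / 2 by omega]
          ring
        · rfl
      rw [e2]
  constructor
  · rintro ⟨f, hf, hm⟩
    obtain ⟨a, b, d, ha, hd, h⟩ := (gP.map f hf hm).exists_changeRel hQ hn gQ
    exact ⟨a, b, d, ha, hd, (key a b d ha).1 h⟩
  · rintro ⟨a, b, d, ha, hd, h⟩
    obtain ⟨y', z', g⟩ := gP.of_changeRel hP hn ha hd (fun i => psi_coeff_eq_zero Q)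
      ((key a b d ha).2 h)
    exact g.iso hP hQ hn gQ

/-- Every choice of structure constants is realized by some `L(γ, β)`. -/
theorem IsGen.exists_iso_family {L : Type*} [AddCommGroup L] [Module ℂ L] {A : SuperProduct L}
    {y z : L} {ψ : Polynomial ℂ} {γ : ℂ} (hA : IsLeibniz A) (hn : 2 ≤ n)
    (h : IsGen A n y z ψ γ) : ∃ P, Iso A (family n P) := by
  set P : Param := (γ, fun k => if k = n + 1 then ψ.coeff (n - 1) else -ψ.coeff (k - 2) / 2)
    with hP
  refine ⟨P, IsGen.iso hA (family_isLeibniz hn P) hn (y := y) (z := z) (ψ := psi n P) (γ := γ) ?_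
    (family_isGen hn P)⟩
  refine ⟨h.left_mem, h.right_mem, h.mul_right_left, ?_, h.mul_right_right, h.nilpotent, h.span,
    fun i => psi_coeff_eq_zero P, h.finrank⟩
  rw [h.mul_left_right, ← sub_eq_zero, ← LinearMap.sub_apply, ← map_sub]
  refine (h.polyAct_of_dvd hA ?_).2
  rw [Polynomial.X_pow_dvd_iff]
  intro i hi
  rw [Polynomial.coeff_sub, psi_coeff P hi, coef]
  split_ifs with h1 h2
  · rw [h.coeff_eq_zero i (by omega), sub_zero]
  · simp [hP, ← h2]
  · simp only [hP]
    rw [if_neg (by omega), show i + 2 - 2 = i by omega]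
    ring

end Family

/-! ### Nilindex and characteristic sequence of an algebra with normalized generators -/

section OfType

variable {L : Type*} [AddCommGroup L] [Module ℂ L] {A : SuperProduct L}

theorem power_succ (A : SuperProduct L) {k : ℕ} (hk : 1 ≤ k) :
    power A (k + 1) = Submodule.map₂ A.mul (power A k) ⊤ := by
  obtain ⟨k, rfl⟩ : ∃ m, k = m + 1 := ⟨k - 1, by omega⟩
  rfl

theorem power_one (A : SuperProduct L) : power A 1 = ⊤ := rfl

theorem mul_mem_power {k : ℕ} (hk : 1 ≤ k) {u : L} (hu : u ∈ power A k) (v : L) :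
    A.mul u v ∈ power A (k + 1) := by
  rw [power_succ A hk]
  exact Submodule.apply_mem_map₂ _ hu trivial

theorem power_succ_le (A : SuperProduct L) {k : ℕ} (hk : 1 ≤ k) : power A (k + 1) ≤ power A k := by
  induction k, hk using Nat.le_induction with
  | base => exact le_top
  | succ k hk ih =>
    rw [power_succ A (by omega)]
    nth_rw 2 [power_succ A hk]
    exact Submodule.map₂_le_map₂_left ih

theorem power_antitone (A : SuperProduct L) {j k : ℕ} (hj : 1 ≤ j) (hjk : j ≤ k) :
    power A k ≤ power A j := by
  induction k, hjk using Nat.le_induction with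
  | base => exact le_rfl
  | succ k hk ih => exact (power_succ_le A (by omega)).trans ih

theorem sum_eq_of_blocks {f : L →ₗ[ℂ] L} {N : Submodule ℂ L} {s : List ℕ}
    (h : HasJordanBlocks f N s) : s.sum = Module.finrank ℂ N := by
  obtain ⟨-, -, e, -⟩ := h
  rw [Module.finrank_eq_card_basis e]
  simp [Fintype.card_sigma]

/-- In a chain longer than `n` the power `fⁿ` would send the first vector to a basis vector. -/
theorem le_of_mem_blocks {f : Module.End ℂ L} {N : Submodule ℂ L} {s : List ℕ} {n : ℕ}
    (h : HasJordanBlocks f N s) (hf : ∀ v ∈ N, (f ^ n) v = 0) {d : ℕ} (hd : d ∈ s) : d ≤ n := by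
  obtain ⟨-, -, e, he⟩ := h
  obtain ⟨i, rfl⟩ := List.mem_iff_get.1 hd
  by_contra hlt
  push Not at hlt
  have key : ∀ k (hk : k < s.get i), (f ^ k) (e ⟨i, ⟨0, by omega⟩⟩) = e ⟨i, ⟨k, hk⟩⟩ := by
    intro k
    induction k with
    | zero => intro _; rfl
    | succ k ih =>
      intro hk
      rw [pow_succ', Module.End.mul_apply, ih (by omega), he, dif_pos hk]
  have h1 := key n hlt
  rw [hf _ (Subtype.mem _)] at h1
  exact e.ne_zero _ (Subtype.ext h1.symm)

theorem list_le_singleton {n : ℕ} {s : List ℕ} (h : s.sum = n) (hp : ∀ d ∈ s, 0 < d) :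
    s ≤ [n] := by
  rcases s with _ | ⟨a, t⟩
  · exact le_of_lt List.Lex.nil
  · rw [List.sum_cons] at h
    rcases Nat.lt_or_ge a n with h1 | h1
    · exact le_of_lt (List.Lex.rel h1)
    · rcases t with _ | ⟨b, t⟩
      · rw [List.sum_nil] at h
        rw [← h, add_zero]
      · have := hp b (by simp)
        rw [List.sum_cons] at h
        omega

theorem list_le_pair {n : ℕ} {s : List ℕ} (h : s.sum = n + 1) (hp : ∀ d ∈ s, 0 < d ∧ d ≤ n) :
    s ≤ [n, 1] := by
  rcases s with _ | ⟨a, t⟩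
  · exact le_of_lt List.Lex.nil
  · rw [List.sum_cons] at h
    have := hp a (by simp)
    rcases Nat.lt_or_ge a n with h1 | h1
    · exact le_of_lt (List.Lex.rel h1)
    · obtain rfl : a = n := by omega
      exact List.cons_le_cons a
        (list_le_singleton (by omega) fun d hd => (hp d (List.mem_cons_of_mem _ hd)).1)

namespace IsGen

variable {n : ℕ} {y z : L} {ψ : Polynomial ℂ} {γ : ℂ} (hA : IsLeibniz A) (hn : 2 ≤ n)
  (h : IsGen A n y z ψ γ)
include hA hn h

omit hn in
theorem comb_mem_range (p q : Polynomial ℂ) :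
    comb A y z p (q * Polynomial.X) 0 ∈ LinearMap.range (R A y) := by
  -- `R_y` maps `p(X) y` to `p(X) x` and `2 q(X) x` to `q(X) X y`.
  refine ⟨polyAct A y p y + (2 : ℂ) • polyAct A y q (A.mul y y), ?_⟩
  rw [map_add, map_smul, h.R_left_polyAct hA, h.R_left_polyAct hA, h.R_left_sq hA, comb, map_mul,
    Module.End.mul_apply, map_smul, smul_smul, zero_smul, add_zero]
  norm_num

theorem R_right_mem_range (v : L) : R A z v ∈ LinearMap.range (R A y) := by
  obtain ⟨p, q, b, rfl⟩ := h.span v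
  have h1 := h.mul_comb hA hn p q 0 0 b 1
  rw [comb_zero_zero_one] at h1
  have h2 : R A z (comb A y z p q b) = comb A y z (q * ψ + Polynomial.C (b * γ) *
      Polynomial.X ^ (n - 1)) (Polynomial.C (-1 / 2) * (p * ψ) * Polynomial.X) 0 := by
    refine h1.trans ?_
    rw [neg_div, Polynomial.C_neg]
    congr 1
    · simp
    · simp only [Polynomial.coeff_zero, Polynomial.C_0, zero_div]
      ring
  rw [h2]
  exact h.comb_mem_range hA _ _

/-- Every right multiplication is a combination of `X = 2 R_y²`, `R_y` and `R_z`. The last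
anticommutes with `R_y` and has image inside the image of `R_y`, so each factor raises the exponent
of `R_y`. -/
theorem power_le_range {k : ℕ} : power A (k + 1) ≤ LinearMap.range ((R A y) ^ k) := by
  have hX : ∀ v, R A (A.mul y y) v = (2 : ℂ) • R A y (R A y v) := fun v => by
    rw [hA.R_sq h.left_mem]; rfl
  have hZ : ∀ (k : ℕ) (v : L), R A z (((R A y) ^ k) v) =
      ((-1 : ℂ) ^ k) • ((R A y) ^ k) (R A z v) := by
    intro k v
    induction k with
    | zero => simp
    | succ k ih =>
      have := LinearMap.congr_fun (h.anticommute hA hn) (((R A y) ^ k) v)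
      rw [pow_succ', Module.End.mul_apply]
      refine this.trans ?_
      rw [LinearMap.neg_apply, Module.End.mul_apply, ih, map_smul, Module.End.mul_apply]
      module
  induction k with
  | zero => simp [Module.End.one_eq_id]
  | succ k ih =>
    rw [power_succ A (by omega), Submodule.map₂_le]
    intro u hu v _
    obtain ⟨w, rfl⟩ := ih hu
    obtain ⟨p, q, b, rfl⟩ := h.span v
    change R A _ _ ∈ _
    rw [h.R_comb hA]
    refine Submodule.add_mem _ (Submodule.add_mem _ (Submodule.smul_mem _ _ ?_)
      (Submodule.smul_mem _ _ ?_)) (Submodule.smul_mem _ _ ?_)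
    · rw [hX]
      refine ⟨(2 : ℂ) • R A y w, ?_⟩
      rw [pow_succ', Module.End.mul_apply, map_smul, map_smul, ← Module.End.mul_apply (_ ^ k),
        ← pow_succ, pow_succ', Module.End.mul_apply]
    · exact ⟨w, by rw [pow_succ', Module.End.mul_apply]⟩
    · rw [hZ]
      obtain ⟨t, ht⟩ := h.R_right_mem_range hA hn w
      refine Submodule.smul_mem _ _ ⟨t, ?_⟩
      rw [pow_succ, Module.End.mul_apply, ht]


theorem R_sq_pow : (R A (A.mul y y)) ^ n = 0 := by
  ext v
  obtain ⟨p, q, b, rfl⟩ := h.span v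
  have h1 := h.polyAct_comb hA (Polynomial.X ^ n) p q b
  rw [Polynomial.aeval_X_pow] at h1
  rw [h1, LinearMap.zero_apply, h.comb_eq_zero_iff hA]
  refine ⟨Dvd.intro _ rfl, Dvd.intro _ rfl, ?_⟩
  rw [Polynomial.coeff_X_pow, if_neg (by omega), zero_mul]

omit hn in
theorem R_left_pow (k : ℕ) : (R A y) ^ (2 * k) = ((1 / 2 : ℂ) ^ k) • (R A (A.mul y y)) ^ k := by
  rw [pow_mul, ← smul_pow, hA.R_sq h.left_mem, smul_smul, sq]
  norm_num

/-- `R_y^{2n}` is a multiple of `Xⁿ = 0`, whereas `R_y^{2n-1} y` is a nonzero multiple of `Xⁿ⁻¹ x`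
lying in `L^{2n}`. -/
theorem hasNilindex : HasNilindex A (2 * n + 1) := by
  refine ⟨⟨by omega, ?_⟩, ?_⟩
  · rw [eq_bot_iff]
    refine (h.power_le_range hA hn).trans ?_
    rw [h.R_left_pow hA, h.R_sq_pow hA hn]
    simp
  · rintro t ⟨ht, hb⟩
    by_contra hlt
    have hmem : ∀ k, ((R A y) ^ k) y ∈ power A (k + 1) := by
      intro k
      induction k with
      | zero => trivial
      | succ k ih =>
        rw [pow_succ']
        exact mul_mem_power (by omega) ih y
    have h1 := power_antitone A ht (show t ≤ 2 * (n - 1) + 1 + 1 by omega) (hmem _)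
    rw [hb, Submodule.mem_bot, pow_succ', Module.End.mul_apply, h.R_left_pow hA,
      LinearMap.smul_apply, map_smul] at h1
    have h2 := (smul_eq_zero.1 h1).resolve_left (by norm_num)
    have h3 := h.R_left_polyAct hA (Polynomial.X ^ (n - 1)) y
    rw [Polynomial.aeval_X_pow, h2] at h3
    have h4 : comb A y z (Polynomial.X ^ (n - 1)) 0 0 = 0 := by
      rw [comb, Polynomial.aeval_X_pow, map_zero, LinearMap.zero_apply, zero_smul, add_zero,
        add_zero]
      exact h3.symm
    have h5 := Polynomial.X_pow_dvd_iff.1 ((h.comb_eq_zero_iff hA).1 h4).1 (n - 1) (by omega)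
    simp at h5

omit hn in
theorem exists_even {v : L} (hv : v ∈ A.part 0) : ∃ p, v = comb A y z p 0 0 := by
  obtain ⟨p, q, b, rfl⟩ := h.span v
  refine ⟨p, ?_⟩
  have e : comb A y z p q b - comb A y z p 0 0 = comb A y z 0 q b := by
    rw [comb_sub]; simp
  rw [← sub_eq_zero]
  refine hA.disjoint (Submodule.sub_mem _ hv (h.comb_even_mem hA p)) ?_
  rw [e]
  exact h.comb_odd_mem hA q b

omit hn in
theorem exists_R_even {v : L} (hv : v ∈ A.part 0) : ∃ c : ℂ, R A v = c • R A (A.mul y y) := by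
  obtain ⟨p, rfl⟩ := h.exists_even hA hv
  exact ⟨p.coeff 0, by rw [h.R_comb hA]; simp⟩

/-- Even elements act by multiples of `X`, and `x` is not in the image of `X`. -/
theorem sq_notMem : A.mul y y ∉ Submodule.map₂ A.mul (A.part 0) (A.part 0) := by
  have hle : Submodule.map₂ A.mul (A.part 0) (A.part 0) ≤ LinearMap.range (R A (A.mul y y)) := by
    rw [Submodule.map₂_le]
    intro u _ v hv
    obtain ⟨c, hc⟩ := h.exists_R_even hA hv
    change R A v u ∈ _
    rw [hc]
    exact Submodule.smul_mem _ _ ⟨u, rfl⟩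
  intro hmem
  obtain ⟨v, hv⟩ := hle hmem
  obtain ⟨p, q, b, rfl⟩ := h.span v
  have h1 := h.polyAct_comb hA Polynomial.X p q b
  rw [Polynomial.aeval_X, hv] at h1
  have h2 : comb A y z 1 0 0 = comb A y z (Polynomial.X * p) (Polynomial.X * q)
      (Polynomial.X.coeff 0 * b) := by
    rw [← h1]; simp [comb]
  have h3 := Polynomial.X_pow_dvd_iff.1 ((h.comb_eq_iff hA).1 h2).1 0 (by omega)
  simp at h3

/-- The vectors `Xⁱ [y, y]` and `Xⁱ y`, `z`, indexed as Jordan chains. -/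
theorem exists_chains : Module.finrank ℂ (A.part 0) = n ∧ Module.finrank ℂ (A.part 1) = n + 1 ∧
    HasJordanBlocks (A.mul.flip (A.mul y y)) (A.part 0) [n] ∧
    HasJordanBlocks (A.mul.flip (A.mul y y)) (A.part 1) [n, 1] := by
  have hfin : Module.Finite ℂ L := Module.finite_of_finrank_pos (by rw [h.finrank]; omega)
  let e0 : (Σ i : Fin [n].length, Fin ([n].get i)) → A.part 0 := fun i =>
    ⟨polyAct A y (Polynomial.X ^ (i.2 : ℕ)) (A.mul y y),
      hA.polyAct_mem h.left_mem _ (hA.sq_mem h.left_mem)⟩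
  let e1 : (Σ i : Fin [n, 1].length, Fin ([n, 1].get i)) → A.part 1 := fun i =>
    if i.1 = 0 then ⟨polyAct A y (Polynomial.X ^ (i.2 : ℕ)) y,
      hA.polyAct_mem h.left_mem _ h.left_mem⟩ else ⟨z, h.right_mem⟩
  have hl := h.linearIndependent hA
  have l0 : LinearIndependent ℂ e0 := by
    refine LinearIndependent.of_comp (A.part 0).subtype ?_
    let g : (Σ i : Fin [n].length, Fin ([n].get i)) → Fin n ⊕ (Fin n ⊕ Unit) := fun i =>
      Sum.inl ⟨i.2, lt_of_lt_of_eq i.2.2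
        (congrArg [n].get (Subsingleton.elim (α := Fin 1) i.1 0))⟩
    have hg : Function.Injective g := by
      rintro ⟨i, k⟩ ⟨i', k'⟩ hi
      obtain rfl : i = i' := Subsingleton.elim (α := Fin 1) _ _
      simp only [g, Sum.inl.injEq, Fin.mk.injEq] at hi
      rw [Fin.ext hi]
    exact hl.comp g hg
  have l1 : LinearIndependent ℂ e1 := by
    refine LinearIndependent.of_comp (A.part 1).subtype ?_
    let g : (Σ i : Fin [n, 1].length, Fin ([n, 1].get i)) → Fin n ⊕ (Fin n ⊕ Unit) := fun i =>
      if h' : i.1 = 0 then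
        Sum.inr (Sum.inl ⟨i.2, lt_of_lt_of_eq i.2.2 (congrArg [n, 1].get h')⟩)
      else Sum.inr (Sum.inr ())
    have hg : Function.Injective g := by
      rintro ⟨i, k⟩ ⟨i', k'⟩ hi
      simp only [g] at hi
      by_cases h0 : i = 0
      · by_cases h0' : i' = 0
        · subst h0 h0'
          simp only [dif_pos, Sum.inr.injEq, Sum.inl.injEq, Fin.mk.injEq] at hi
          rw [Fin.ext hi]
        · rw [dif_pos h0, dif_neg h0'] at hi
          cases hi
      · by_cases h0' : i' = 0
        · rw [dif_neg h0, dif_pos h0'] at hi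
          cases hi
        · have one : ∀ i : Fin 2, i ≠ 0 → i = 1 := by decide
          obtain rfl : i = 1 := one i h0
          obtain rfl : i' = 1 := one i' h0'
          rw [Subsingleton.elim (α := Fin 1) k k']
    have := hl.comp g hg
    convert this using 1
    funext i
    simp only [Function.comp_apply, e1, g]
    split_ifs <;> rfl
  have c0 : Fintype.card (Σ i : Fin [n].length, Fin ([n].get i)) = n := by
    simp [Fintype.card_sigma]
  have c1 : Fintype.card (Σ i : Fin [n, 1].length, Fin ([n, 1].get i)) = n + 1 := by
    simp [Fintype.card_sigma]
  -- Independence bounds the two dimensions below by `n` and `n + 1`; their sum `2n + 1` makes both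
  -- bounds sharp.
  have hsum := Submodule.finrank_add_eq_of_isCompl hA.isCompl
  have d0 := l0.fintype_card_le_finrank
  have d1 := l1.fintype_card_le_finrank
  rw [h.finrank] at hsum
  have f0 : Module.finrank ℂ (A.part 0) = n := by omega
  have f1 : Module.finrank ℂ (A.part 1) = n + 1 := by omega
  have hpow : ∀ (k : ℕ) (v : L), A.mul.flip (A.mul y y) (polyAct A y (Polynomial.X ^ k) v) =
      polyAct A y (Polynomial.X ^ (k + 1)) v := by
    intro k v
    rw [Polynomial.aeval_X_pow, Polynomial.aeval_X_pow, pow_succ']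
    rfl
  have : Nonempty (Σ i : Fin [n].length, Fin ([n].get i)) :=
    ⟨⟨0, ⟨0, show 0 < n by omega⟩⟩⟩
  have : Nonempty (Σ i : Fin [n, 1].length, Fin ([n, 1].get i)) :=
    ⟨⟨0, ⟨0, show 0 < n by omega⟩⟩⟩
  refine ⟨f0, f1, ⟨by simp, by simp; omega,
    basisOfLinearIndependentOfCardEqFinrank l0 (by rw [c0, f0]), ?_⟩, ⟨by simp; omega,
    by simp; omega, basisOfLinearIndependentOfCardEqFinrank l1 (by rw [c1, f1]), ?_⟩⟩
  · intro i k
    obtain rfl : i = 0 := Subsingleton.elim (α := Fin 1) _ _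
    simp only [coe_basisOfLinearIndependentOfCardEqFinrank]
    simp only [e0]
    rw [hpow]
    split_ifs with hk
    · rfl
    · have hk' : (k : ℕ) < n := k.2
      have hk2 : ¬ ((k : ℕ) + 1 < n) := hk
      rw [show (k : ℕ) + 1 = n by omega]
      exact h.nilpotent_sq hA
  · intro i k
    simp only [coe_basisOfLinearIndependentOfCardEqFinrank]
    simp only [e1]
    by_cases h0 : i = 0
    · subst h0
      simp only [if_true]
      rw [hpow]
      split_ifs with hk
      · rfl
      · have hk' : (k : ℕ) < n := k.2
        have hk2 : ¬ ((k : ℕ) + 1 < n) := hk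
        rw [show (k : ℕ) + 1 = n by omega]
        exact h.nilpotent
    · have one : ∀ i : Fin 2, i ≠ 0 → i = 1 := by decide
      obtain rfl : i = 1 := one i h0
      rw [if_neg h0, dif_neg]
      · exact h.R_sq_right hA
      · change ¬ ((k : ℕ) + 1 < 1)
        omega

/-- Every even element acts by a multiple of `X`, and `Xⁿ = 0`, so no Jordan block exceeds `n`.
Among the sequences with sum `n + 1` and entries at most `n`, `(n, 1)` is the greatest. -/
theorem isOfType : IsOfType n (n + 1) A := by
  obtain ⟨f0, f1, b0, b1⟩ := h.exists_chains hA hn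
  refine ⟨hA, f0, f1, ⟨⟨⟨_, hA.sq_mem h.left_mem, h.sq_notMem hA hn, b0⟩, ?_⟩,
    ⟨⟨_, hA.sq_mem h.left_mem, h.sq_notMem hA hn, b1⟩, ?_⟩⟩, ?_⟩
  · rintro s ⟨u, hu, -, hs⟩
    exact list_le_singleton ((sum_eq_of_blocks hs).trans f0) hs.2.1
  · rintro s ⟨u, hu, -, hs⟩
    refine list_le_pair ((sum_eq_of_blocks hs).trans f1) fun d hd => ⟨hs.2.1 d hd,
      le_of_mem_blocks hs (fun v _ => ?_) hd⟩
    obtain ⟨c, hc⟩ := h.exists_R_even hA hu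
    change (R A u ^ n) v = 0
    rw [hc, smul_pow, h.R_sq_pow hA hn]
    simp
  · have := h.hasNilindex hA hn
    rwa [show n + (n + 1) = 2 * n + 1 by omega]

end IsGen

end OfType

end LeibnizSuper

namespace LeibnizSuper

/-! ### The descending central sequence and the number of generators -/

section Power

variable {L : Type*} [AddCommGroup L] [Module ℂ L] {A : SuperProduct L}

theorem finrank_span_singleton_le_one (x : L) : Module.finrank ℂ (Submodule.span ℂ {x}) ≤ 1 := by
  simpa using finrank_span_le_card (R := ℂ) ({x} : Set L)

/-- The powers are graded, which permits the use of the sign-dependent Leibniz identity inside them.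
-/
theorem exists_add_power (hA : IsLeibniz A) {k : ℕ} (hk : 1 ≤ k) {v : L} (hv : v ∈ power A k) :
    ∃ v₀ ∈ power A k, ∃ v₁ ∈ power A k, v₀ ∈ A.part 0 ∧ v₁ ∈ A.part 1 ∧ v₀ + v₁ = v := by
  suffices h : power A k ≤ (power A k ⊓ A.part 0) ⊔ (power A k ⊓ A.part 1) by
    obtain ⟨v₀, h0, v₁, h1, e⟩ := Submodule.mem_sup.1 (h hv)
    exact ⟨v₀, h0.1, v₁, h1.1, h0.2, h1.2, e⟩
  induction k, hk using Nat.le_induction generalizing v with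
  | base => rw [power_one, top_inf_eq, top_inf_eq, hA.isCompl.sup_eq_top]
  | succ k hk ih =>
    nth_rw 1 [power_succ A hk]
    rw [Submodule.map₂_le]
    intro u hu w _
    obtain ⟨u₀, h0, u₁, h1, rfl⟩ := Submodule.mem_sup.1 (ih hu hu)
    obtain ⟨w₀, g0, w₁, g1, rfl⟩ := hA.exists_add w
    have e : A.mul (u₀ + u₁) (w₀ + w₁) =
        (A.mul u₀ w₀ + A.mul u₁ w₁) + (A.mul u₀ w₁ + A.mul u₁ w₀) := by
      simp only [map_add, LinearMap.add_apply]
      abel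
    rw [e]
    exact Submodule.add_mem_sup
      ⟨Submodule.add_mem _ (mul_mem_power hk h0.1 _) (mul_mem_power hk h1.1 _),
        Submodule.add_mem _ (hA.even_even_mem h0.2 g0) (hA.odd_odd_mem h1.2 g1)⟩
      ⟨Submodule.add_mem _ (mul_mem_power hk h0.1 _) (mul_mem_power hk h1.1 _),
        Submodule.add_mem _ (hA.even_odd_mem h0.2 g1) (hA.odd_even_mem h1.2 g0)⟩

/-- Induction on `k`: the Leibniz identity moves the last factor of an element of `Lᵏ⁺¹` to the
outside. -/
theorem mul_power_mem (hA : IsLeibniz A) {j k : ℕ} (hj : 1 ≤ j) (hk : 1 ≤ k) {u v : L}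
    (hu : u ∈ power A j) (hv : v ∈ power A k) : A.mul u v ∈ power A (j + k) := by
  induction k, hk using Nat.le_induction generalizing j u v with
  | base => exact mul_mem_power hj hu v
  | succ k hk ih =>
    suffices h : power A (k + 1) ≤ (power A (j + (k + 1))).comap (A.mul u) from h hv
    rw [power_succ A hk, Submodule.map₂_le]
    intro v hv w _
    rw [Submodule.mem_comap]
    have key : ∀ (a b : ZMod 2) (v w : L), v ∈ power A k → v ∈ A.part a → w ∈ A.part b →
        A.mul u (A.mul v w) ∈ power A (j + (k + 1)) := by
      intro a b v w hv ha hb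
      rw [hA.leibniz a b u v w ha hb]
      refine Submodule.sub_mem _ ?_ (Submodule.smul_mem _ _ ?_)
      · exact mul_mem_power (by omega) (ih hj hu hv) w
      · have := ih (j := j + 1) (by omega) (mul_mem_power hj hu w) hv
        rwa [show j + (k + 1) = j + 1 + k by omega]
    obtain ⟨v₀, h0, v₁, h1, p0, p1, rfl⟩ := exists_add_power hA hk hv
    obtain ⟨w₀, g0, w₁, g1, rfl⟩ := hA.exists_add w
    simp only [map_add, LinearMap.add_apply]
    exact Submodule.add_mem _
      (Submodule.add_mem _ (key _ _ _ _ h0 p0 g0) (key _ _ _ _ h1 p1 g0))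
      (Submodule.add_mem _ (key _ _ _ _ h0 p0 g1) (key _ _ _ _ h1 p1 g1))

/-- If `S` spans `Lᵏ` modulo `Lᵏ⁺¹` and `T` spans `L` modulo `L²`, then the products of elements of
`S` and `T` span `Lᵏ⁺¹` modulo `Lᵏ⁺²`. -/
theorem power_step (hA : IsLeibniz A) {k : ℕ} (hk : 1 ≤ k) {S T : Set L}
    (hS : power A k ≤ Submodule.span ℂ S ⊔ power A (k + 1)) (hSk : S ⊆ power A k)
    (hT : ⊤ ≤ Submodule.span ℂ T ⊔ power A 2) {N : Submodule ℂ L}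
    (hN : ∀ s ∈ S, ∀ t ∈ T, A.mul s t ∈ N ⊔ power A (k + 2)) :
    power A (k + 1) ≤ N ⊔ power A (k + 2) := by
  rw [power_succ A hk]
  refine (Submodule.map₂_le_map₂ hS hT).trans ?_
  rw [Submodule.map₂_sup_left, Submodule.map₂_sup_right]
  refine sup_le (sup_le ?_ ?_) ?_
  · rw [Submodule.map₂_span_span, Submodule.span_le]
    rintro _ ⟨s, hs, t, ht, rfl⟩
    exact hN s hs t ht
  · refine le_sup_of_le_right ?_
    rw [Submodule.map₂_le]
    intro u hu v hv
    exact mul_power_mem hA hk (by omega) (Submodule.span_le.2 hSk hu) hv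
  · refine le_sup_of_le_right ?_
    rw [Submodule.map₂_le]
    intro u hu v hv
    exact mul_mem_power (by omega) hu v

namespace IsOfType

variable {n : ℕ} (h : IsOfType n (n + 1) A) (hn : 2 ≤ n)
include h

theorem power_eq_bot : power A (2 * n + 1) = ⊥ := by
  have := h.nilindex.1.2
  rwa [show n + (n + 1) = 2 * n + 1 by omega] at this

theorem power_ne_bot {k : ℕ} (hk : 1 ≤ k) (hk' : k ≤ 2 * n) : power A k ≠ ⊥ := by
  intro hb
  have := h.nilindex.2 ⟨hk, hb⟩
  omega

/-- Once two consecutive powers agree, the sequence is constant and never reaches zero. -/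
theorem power_lt {k : ℕ} (hk : 1 ≤ k) (hk' : k ≤ 2 * n) : power A (k + 1) < power A k := by
  refine lt_of_le_of_ne (power_succ_le A hk) fun he => h.power_ne_bot hk hk' ?_
  have : ∀ j, power A (k + j) = power A k := by
    intro j
    induction j with
    | zero => rfl
    | succ j ih =>
      rw [← add_assoc, power_succ A (by omega), ih, ← power_succ A hk, he]
  have h1 := this (2 * n + 1 - k)
  rw [show k + (2 * n + 1 - k) = 2 * n + 1 by omega, h.power_eq_bot] at h1
  exact h1.symm

include hn

theorem finite : Module.Finite ℂ (A.part 0) ∧ Module.Finite ℂ (A.part 1) :=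
  ⟨Module.finite_of_finrank_pos (by rw [h.finrank_even]; omega),
    Module.finite_of_finrank_pos (by rw [h.finrank_odd]; omega)⟩

theorem finiteDimensional : Module.Finite ℂ L := by
  obtain ⟨h0, h1⟩ := h.finite hn
  have := Submodule.finite_sup (A.part 0) (A.part 1)
  rw [h.isLeibniz.isCompl.sup_eq_top] at this
  exact Module.finite_def.2 (Module.Finite.iff_fg.1 this)

theorem finrank_eq : Module.finrank ℂ L = 2 * n + 1 := by
  have := h.finiteDimensional hn
  rw [← Submodule.finrank_add_eq_of_isCompl h.isLeibniz.isCompl, h.finrank_even, h.finrank_odd]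
  omega

theorem le_finrank_power {k : ℕ} (hk : 1 ≤ k) (hk' : k ≤ 2 * n + 1) :
    2 * n + 1 - k ≤ Module.finrank ℂ (power A k) := by
  have := h.finiteDimensional hn
  induction hk' using Nat.decreasingInduction with
  | self => omega
  | of_succ k hk' ih =>
    have h1 := Submodule.finrank_lt_finrank_of_lt (h.power_lt hk (by omega))
    have := ih (by omega)
    omega

/-- If `L / L²` had dimension one, a single generator `v` would make every quotient `Lᵏ / Lᵏ⁺¹` at
most one-dimensional. With nilindex `2n + 1` this would give `dim L ≤ 2n`. -/
theorem finrank_power_two_le : Module.finrank ℂ (power A 2) ≤ 2 * n - 1 := by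
  have := h.finiteDimensional hn
  by_contra hcon
  push Not at hcon
  have htop : Module.finrank ℂ (⊤ : Submodule ℂ L) = 2 * n + 1 := by
    rw [finrank_top, h.finrank_eq hn]
  have hlt := Submodule.finrank_lt_finrank_of_lt (h.power_lt (k := 1) le_rfl (by omega))
  rw [power_one, htop] at hlt
  obtain ⟨v, hv⟩ : ∃ v, v ∉ power A 2 := by
    by_contra hc
    push Not at hc
    have : power A 2 = ⊤ := eq_top_iff.2 fun x _ => hc x
    rw [this, htop] at hlt
    omega
  have hspan : ⊤ ≤ Submodule.span ℂ {v} ⊔ power A 2 := by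
    refine (Submodule.eq_top_of_finrank_eq ?_).ge
    have h1 : power A 2 < Submodule.span ℂ {v} ⊔ power A 2 := by
      refine lt_of_le_of_ne le_sup_right fun he => hv ?_
      rw [he]
      exact Submodule.mem_sup_left (Submodule.mem_span_singleton_self v)
    have h2 := Submodule.finrank_lt_finrank_of_lt h1
    have h3 := Submodule.finrank_le (Submodule.span ℂ {v} ⊔ power A 2)
    rw [h.finrank_eq hn] at h3 ⊢
    omega
  have key : ∀ k, 1 ≤ k → ∃ w ∈ power A k, power A k ≤ Submodule.span ℂ {w} ⊔ power A (k + 1) := by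
    intro k hk
    induction k, hk using Nat.le_induction with
    | base => exact ⟨v, trivial, hspan⟩
    | succ k hk ih =>
      obtain ⟨w, hw, hle⟩ := ih
      refine ⟨A.mul w v, mul_mem_power hk hw v, ?_⟩
      refine power_step h.isLeibniz hk hle (Set.singleton_subset_iff.2 hw) hspan ?_
      rintro s rfl t rfl
      exact Submodule.mem_sup_left (Submodule.mem_span_singleton_self _)
  have hstep : ∀ k, 1 ≤ k →
      Module.finrank ℂ (power A k) ≤ Module.finrank ℂ (power A (k + 1)) + 1 := by
    intro k hk
    obtain ⟨w, -, hle⟩ := key k hk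
    have h1 := Submodule.finrank_mono hle
    have h2 := Submodule.finrank_add_le_finrank_add_finrank (Submodule.span ℂ {w}) (power A (k + 1))
    have h3 := finrank_span_singleton_le_one w
    omega
  -- Count downwards from `L^{2n+1} = 0`. The second alternative excludes the indices `2n + 1 - k`
  -- that drop to `0`.
  have hall : ∀ k, Module.finrank ℂ (power A (2 * n + 1 - k)) ≤ k ∨ 2 * n < k := by
    intro k
    induction k with
    | zero => left; rw [Nat.sub_zero, h.power_eq_bot, finrank_bot]
    | succ k ih =>
      by_cases hk : 2 * n < k + 1
      · exact Or.inr hk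
      · left
        have h1 := ih.resolve_right (by omega)
        have h2 := hstep (2 * n + 1 - (k + 1)) (by omega)
        rw [show 2 * n + 1 - (k + 1) + 1 = 2 * n + 1 - k by omega] at h2
        omega
  have h1 := (hall (2 * n)).resolve_right (by omega)
  rw [show 2 * n + 1 - 2 * n = 1 by omega, power_one, htop] at h1
  omega

/-- A strictly decreasing sequence from at most `2n - 1` at `k = 2` to `0` at `k = 2n + 1` has no
freedom. -/
theorem finrank_power {k : ℕ} (hk : 2 ≤ k) (hk' : k ≤ 2 * n + 1) :
    Module.finrank ℂ (power A k) = 2 * n + 1 - k := by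
  have := h.finiteDimensional hn
  refine le_antisymm ?_ (h.le_finrank_power hn (by omega) hk')
  induction k, hk using Nat.le_induction with
  | base => exact (h.finrank_power_two_le hn).trans (by omega)
  | succ k hk ih =>
    have h1 := Submodule.finrank_lt_finrank_of_lt (h.power_lt (k := k) (by omega) (by omega))
    have := ih (by omega)
    omega

/-- The quotients `Lᵏ / Lᵏ⁺¹` with `k ≥ 2` have dimension at most one. -/
theorem power_le_span {k : ℕ} (hk : 2 ≤ k) {w : L} (hw : w ∈ power A k)
    (hw' : w ∉ power A (k + 1)) : power A k ≤ Submodule.span ℂ {w} ⊔ power A (k + 1) := by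
  have := h.finiteDimensional hn
  rcases Nat.lt_or_ge (2 * n) k with hk' | hk'
  · refine absurd ?_ hw'
    have := power_antitone A (show 1 ≤ 2 * n + 1 by omega) (show 2 * n + 1 ≤ k by omega) hw
    rw [h.power_eq_bot, Submodule.mem_bot] at this
    rw [this]
    exact Submodule.zero_mem _
  · have hle : Submodule.span ℂ {w} ⊔ power A (k + 1) ≤ power A k :=
      sup_le ((Submodule.span_singleton_le_iff_mem _ _).2 hw) (power_succ_le A (by omega))
    have h1 : power A (k + 1) < Submodule.span ℂ {w} ⊔ power A (k + 1) := by
      refine lt_of_le_of_ne le_sup_right fun he => hw' ?_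
      rw [he]
      exact Submodule.mem_sup_left (Submodule.mem_span_singleton_self w)
    have h2 := Submodule.finrank_lt_finrank_of_lt h1
    rw [h.finrank_power hn (by omega) (by omega)] at h2
    refine (Submodule.eq_of_le_of_finrank_le hle ?_).ge
    rw [h.finrank_power hn hk (by omega)]
    omega

/-- Two elements which are independent modulo `L²` span `L` modulo `L²`; the second one may be
chosen odd. -/
theorem exists_odd_generator {x : L} (hx : x ∉ power A 2)
    (hxp : A.part 0 ≤ Submodule.span ℂ {x} ⊔ power A 2) :
    ∃ y ∈ A.part 1, ⊤ ≤ Submodule.span ℂ {x, y} ⊔ power A 2 := by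
  have := h.finiteDimensional hn
  have h1 : power A 2 < Submodule.span ℂ {x} ⊔ power A 2 := by
    refine lt_of_le_of_ne le_sup_right fun he => hx ?_
    rw [he]
    exact Submodule.mem_sup_left (Submodule.mem_span_singleton_self x)
  have h2 := Submodule.finrank_lt_finrank_of_lt h1
  rw [h.finrank_power hn le_rfl (by omega)] at h2
  have h3 : Module.finrank ℂ ↥(Submodule.span ℂ {x} ⊔ power A 2) ≤ 2 * n := by
    have h4 := Submodule.finrank_add_le_finrank_add_finrank (Submodule.span ℂ {x}) (power A 2)
    have h5 := finrank_span_singleton_le_one x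
    rw [h.finrank_power hn le_rfl (by omega)] at h4
    omega
  obtain ⟨y, hy, hy'⟩ : ∃ y ∈ A.part 1, y ∉ Submodule.span ℂ {x} ⊔ power A 2 := by
    by_contra hc
    push Not at hc
    have h4 : Submodule.span ℂ {x} ⊔ power A 2 = ⊤ := by
      rw [eq_top_iff, ← h.isLeibniz.isCompl.sup_eq_top]
      exact sup_le hxp hc
    rw [h4, finrank_top, h.finrank_eq hn] at h3
    omega
  refine ⟨y, hy, ?_⟩
  have hle : Submodule.span ℂ {x} ⊔ power A 2 ≤ Submodule.span ℂ {x, y} ⊔ power A 2 :=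
    sup_le_sup_right (Submodule.span_mono (by simp)) _
  have h4 : Submodule.span ℂ {x} ⊔ power A 2 < Submodule.span ℂ {x, y} ⊔ power A 2 := by
    refine lt_of_le_of_ne hle fun he => hy' ?_
    rw [he]
    exact Submodule.mem_sup_left (Submodule.subset_span (by simp))
  have h5 := Submodule.finrank_lt_finrank_of_lt h4
  refine (Submodule.eq_top_of_finrank_eq ?_).ge
  have h6 := Submodule.finrank_le (Submodule.span ℂ {x, y} ⊔ power A 2)
  rw [h.finrank_eq hn] at h6 ⊢
  omega

end IsOfType

/-! ### The even part and its generator -/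

/-- `x` generates the even part of `L` as in a null-filiform algebra. -/
structure IsEvenGen (A : SuperProduct L) (n : ℕ) (x : L) : Prop where
  mem : x ∈ A.part 0
  exists_add : ∀ v ∈ A.part 0, ∃ c : ℂ, ∃ w ∈ A.part 0, v = c • x + R A x w
  pow_eq_zero : (R A x) ^ n = 0
  finrank : Module.finrank ℂ (A.part 0) = n

/-- Iterate `v = c x + f w`; after `n` steps the remainder `fⁿ w` is zero. -/
theorem exists_aeval_of_exists_add {f : Module.End ℂ L} {N : Submodule ℂ L} {x : L} {n : ℕ}
    (hadd : ∀ v ∈ N, ∃ c : ℂ, ∃ w ∈ N, v = c • x + f w) (hf : ∀ v ∈ N, (f ^ n) v = 0) {v : L}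
    (hv : v ∈ N) : ∃ p : Polynomial ℂ, v = Polynomial.aeval f p x := by
  have key : ∀ k : ℕ, ∃ p : Polynomial ℂ, ∃ w ∈ N, v = Polynomial.aeval f p x + (f ^ k) w := by
    intro k
    induction k with
    | zero => exact ⟨0, v, hv, by simp⟩
    | succ k ih =>
      obtain ⟨p, w, hw, e⟩ := ih
      obtain ⟨c, w', hw', rfl⟩ := hadd w hw
      refine ⟨p + Polynomial.C c * Polynomial.X ^ k, w', hw', ?_⟩
      rw [e]
      simp only [map_add, LinearMap.add_apply, map_mul, Polynomial.aeval_C, Polynomial.aeval_X_pow,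
        Module.End.mul_apply, Module.algebraMap_end_apply, map_smul, pow_succ, add_assoc]
  obtain ⟨p, w, hw, e⟩ := key n
  exact ⟨p, by rw [e, hf w hw, add_zero]⟩

namespace IsEvenGen

variable {n : ℕ} {x : L} (hA : IsLeibniz A) (h : IsEvenGen A n x)
include h

theorem exists_aeval {v : L} (hv : v ∈ A.part 0) :
    ∃ p : Polynomial ℂ, v = Polynomial.aeval (R A x) p x :=
  exists_aeval_of_exists_add h.exists_add
    (fun v _ => by rw [h.pow_eq_zero, LinearMap.zero_apply]) hv

theorem aeval_of_dvd {p : Polynomial ℂ} (hp : Polynomial.X ^ n ∣ p) :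
    Polynomial.aeval (R A x) p = 0 := by
  obtain ⟨r, rfl⟩ := hp
  rw [map_mul, Polynomial.aeval_X_pow, h.pow_eq_zero, zero_mul]

include hA

theorem aeval_mem (p : Polynomial ℂ) : Polynomial.aeval (R A x) p x ∈ A.part 0 :=
  aeval_apply_mem (f := R A x) (N := A.part 0)
    (fun u (hu : u ∈ A.part 0) => hA.mul_even_mem hu h.mem) p h.mem

theorem aeval_eq_zero_iff {p : Polynomial ℂ} :
    Polynomial.aeval (R A x) p x = 0 ↔ Polynomial.X ^ n ∣ p := by
  refine ⟨fun h0 => ?_, fun hp => by rw [h.aeval_of_dvd hp, LinearMap.zero_apply]⟩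
  have hsum : ∀ p : Polynomial ℂ, Polynomial.aeval (R A x) p x =
      ∑ i : Fin n, p.coeff i • ((R A x) ^ (i : ℕ)) x := by
    intro p
    have := LinearMap.congr_fun (h.aeval_of_dvd (X_pow_dvd_sub_sum n p)) x
    simpa only [map_sub, map_sum, LinearMap.sub_apply, LinearMap.sum_apply, map_mul,
      Polynomial.aeval_C, Polynomial.aeval_X_pow, Module.End.mul_apply,
      Module.algebraMap_end_apply, sub_eq_zero, LinearMap.zero_apply] using this
  have hmem : ∀ i : Fin n, ((R A x) ^ (i : ℕ)) x ∈ A.part 0 := by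
    intro i
    have := h.aeval_mem hA (Polynomial.X ^ (i : ℕ))
    rwa [Polynomial.aeval_X_pow] at this
  let e : Fin n → A.part 0 := fun i => ⟨_, hmem i⟩
  have hspan : ⊤ ≤ Submodule.span ℂ (Set.range e) := by
    rintro ⟨v, hv⟩ -
    obtain ⟨p, rfl⟩ := h.exists_aeval hv
    have : (⟨Polynomial.aeval (R A x) p x, hv⟩ : A.part 0) = ∑ i : Fin n, p.coeff i • e i := by
      apply Subtype.ext
      simp [hsum p, e]
    rw [this]
    exact Submodule.sum_mem _ fun i _ => Submodule.smul_mem _ _ (Submodule.subset_span ⟨i, rfl⟩)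
  have hli := linearIndependent_of_top_le_span_of_card_eq_finrank hspan
    (by rw [h.finrank, Fintype.card_fin])
  have h1 : ∑ i : Fin n, p.coeff i • e i = 0 := by
    apply Subtype.ext
    simpa [e, hsum p] using h0
  have h2 := Fintype.linearIndependent_iff.1 hli _ h1
  exact Polynomial.X_pow_dvd_iff.2 fun d hd => h2 ⟨d, hd⟩

theorem R_aeval (p : Polynomial ℂ) :
    R A (Polynomial.aeval (R A x) p x) = p.coeff 0 • R A x :=
  hA.R_aeval h.mem h.mem (Commute.refl _) p

/-- On the even part, `X w` is a polynomial without constant term in `X` applied to `x`. -/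
theorem R_apply_eq_zero {w : L} (hw : w ∈ A.part 0) : R A (R A x w) = 0 := by
  obtain ⟨p, rfl⟩ := h.exists_aeval hw
  have := h.R_aeval hA (Polynomial.X * p)
  rw [map_mul, Polynomial.aeval_X, Module.End.mul_apply, Polynomial.mul_coeff_zero,
    Polynomial.coeff_X_zero, zero_mul, zero_smul] at this
  exact this

theorem ne_zero (hn : 2 ≤ n) : R A x x ≠ 0 := by
  intro h0
  have h1 : Polynomial.aeval (R A x) (Polynomial.X : Polynomial ℂ) x = 0 := by
    rw [Polynomial.aeval_X, h0]
  have := Polynomial.X_pow_dvd_iff.1 ((h.aeval_eq_zero_iff hA).1 h1) 1 (by omega)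
  simp at this

/-- An even element killed by right multiplication is a product. -/
theorem exists_of_R_eq_zero (hn : 2 ≤ n) {v : L} (hv : v ∈ A.part 0) (h0 : R A v = 0) :
    ∃ w ∈ A.part 0, v = R A x w := by
  obtain ⟨c, w, hw, rfl⟩ := h.exists_add v hv
  refine ⟨w, hw, ?_⟩
  rw [map_add, map_smul, h.R_apply_eq_zero hA hw, add_zero] at h0
  rcases smul_eq_zero.1 h0 with hc | hc
  · rw [hc, zero_smul, zero_add]
  · exact absurd (by rw [hc, LinearMap.zero_apply]) (h.ne_zero hA hn)

/-- The generator may be changed by products and nonzero scalars. -/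
theorem change {c : ℂ} (hc : c ≠ 0) {w : L} (hw : w ∈ A.part 0) :
    IsEvenGen A n (c • x + R A x w) ∧ R A (c • x + R A x w) = c • R A x := by
  have hR : R A (c • x + R A x w) = c • R A x := by
    rw [map_add, map_smul, h.R_apply_eq_zero hA hw, add_zero]
  have hm : R A x w ∈ A.part 0 := hA.even_even_mem hw h.mem
  refine ⟨⟨Submodule.add_mem _ (Submodule.smul_mem _ _ h.mem) hm, ?_, ?_, h.finrank⟩, hR⟩
  · intro v hv
    obtain ⟨d, u, hu, rfl⟩ := h.exists_add v hv
    -- Substitute `x = c⁻¹ (x' - X w)` into `v = d x + X u` and use `X = c⁻¹ R_{x'}`.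
    refine ⟨d * c⁻¹, c⁻¹ • (u - (d * c⁻¹) • w), Submodule.smul_mem _ _
      (Submodule.sub_mem _ hu (Submodule.smul_mem _ _ hw)), ?_⟩
    rw [hR, LinearMap.smul_apply, map_smul, smul_smul, mul_inv_cancel₀ hc, one_smul, map_sub,
      map_smul, smul_add, smul_smul, mul_assoc, inv_mul_cancel₀ hc, mul_one]
    abel
  · rw [hR, smul_pow, h.pow_eq_zero, smul_zero]

end IsEvenGen

theorem pow_eq_zero_of_blocks {f : Module.End ℂ L} {N : Submodule ℂ L} {s : List ℕ} {n : ℕ}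
    (h : HasJordanBlocks f N s) (hs : ∀ d ∈ s, d ≤ n) {v : L} (hv : v ∈ N) : (f ^ n) v = 0 := by
  obtain ⟨-, -, e, he⟩ := h
  have key : ∀ (m : ℕ) (i : Fin s.length) (k : Fin (s.get i)), s.get i ≤ m + k →
      (f ^ m) (e ⟨i, k⟩) = 0 := by
    intro m
    induction m with
    | zero =>
      intro i k hk
      omega
    | succ m ih =>
      intro i k hk
      rw [pow_succ, Module.End.mul_apply, he]
      split_ifs with h'
      · exact ih i ⟨k + 1, h'⟩ (by simp only; omega)
      · rw [map_zero]
  have h1 : (f ^ n) ∘ₗ N.subtype = 0 := by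
    refine e.ext fun ⟨i, k⟩ => ?_
    exact key n i k (by have := hs _ (List.get_mem s i); omega)
  exact LinearMap.congr_fun h1 ⟨v, hv⟩

/-- The maximum `(n)` gives an even `x` with a single Jordan block on `L₀`. Since `x ∉ [L₀, L₀]`,
`x` may replace the first vector of the chain. The maximum on `L₁` may belong to another element
`x'`, but `R_{x'}` is a nonzero multiple of `R_x`, so `Xⁿ` vanishes on `L₁` too. -/
theorem IsOfType.exists_evenGen {n : ℕ} (hn : 2 ≤ n) (h : IsOfType n (n + 1) A) :
    ∃ x, IsEvenGen A n x := by
  obtain ⟨⟨⟨x, hx, hx', hb⟩, -⟩, ⟨⟨x', g, g', hb'⟩, -⟩⟩ := h.charSeq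
  have hA := h.isLeibniz
  have hpow : ∀ v ∈ A.part 0, ((R A x) ^ n) v = 0 :=
    fun v hv => pow_eq_zero_of_blocks hb (by simp) hv
  have hpow' : ∀ v ∈ A.part 1, ((R A x') ^ n) v = 0 :=
    fun v hv => pow_eq_zero_of_blocks hb' (by simp; omega) hv
  have hadd : ∀ v ∈ A.part 0, ∃ c : ℂ, ∃ w ∈ A.part 0, v = c • x + R A x w := by
    obtain ⟨-, -, e, he⟩ := hb
    set e0 : L := Subtype.val (e ⟨0, ⟨0, show 0 < n by omega⟩⟩) with he0
    have key : ∀ v ∈ A.part 0, ∃ c : ℂ, ∃ w ∈ A.part 0, v = c • e0 + R A x w := by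
      intro v hv
      suffices hs : ∀ u : A.part 0, u ∈ (Submodule.span ℂ {e0} ⊔
          (A.part 0).map (R A x)).comap (A.part 0).subtype by
        obtain ⟨a, ha, b, ⟨w, hw, rfl⟩, hab⟩ := Submodule.mem_sup.1 (hs ⟨v, hv⟩)
        obtain ⟨c, rfl⟩ := Submodule.mem_span_singleton.1 ha
        exact ⟨c, w, hw, hab.symm⟩
      intro u
      have hu : u ∈ Submodule.span ℂ (Set.range e) := by rw [e.span_eq]; trivial
      refine Submodule.span_le.2 ?_ hu
      rintro _ ⟨⟨i, k⟩, rfl⟩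
      obtain rfl : i = 0 := Subsingleton.elim (α := Fin 1) _ _
      obtain ⟨k, hk⟩ := k
      rcases k with _ | k
      · exact Submodule.mem_sup_left (Submodule.mem_span_singleton_self _)
      · refine Submodule.mem_sup_right ⟨e ⟨0, ⟨k, by omega⟩⟩, Subtype.mem _, ?_⟩
        have := he 0 ⟨k, by omega⟩
        rw [dif_pos hk] at this
        exact this
    obtain ⟨c, w, hw, hcx⟩ := key x hx
    have hc : c ≠ 0 := by
      rintro rfl
      refine hx' ?_
      rw [zero_smul, zero_add] at hcx
      have := Submodule.apply_mem_map₂ A.mul hw hx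
      rwa [show A.mul w x = x from hcx.symm] at this
    intro v hv
    obtain ⟨d, u, hu, rfl⟩ := key v hv
    refine ⟨d * c⁻¹, u - (d * c⁻¹) • w, Submodule.sub_mem _ hu (Submodule.smul_mem _ _ hw), ?_⟩
    nth_rw 2 [hcx]
    rw [smul_add, smul_smul, mul_assoc, inv_mul_cancel₀ hc, mul_one, map_sub, map_smul]
    abel
  refine ⟨x, hx, hadd, ?_, h.finrank_even⟩
  obtain ⟨p, hp⟩ := exists_aeval_of_exists_add hadd hpow g
  have hR : R A x' = p.coeff 0 • R A x := by
    rw [hp]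
    exact hA.R_aeval hx hx (Commute.refl _) p
  have hp0 : p.coeff 0 ≠ 0 := by
    intro h0
    obtain ⟨r, rfl⟩ := Polynomial.X_dvd_iff.2 h0
    refine g' ?_
    rw [hp, map_mul, Polynomial.aeval_X, Module.End.mul_apply]
    exact Submodule.apply_mem_map₂ A.mul (aeval_apply_mem (f := R A x) (N := A.part 0)
      (fun u (hu : u ∈ A.part 0) => hA.mul_even_mem hu hx) r hx) hx
  ext v
  obtain ⟨v₀, h0, v₁, h1, rfl⟩ := hA.exists_add v
  have h2 := hpow' v₁ h1
  rw [hR, smul_pow, LinearMap.smul_apply] at h2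
  rw [map_add, hpow v₀ h0, (smul_eq_zero.1 h2).resolve_left (pow_ne_zero _ hp0), add_zero,
    LinearMap.zero_apply]

end Power

end LeibnizSuper

namespace LeibnizSuper

/-! ### Excluding one even and one odd generator -/

section MixedGenerators

variable {L : Type*} [AddCommGroup L] [Module ℂ L] {A : SuperProduct L} {n : ℕ}

theorem pow_apply_mem_power {x v : L} {j : ℕ} (hj : 1 ≤ j) (hv : v ∈ power A j) (k : ℕ) :
    ((R A x) ^ k) v ∈ power A (j + k) := by
  induction k with
  | zero => exact hv
  | succ k ih =>
    rw [pow_succ', Module.End.mul_apply]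
    exact mul_mem_power (by omega) ih x

namespace IsOfType

variable (h : IsOfType n (n + 1) A) (hn : 2 ≤ n) {x : L} (hx : IsEvenGen A n x)
  (hx2 : x ∉ power A 2)
include h hn hx hx2

omit h hn in
theorem exists_of_mem_power_two {v : L} (hv : v ∈ A.part 0) (hv2 : v ∈ power A 2) :
    ∃ w ∈ A.part 0, v = R A x w := by
  obtain ⟨c, w, hw, rfl⟩ := hx.exists_add v hv
  refine ⟨w, hw, ?_⟩
  have h1 : R A x w ∈ power A 2 := mul_mem_power (k := 1) le_rfl trivial x
  have h2 : c • x ∈ power A 2 := (Submodule.add_mem_iff_left _ h1).1 hv2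
  rcases eq_or_ne c 0 with rfl | hc
  · rw [zero_smul, zero_add]
  · exact absurd ((Submodule.smul_mem_iff _ hc).1 h2) hx2

omit hn in
-- A product of odd elements is even and in `L²`; as `x ∉ L²`, it is of the form `X w` and acts
-- trivially from the right.
theorem R_anticommute {u v : L} (hu : u ∈ A.part 1) (hv : v ∈ A.part 1) :
    R A v * R A u + R A u * R A v = 0 := by
  obtain ⟨w, hw, e⟩ := exists_of_mem_power_two hx hx2 (h.isLeibniz.odd_odd_mem hu hv)
    (mul_mem_power (k := 1) le_rfl trivial v)
  rw [← h.isLeibniz.R_mul_odd_odd hu hv, e, hx.R_apply_eq_zero h.isLeibniz hw]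

/-- If the generators are even and odd and commute modulo `L³`, the algebra is too small. -/
theorem mul_notMem_power_three {y : L} (hy : y ∈ A.part 1)
    (hgen : ⊤ ≤ Submodule.span ℂ {x, y} ⊔ power A 2) : A.mul y x ∉ power A 3 := by
  intro h3
  have hA := h.isLeibniz
  have hYY : R A y * R A y = 0 := by
    have := h.R_anticommute hx hx2 hy hy
    rw [← two_smul ℂ] at this
    simpa using this
  -- The commutator of `X` and `R_y` is right multiplication by `[y, x] ∈ L³`, which lands one step
  -- deeper than expected.
  have hcomm : ∀ (k j : ℕ) (v : L), 1 ≤ j → v ∈ power A j →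
      R A y (((R A x) ^ k) v) - ((R A x) ^ k) (R A y v) ∈ power A (j + k + 2) := by
    intro k j v hj hv
    induction k with
    | zero => simp
    | succ k ih =>
      have h1 : R A y (((R A x) ^ (k + 1)) v) - ((R A x) ^ (k + 1)) (R A y v) =
          R A x (R A y (((R A x) ^ k) v) - ((R A x) ^ k) (R A y v)) -
          A.mul (((R A x) ^ k) v) (A.mul y x) := by
        have := LinearMap.congr_fun (hA.R_mul_even hy hx.mem) (((R A x) ^ k) v)
        rw [LinearMap.flip_apply] at this
        rw [this, pow_succ']
        simp only [Module.End.mul_apply, map_sub, LinearMap.sub_apply]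
        abel
      rw [h1]
      refine Submodule.sub_mem _ (mul_mem_power (by omega) ih x) ?_
      have := mul_power_mem hA (by omega) (by omega) (pow_apply_mem_power hj hv (x := x) k) h3
      rwa [show j + (k + 1) + 2 = j + k + 3 by omega]
  -- Modulo deeper powers `R_y` can be moved to the innermost place, and two factors `R_y` cancel.
  -- Only `Xᵏ` and `Xᵏ⁻¹ R_y` survive.
  have key : ∀ k, 1 ≤ k → power A (k + 1) ≤ (LinearMap.range ((R A x) ^ k) ⊔
      LinearMap.range ((R A x) ^ (k - 1) * R A y)) ⊔ power A (k + 2) := by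
    intro k hk
    induction k, hk using Nat.le_induction with
    | base =>
      refine power_step hA le_rfl (S := Set.univ) (T := {x, y}) (by simp) (fun _ _ => trivial)
        hgen ?_
      rintro u - t (rfl | rfl)
      · refine Submodule.mem_sup_left (Submodule.mem_sup_left ⟨u, ?_⟩)
        rw [pow_one]; rfl
      · refine Submodule.mem_sup_left (Submodule.mem_sup_right ⟨u, ?_⟩)
        simp
    | succ k hk ih =>
      refine power_step hA (by omega) (S := power A (k + 1)) (T := {x, y}) (by simp)
        subset_rfl hgen ?_
      intro u hu t ht
      obtain ⟨u', hu', w, hw, rfl⟩ := Submodule.mem_sup.1 (ih hu)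
      obtain ⟨_, ⟨a, rfl⟩, _, ⟨b, rfl⟩, rfl⟩ := Submodule.mem_sup.1 hu'
      have hwt : A.mul w t ∈ power A (k + 1 + 2) := mul_mem_power (by omega) hw t
      obtain ⟨m, rfl⟩ : ∃ m, k = m + 1 := ⟨k - 1, by omega⟩
      rw [map_add, LinearMap.add_apply]
      refine Submodule.add_mem _ ?_ (Submodule.mem_sup_right hwt)
      simp only [Nat.add_sub_cancel]
      rcases ht with rfl | rfl
      · refine Submodule.mem_sup_left ?_
        rw [map_add, LinearMap.add_apply]
        refine Submodule.add_mem_sup ⟨a, ?_⟩ ⟨b, ?_⟩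
        · rw [pow_succ', Module.End.mul_apply]; rfl
        · rw [pow_succ', mul_assoc, Module.End.mul_apply]; rfl
      · rw [map_add, LinearMap.add_apply]
        refine Submodule.add_mem _ ?_ ?_
        · have h1 := hcomm (m + 1) 1 a le_rfl trivial
          rw [show 1 + (m + 1) + 2 = m + 1 + 1 + 2 by omega] at h1
          rw [← sub_add_cancel (A.mul (((R A x) ^ (m + 1)) a) t)
            (((R A x) ^ (m + 1)) (R A t a))]
          exact Submodule.add_mem _ (Submodule.mem_sup_right h1)
            (Submodule.mem_sup_left (Submodule.mem_sup_right ⟨a, rfl⟩))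
        · have h1 := hcomm m 2 (R A t b) (by omega) (mul_mem_power (k := 1) le_rfl trivial t)
          have h2 : R A t (R A t b) = 0 := LinearMap.congr_fun hYY b
          rw [h2, map_zero, sub_zero, show 2 + m + 2 = m + 1 + 1 + 2 by omega] at h1
          exact Submodule.mem_sup_right h1
  have hz : ∀ k, n ≤ k → (R A x) ^ k = 0 := fun k hk => pow_eq_zero_of_le hk hx.pow_eq_zero
  -- Both exponents `2n - 1` and `2n - 2` are at least `n`, so `L^{2n}` would be zero.
  have h1 := key (2 * n - 1) (by omega)
  rw [hz _ (by omega), hz _ (by omega), zero_mul, show 2 * n - 1 + 2 = 2 * n + 1 by omega,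
    h.power_eq_bot, show 2 * n - 1 + 1 = 2 * n by omega] at h1
  refine h.power_ne_bot (show 1 ≤ 2 * n by omega) le_rfl (le_bot_iff.1 (h1.trans ?_))
  simp

/-- One even and one odd generator cannot occur. -/
theorem false_of_notMem_power_two : False := by
  have hA := h.isLeibniz
  have hfin := h.finiteDimensional hn
  obtain ⟨y, hy, hgen⟩ := h.exists_odd_generator hn hx2 (by
    intro v hv
    obtain ⟨c, w, hw, rfl⟩ := hx.exists_add v hv
    exact Submodule.add_mem_sup (Submodule.smul_mem _ _ (Submodule.mem_span_singleton_self x))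
      (mul_mem_power (k := 1) le_rfl trivial x))
  have hxX : ∀ k, ((R A x) ^ k) y ∈ power A (k + 1) := fun k => by
    have := pow_apply_mem_power (A := A) (x := x) (v := y) le_rfl trivial k
    rwa [add_comm]
  have hodd : ∀ k, ((R A x) ^ k) y ∈ A.part 1 := by
    intro k
    induction k with
    | zero => exact hy
    | succ k ih =>
      rw [pow_succ', Module.End.mul_apply]
      exact hA.odd_even_mem ih hx.mem
  -- Take the end of the initial run of indices `j ≥ 1` with `Xʲ y ∉ Lʲ⁺²`. The run contains `j = 1`
  -- by the previous lemma and stops before `n` because `Xⁿ = 0`. Below, `u = Xʲ⁻¹ y` and `v = Xʲ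
  -- y`; the odd vector `v` spans `Lʲ⁺¹` modulo `Lʲ⁺²`.
  obtain ⟨j, hj1, hjn, hj, hj'⟩ : ∃ j, 1 ≤ j ∧ j < n ∧ ((R A x) ^ j) y ∉ power A (j + 2) ∧
      ((R A x) ^ (j + 1)) y ∈ power A (j + 3) := by
    by_contra hcon
    push Not at hcon
    have : ∀ j, 1 ≤ j → j ≤ n → ((R A x) ^ j) y ∉ power A (j + 2) := by
      intro j h1
      induction j, h1 using Nat.le_induction with
      | base =>
        intro _
        rw [pow_one]
        exact h.mul_notMem_power_three hn hx hx2 hy hgen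
      | succ j h1 ih =>
        intro h2
        exact hcon j h1 (by omega) (ih (by omega))
    refine this n (by omega) le_rfl ?_
    rw [hx.pow_eq_zero]
    exact Submodule.zero_mem _
  obtain ⟨m, rfl⟩ : ∃ m, j = m + 1 := ⟨j - 1, by omega⟩
  set u := ((R A x) ^ m) y with hu
  set v := ((R A x) ^ (m + 1)) y with hv
  have huv : R A x u = v := by rw [hv, pow_succ', Module.End.mul_apply]
  set e0 := R A y v with he0
  have hvp : v ∈ power A (m + 2) := hxX (m + 1)
  have hspan := h.power_le_span hn (k := m + 1 + 1) (by omega) (hxX (m + 1)) hj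
  -- `[u, y]` is even, while the quotient in which it lies is spanned by the odd vector `v`.
  have hYu : R A y u ∈ power A (m + 3) := by
    have h1 : R A y u ∈ power A (m + 1 + 1) := mul_mem_power (by omega) (hxX m) y
    obtain ⟨a, ha, w, hw, e⟩ := Submodule.mem_sup.1 (hspan h1)
    obtain ⟨c, rfl⟩ := Submodule.mem_span_singleton.1 ha
    obtain ⟨w₀, hw0, w₁, hw1, p0, p1, rfl⟩ := exists_add_power hA (by omega) hw
    have h2 : R A y u - w₀ = c • v + w₁ := by rw [← e]; abel
    have h3 : R A y u - w₀ = 0 := by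
      refine hA.disjoint (Submodule.sub_mem _ (hA.odd_odd_mem (hodd m) hy) p0) ?_
      rw [h2]
      exact Submodule.add_mem _ (Submodule.smul_mem _ _ (hodd _)) p1
    rw [sub_eq_zero.1 h3]
    exact hw0
  have hXv : R A x v ∈ power A (m + 4) := by
    have := hj'
    rw [pow_succ', Module.End.mul_apply] at this
    exact this
  have hD : ∀ p w, R A (((R A x) ^ (p + 1)) y) w =
      R A x (R A (((R A x) ^ p) y) w) - R A (((R A x) ^ p) y) (R A x w) := by
    intro p w
    have := LinearMap.congr_fun (hA.R_mul_even (hodd p) hx.mem) w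
    rw [pow_succ', Module.End.mul_apply]
    exact this
  have hDmem : ∀ p k w, 1 ≤ k → w ∈ power A k →
      R A (((R A x) ^ p) y) w ∈ power A (k + (p + 1)) :=
    fun p k w hk hw => mul_power_mem hA hk (by omega) hw (hxX p)
  -- Expand `R_{Xᵖ⁺¹ y}` as a commutator with `X`. Since `X v` lies deeper than expected, right
  -- multiplication of `v` by `Xᵖ y` is `Xᵖ e0` up to deeper terms. For `u` the same recursion gives
  -- `-(p + 1) Xᵖ e0` with `Xᵖ⁺¹ y`.
  have claim2 : ∀ p, R A (((R A x) ^ p) y) v - ((R A x) ^ p) e0 ∈ power A (m + p + 4) := by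
    intro p
    induction p with
    | zero => simp [he0]
    | succ p ih =>
      have e : R A (((R A x) ^ (p + 1)) y) v - ((R A x) ^ (p + 1)) e0 =
          R A x (R A (((R A x) ^ p) y) v - ((R A x) ^ p) e0) -
          R A (((R A x) ^ p) y) (R A x v) := by
        rw [hD, map_sub, pow_succ', Module.End.mul_apply]
        abel
      rw [e]
      refine Submodule.sub_mem _ (mul_mem_power (by omega) ih x) ?_
      have := hDmem p _ _ (by omega) hXv
      rwa [show m + (p + 1) + 4 = m + 4 + (p + 1) by omega]
  have claim1 : ∀ p : ℕ, R A (((R A x) ^ (p + 1)) y) u + ((p : ℂ) + 1) • ((R A x) ^ p) e0 ∈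
      power A (m + p + 4) := by
    intro p
    induction p with
    | zero =>
      have e : R A (((R A x) ^ (0 + 1)) y) u + (((0 : ℕ) : ℂ) + 1) • ((R A x) ^ 0) e0 =
          R A x (R A y u) := by
        rw [hD]
        simp only [pow_zero, Module.End.one_apply, huv, he0]
        push_cast
        rw [zero_add, one_smul, sub_add_cancel]
      rw [e]
      exact mul_mem_power (by omega) hYu x
    | succ p ih =>
      have e : R A (((R A x) ^ (p + 1 + 1)) y) u +
          (((p + 1 : ℕ) : ℂ) + 1) • ((R A x) ^ (p + 1)) e0 =
          R A x (R A (((R A x) ^ (p + 1)) y) u + ((p : ℂ) + 1) • ((R A x) ^ p) e0) -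
          (R A (((R A x) ^ (p + 1)) y) v - ((R A x) ^ (p + 1)) e0) := by
        rw [hD, huv, map_add, map_smul, ← Module.End.mul_apply (R A x) ((R A x) ^ p), ← pow_succ']
        push_cast
        module
      rw [e]
      have h2 := claim2 (p + 1)
      rw [show m + (p + 1) + 4 = m + p + 4 + 1 by omega] at h2 ⊢
      exact Submodule.sub_mem _ (mul_mem_power (by omega) ih x) h2
  -- `R_y` anticommutes with `R_{Xᵖ⁺¹ y}` and `[u, y]` is deep; as `p + 1 ≠ 0`, `R_y` sends `Xᵖ e0`
  -- one step too deep. So from `e0` on only `X` produces new vectors, and all of them are even.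
  have hY : ∀ p, R A y (((R A x) ^ p) e0) ∈ power A (m + p + 5) := by
    intro p
    have h1 : R A y (R A (((R A x) ^ (p + 1)) y) u + ((p : ℂ) + 1) • ((R A x) ^ p) e0) ∈
        power A (m + p + 5) := mul_mem_power (by omega) (claim1 p) y
    have h2 := LinearMap.congr_fun (h.R_anticommute hx hx2 hy (hodd (p + 1))) u
    rw [LinearMap.add_apply, Module.End.mul_apply, Module.End.mul_apply, LinearMap.zero_apply] at h2
    have h3 := hDmem (p + 1) _ _ (by omega) hYu
    rw [show m + 3 + (p + 1 + 1) = m + p + 5 by omega] at h3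
    rw [map_add, map_smul, eq_neg_of_add_eq_zero_right h2] at h1
    have h4 := (Submodule.add_mem_iff_right _ (Submodule.neg_mem _ h3)).1 h1
    have hp : (p : ℂ) + 1 ≠ 0 := by exact_mod_cast Nat.succ_ne_zero p
    exact (Submodule.smul_mem_iff _ hp).1 h4
  have he0p : e0 ∈ power A (m + 3) := mul_mem_power (by omega) hvp y
  have hchain : ∀ p, power A (m + 3 + p) ≤
      Submodule.span ℂ {((R A x) ^ p) e0} ⊔ power A (m + 3 + p + 1) := by
    intro p
    induction p with
    | zero =>
      refine power_step hA (k := m + 1 + 1) (by omega) hspan (Set.singleton_subset_iff.2 hvp)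
        hgen ?_
      rintro _ rfl t (rfl | rfl)
      · exact Submodule.mem_sup_right hXv
      · exact Submodule.mem_sup_left (Submodule.mem_span_singleton_self _)
    | succ p ih =>
      have hm := pow_apply_mem_power (x := x) (by omega) he0p p
      refine power_step hA (k := m + 3 + p) (by omega) ih
        (Set.singleton_subset_iff.2 hm) hgen ?_
      rintro _ rfl t (rfl | rfl)
      · refine Submodule.mem_sup_left ?_
        rw [pow_succ', Module.End.mul_apply]
        exact Submodule.mem_span_singleton_self _
      · have := hY p
        rw [show m + p + 5 = m + 3 + p + 2 by omega] at this
        exact Submodule.mem_sup_right this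
  have heven : ∀ p, power A (m + 3) ≤ A.part 0 ⊔ power A (m + 3 + p) := by
    intro p
    induction p with
    | zero => exact le_sup_right
    | succ p ih =>
      refine ih.trans (sup_le le_sup_left ((hchain p).trans (sup_le_sup_right ?_ _)))
      rw [Submodule.span_singleton_le_iff_mem]
      clear ih
      induction p with
      | zero => exact hA.odd_odd_mem (hodd _) hy
      | succ p ih =>
        rw [pow_succ', Module.End.mul_apply]
        exact hA.even_even_mem ih hx.mem
  have hle : power A (m + 3) ≤ A.part 0 := by
    have h1 := heven (2 * n)
    have h2 := power_antitone A (show 1 ≤ 2 * n + 1 by omega)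
      (show 2 * n + 1 ≤ m + 3 + 2 * n by omega)
    rw [h.power_eq_bot, le_bot_iff] at h2
    rwa [h2, sup_bot_eq] at h1
  -- `L^{m+3}` is a proper subspace of `L₀`, so `2n - 2 - m < n`; this contradicts `m + 1 < n`.
  have hlt : power A (m + 3) < A.part 0 := by
    refine lt_of_le_of_ne hle fun he => hx2 ?_
    have := hx.mem
    rw [← he] at this
    exact power_antitone A (by omega) (by omega) this
  have := Submodule.finrank_lt_finrank_of_lt hlt
  rw [hx.finrank, h.finrank_power hn (by omega) (by omega)] at this
  omega

end IsOfType

end MixedGenerators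

end LeibnizSuper

namespace LeibnizSuper

/-! ### Two odd generators and the form on the odd part -/

section OddGenerators

variable {L : Type*} [AddCommGroup L] [Module ℂ L] {A : SuperProduct L} {n : ℕ}

namespace IsOfType

variable (h : IsOfType n (n + 1) A) (hn : 2 ≤ n) {x : L} (hx : IsEvenGen A n x)
  (hx2 : x ∈ power A 2)

include hx hx2 in
theorem even_le_power_two : A.part 0 ≤ power A 2 := by
  intro v hv
  obtain ⟨c, w, -, rfl⟩ := hx.exists_add v hv
  exact Submodule.add_mem _ (Submodule.smul_mem _ _ hx2) (mul_mem_power (k := 1) le_rfl trivial x)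

include hx hx2 in
theorem R_mem_power_three {w : L} (hw : w ∈ A.part 0) : R A x w ∈ power A 3 :=
  mul_mem_power (k := 2) (by omega) (even_le_power_two hx hx2 hw) x

include h hn hx hx2

/-- Here `L₁` spans `L` modulo `L²`, so `L²` is spanned modulo `L³` by products of odd elements,
that is, by `x`. If `x ∈ L³`, then `L² = L³`. -/
theorem notMem_power_three : x ∉ power A 3 := by
  intro hx3
  have hA := h.isLeibniz
  have hle : power A 2 ≤ ⊥ ⊔ power A 3 := by
    have htop : (⊤ : Submodule ℂ L) ≤ Submodule.span ℂ (A.part 1 : Set L) ⊔ power A 2 := by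
      rw [Submodule.span_eq, ← hA.isCompl.sup_eq_top]
      exact sup_le (le_sup_of_le_right (even_le_power_two hx hx2)) le_sup_left
    refine power_step hA (k := 1) le_rfl (by rwa [power_one]) (fun _ _ => trivial) htop ?_
    intro u hu v hv
    rw [bot_sup_eq]
    obtain ⟨c, w, hw, e⟩ := hx.exists_add _ (hA.odd_odd_mem hu hv)
    rw [e]
    exact Submodule.add_mem _ (Submodule.smul_mem _ _ hx3) (R_mem_power_three hx hx2 hw)
  rw [bot_sup_eq] at hle
  exact absurd hle (h.power_lt (k := 2) (by omega) (by omega)).not_ge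

/-- `l` reads off the coefficient of `x` modulo `L³`. It turns the odd products into a bilinear form
`l([u, v])`, which governs `R_{[u,v]}`. -/
theorem exists_dual : ∃ l : Module.Dual ℂ L, (∀ v ∈ power A 3, l v = 0) ∧
    ∀ v ∈ A.part 0, R A v = l v • R A x ∧ ∃ w ∈ A.part 0, v = l v • x + R A x w := by
  obtain ⟨f, hf, hf'⟩ := Submodule.exists_le_ker_of_notMem (h.notMem_power_three hn hx hx2)
  have h3 : ∀ v ∈ power A 3, f v = 0 := fun v hv => hf' hv
  refine ⟨(f x)⁻¹ • f, fun v hv => by rw [LinearMap.smul_apply, h3 v hv, smul_zero], ?_⟩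
  intro v hv
  obtain ⟨c, w, hw, rfl⟩ := hx.exists_add v hv
  have e : ((f x)⁻¹ • f) (c • x + R A x w) = c := by
    rw [map_add, LinearMap.smul_apply, LinearMap.smul_apply,
      h3 _ (R_mem_power_three hx hx2 hw), smul_zero, add_zero, map_smul, smul_eq_mul,
      smul_eq_mul, mul_comm c, inv_mul_cancel_left₀ hf]
  rw [e]
  refine ⟨?_, w, hw, rfl⟩
  rw [map_add, map_smul, hx.R_apply_eq_zero h.isLeibniz hw, add_zero]

omit h hn hx2 in
/-- An odd element of square zero kills the even part. -/
theorem R_apply_even_eq_zero (hA : IsLeibniz A) {p q : L} (hp : p ∈ A.part 1)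
    (hq : q ∈ A.part 1) (hq2 : R A q * R A q = 0) {c : ℂ} (hc : c ≠ 0) {w : L}
    (hw : w ∈ A.part 0) (hpq : A.mul p q = c • x + R A x w) {v : L} (hv : v ∈ A.part 0) :
    R A q v = 0 := by
  have hR : R A q * R A p + R A p * R A q = c • R A x := by
    rw [← hA.R_mul_odd_odd hp hq, hpq, map_add, map_smul, hx.R_apply_eq_zero hA hw, add_zero]
  -- With `Q = R_q`, `P = R_p` and `Q² = 0`, both `Q(QP + PQ)` and `(QP + PQ)Q` equal `QPQ`, and `QP
  -- + PQ` is a nonzero multiple of `X`.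
  have hcomm : R A q * R A x = R A x * R A q := by
    have h1 : c • (R A q * R A x) = c • (R A x * R A q) := by
      rw [← mul_smul_comm, ← smul_mul_assoc, ← hR, mul_add, add_mul, ← mul_assoc, hq2, zero_mul,
        zero_add, mul_assoc (R A p), hq2, mul_zero, add_zero, mul_assoc]
    exact smul_right_injective _ hc h1
  have hcomm' : ∀ u, R A q (R A x u) = R A x (R A q u) := LinearMap.congr_fun hcomm
  -- Since `R_q [p, q] = R_q² p = 0`, the vector `R_q x` lies in `X R_q L₀`. Iterating, `R_q v` lies
  -- in `Xᵏ R_q L₀` for every `k`.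
  have hqx : R A q x = R A x (R A q (-(c⁻¹ • w))) := by
    have h1 : R A q (R A q p) = 0 := LinearMap.congr_fun hq2 p
    have h2 : R A q p = c • x + R A x w := hpq
    rw [h2, map_add, map_smul, hcomm'] at h1
    rw [map_neg, map_neg, map_smul, map_smul, ← inv_smul_smul₀ hc (R A q x),
      eq_neg_of_add_eq_zero_left h1, smul_neg]
  have hstep : ∀ k : ℕ, ∃ u ∈ A.part 0, R A q v = ((R A x) ^ k) (R A q u) := by
    intro k
    induction k with
    | zero => exact ⟨v, hv, rfl⟩
    | succ k ih =>
      obtain ⟨u, hu, e⟩ := ih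
      obtain ⟨d, u', hu', rfl⟩ := hx.exists_add u hu
      refine ⟨d • (-(c⁻¹ • w)) + u', Submodule.add_mem _ (Submodule.smul_mem _ _
        (Submodule.neg_mem _ (Submodule.smul_mem _ _ hw))) hu', ?_⟩
      rw [e, map_add (R A q), map_smul, hqx, hcomm', pow_succ, Module.End.mul_apply,
        map_add (R A q), map_add (R A x), map_smul (R A q), map_smul (R A x)]
  obtain ⟨u, -, e⟩ := hstep n
  rw [e, hx.pow_eq_zero, LinearMap.zero_apply]

/-- Two odd generators of square zero cannot occur. -/
theorem false_of_isotropic {p q : L} (hp : p ∈ A.part 1) (hq : q ∈ A.part 1)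
    (hp2 : R A p * R A p = 0) (hq2 : R A q * R A q = 0) {c : ℂ} (hc : c ≠ 0) {w : L}
    (hw : w ∈ A.part 0) (hpq : A.mul p q = c • x + R A x w) {d : ℂ} (hd : d ≠ 0) {u : L}
    (hu : u ∈ A.part 0) (hqp : A.mul q p = d • x + R A x u)
    (hgen : ⊤ ≤ Submodule.span ℂ {p, q} ⊔ power A 2) : False := by
  have hA := h.isLeibniz
  -- `L³` is spanned modulo `L⁴` by `[x, p]` and `[x, q]`, and both vanish.
  have hle : power A 3 ≤ ⊥ ⊔ power A 4 := by
    refine power_step hA (k := 2) (by omega)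
      (h.power_le_span hn le_rfl hx2 (h.notMem_power_three hn hx hx2))
      (Set.singleton_subset_iff.2 hx2) hgen ?_
    rintro _ rfl t (rfl | rfl)
    · have : A.mul _ t = 0 := R_apply_even_eq_zero hx hA hq hp hp2 hd hu hqp hx.mem
      rw [this]
      exact Submodule.zero_mem _
    · have : A.mul _ t = 0 := R_apply_even_eq_zero hx hA hp hq hq2 hc hw hpq hx.mem
      rw [this]
      exact Submodule.zero_mem _
  rw [bot_sup_eq] at hle
  exact absurd hle (h.power_lt (k := 3) (by omega) (by omega)).not_ge

/-- There are two odd generators `y`, `z` such that `[y, y]` generates the even part and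
`R_{[y, z]} = R_{[z, z]} = 0`. -/
theorem exists_odd_generators : ∃ y ∈ A.part 1, ∃ z ∈ A.part 1, IsEvenGen A n (A.mul y y) ∧
    R A (A.mul y z) = 0 ∧ R A z * R A z = 0 ∧ A.mul y y ∈ power A 2 ∧
    ⊤ ≤ Submodule.span ℂ {y, z} ⊔ power A 2 := by
  have hA := h.isLeibniz
  obtain ⟨l, hl3, hl⟩ := h.exists_dual hn hx hx2
  have hX0 : R A x ≠ 0 := fun h0 => hx.ne_zero hA hn (by rw [h0, LinearMap.zero_apply])
  have hsymm : ∀ u ∈ A.part 1, ∀ v ∈ A.part 1, l (A.mul u v) = l (A.mul v u) := by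
    intro u hu v hv
    refine smul_left_injective ℂ hX0 ?_
    change l (A.mul u v) • R A x = l (A.mul v u) • R A x
    rw [← (hl _ (hA.odd_odd_mem hu hv)).1, ← (hl _ (hA.odd_odd_mem hv hu)).1,
      hA.R_mul_odd_odd hu hv, hA.R_mul_odd_odd hv hu, add_comm]
  have hsq : ∀ u ∈ A.part 1, l (A.mul u u) = 0 → R A u * R A u = 0 := by
    intro u hu h0
    have h1 := hA.R_sq hu
    rw [(hl _ (hA.sq_mem hu)).1, h0, zero_smul] at h1
    exact (smul_eq_zero.1 h1.symm).resolve_left two_ne_zero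
  -- If the symmetric form vanished on the diagonal, it would vanish by polarization, and then `L² =
  -- L³`.
  obtain ⟨y, hy, hly⟩ : ∃ y ∈ A.part 1, l (A.mul y y) ≠ 0 := by
    by_contra hcon
    push Not at hcon
    have h0 : ∀ u ∈ A.part 1, ∀ v ∈ A.part 1, l (A.mul u v) = 0 := by
      intro u hu v hv
      have h1 := hcon (u + v) (Submodule.add_mem _ hu hv)
      simp only [map_add, LinearMap.add_apply] at h1
      rw [hcon u hu, hcon v hv, hsymm v hv u hu, zero_add, add_zero, ← two_mul] at h1
      exact (mul_eq_zero.1 h1).resolve_left two_ne_zero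
    have hle : power A 2 ≤ ⊥ ⊔ power A 3 := by
      have htop : (⊤ : Submodule ℂ L) ≤ Submodule.span ℂ (A.part 1 : Set L) ⊔ power A 2 := by
        rw [Submodule.span_eq, ← hA.isCompl.sup_eq_top]
        exact sup_le (le_sup_of_le_right (even_le_power_two hx hx2)) le_sup_left
      refine power_step hA (k := 1) le_rfl (by rwa [power_one]) (fun _ _ => trivial) htop ?_
      intro u hu v hv
      rw [bot_sup_eq]
      obtain ⟨w, hw, e⟩ := (hl _ (hA.odd_odd_mem hu hv)).2
      rw [h0 u hu v hv, zero_smul, zero_add] at e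
      rw [e]
      exact R_mem_power_three hx hx2 hw
    rw [bot_sup_eq] at hle
    exact absurd hle (h.power_lt (k := 2) (by omega) (by omega)).not_ge
  have hy2 : y ∉ power A 2 := fun hy2 => hly (hl3 _ (mul_mem_power (by omega) hy2 y))
  obtain ⟨z₀, hz₀, hgen₀⟩ := h.exists_odd_generator hn hy2
    ((even_le_power_two hx hx2).trans le_sup_right)
  -- Orthogonal projection: `z = z₀ - t y` is orthogonal to `y`.
  set t := l (A.mul y z₀) / l (A.mul y y) with ht
  set z := z₀ - t • y with hz
  have hzm : z ∈ A.part 1 := Submodule.sub_mem _ hz₀ (Submodule.smul_mem _ _ hy)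
  have hyz : l (A.mul y z) = 0 := by
    rw [hz, map_sub, map_smul, map_sub, map_smul, smul_eq_mul, ht, div_mul_cancel₀ _ hly, sub_self]
  have hzy : l (A.mul z y) = 0 := by rw [hsymm z hzm y hy, hyz]
  have hgen : ∀ a b : ℂ, a ≠ b →
      ⊤ ≤ Submodule.span ℂ {z + a • y, z + b • y} ⊔ power A 2 := by
    intro a b hab
    refine hgen₀.trans (sup_le_sup_right ?_ _)
    have hab' : a - b ≠ 0 := sub_ne_zero.2 hab
    have hyS : y ∈ Submodule.span ℂ {z + a • y, z + b • y} := by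
      refine Submodule.mem_span_pair.2 ⟨(a - b)⁻¹, -(a - b)⁻¹, ?_⟩
      rw [neg_smul, ← sub_eq_add_neg, ← smul_sub, add_sub_add_left_eq_sub, ← sub_smul,
        inv_smul_smul₀ hab']
    rw [Submodule.span_le, Set.insert_subset_iff, Set.singleton_subset_iff]
    refine ⟨hyS, ?_⟩
    have h1 : z₀ = (z + a • y) + (t - a) • y := by
      rw [hz]
      module
    rw [SetLike.mem_coe, h1]
    exact Submodule.add_mem _ (Submodule.subset_span (by simp)) (Submodule.smul_mem _ _ hyS)
  -- Otherwise `z ± s y` with `s² l([y, y]) = -l([z, z])` are isotropic generators with nonzero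
  -- mutual product, which has been excluded.
  have hzz : l (A.mul z z) = 0 := by
    by_contra hmu
    obtain ⟨s, hs⟩ := IsAlgClosed.exists_pow_nat_eq (-(l (A.mul z z) / l (A.mul y y)))
      (n := 2) (by omega)
    have hs' : s ^ 2 * l (A.mul y y) = -l (A.mul z z) := by
      rw [hs, neg_mul, div_mul_cancel₀ _ hly]
    have hs0 : s ≠ 0 := by
      rintro rfl
      apply hmu
      linear_combination hs'
    have hform : ∀ a b : ℂ, l (A.mul (z + a • y) (z + b • y)) =
        l (A.mul z z) + a * b * l (A.mul y y) := by
      intro a b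
      simp only [map_add, map_smul, LinearMap.add_apply, LinearMap.smul_apply, hyz, hzy,
        smul_eq_mul]
      ring
    have hm : ∀ a : ℂ, z + a • y ∈ A.part 1 := fun a =>
      Submodule.add_mem _ hzm (Submodule.smul_mem _ _ hy)
    obtain ⟨w, hw, e⟩ := (hl _ (hA.odd_odd_mem (hm s) (hm (-s)))).2
    obtain ⟨u, hu, e'⟩ := (hl _ (hA.odd_odd_mem (hm (-s)) (hm s))).2
    have h2 : ∀ a b : ℂ, a * b = -s ^ 2 → l (A.mul (z + a • y) (z + b • y)) ≠ 0 := by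
      intro a b hab
      rw [hform, hab, neg_mul, hs', neg_neg, ← two_mul]
      exact mul_ne_zero two_ne_zero hmu
    refine h.false_of_isotropic hn hx hx2 (hm s) (hm (-s)) (hsq _ (hm s) ?_) (hsq _ (hm (-s)) ?_)
      (h2 _ _ (by ring)) hw e (h2 _ _ (by ring)) hu e' (hgen s (-s) ?_)
    · rw [hform, ← pow_two, hs', add_neg_cancel]
    · rw [hform, neg_mul_neg, ← pow_two, hs', add_neg_cancel]
    · intro hss
      exact hs0 (self_eq_neg.1 hss)
  refine ⟨y, hy, z, hzm, ?_, ?_, hsq z hzm hzz, mul_mem_power (k := 1) le_rfl trivial y, ?_⟩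
  · obtain ⟨w, hw, e⟩ := (hl _ (hA.sq_mem hy)).2
    rw [e]
    exact (hx.change hA hly hw).1
  · rw [(hl _ (hA.odd_odd_mem hy hzm)).1, hyz, zero_smul]
  · refine hgen₀.trans (sup_le_sup_right ?_ _)
    rw [Submodule.span_le]
    rintro _ (rfl | rfl)
    · exact Submodule.subset_span (by simp)
    · refine Submodule.mem_span_pair.2 ⟨t, 1, ?_⟩
      rw [hz]
      module

end IsOfType

end OddGenerators

end LeibnizSuper

namespace LeibnizSuper

/-! ### Existence of normalized generators -/

section Generators

variable {L : Type*} [AddCommGroup L] [Module ℂ L] {A : SuperProduct L} {n : ℕ}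

theorem coeff_eq_zero_of_X_pow_dvd_mul_sq {p : Polynomial ℂ}
    (hp : Polynomial.X ^ n ∣ Polynomial.X * p ^ 2) (i : ℕ) (hi : 2 * i + 1 < n) :
    p.coeff i = 0 := by
  have key : ∀ i : ℕ, 2 * i < n + 1 → Polynomial.X ^ i ∣ p := by
    intro i
    induction i with
    | zero => simp
    | succ i ih =>
      intro hi
      obtain ⟨g, rfl⟩ := ih (by omega)
      have h1 : Polynomial.X ^ (2 * i + 1) * Polynomial.X ∣ Polynomial.X ^ (2 * i + 1) * g ^ 2 := by
        rw [← pow_succ]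
        refine (pow_dvd_pow _ (by omega)).trans (hp.trans (dvd_of_eq ?_))
        ring
      have h2 := (mul_dvd_mul_iff_left (pow_ne_zero _ Polynomial.X_ne_zero)).1 h1
      rw [pow_succ]
      exact mul_dvd_mul_left _ (Polynomial.prime_X.dvd_of_dvd_pow h2)
  exact Polynomial.X_pow_dvd_iff.1 (key (i + 1) (by omega)) i (by omega)

theorem exists_isGen_of_generators (hA : IsLeibniz A) (hn : 2 ≤ n)
    (hfr : Module.finrank ℂ L = 2 * n + 1) (hbot : power A (2 * n + 1) = ⊥) {y z : L}
    (hy : y ∈ A.part 1) (hz : z ∈ A.part 1) (hx : IsEvenGen A n (A.mul y y))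
    (hyz : R A (A.mul y z) = 0) (hzz : R A z * R A z = 0) (hx2 : A.mul y y ∈ power A 2)
    (hgen : ⊤ ≤ Submodule.span ℂ {y, z} ⊔ power A 2) (hzy : A.mul z y = 0) :
    ∃ ψ γ, IsGen A n y z ψ γ := by
  have hanti : R A z * R A y = -(R A y * R A z) := by
    rw [hA.R_mul_odd_odd hy hz] at hyz
    exact eq_neg_of_add_eq_zero_left hyz
  have hantiv : ∀ v, R A z (R A y v) = -(R A y (R A z v)) := LinearMap.congr_fun hanti
  have hYp : ∀ (p : Polynomial ℂ) (v : L), R A y (polyAct A y p v) = polyAct A y p (R A y v) :=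
    fun p v => (LinearMap.congr_fun (aeval_commute (hA.commute_sq hy) p).eq v).symm
  have hZc : Commute (R A (A.mul y y)) (R A z) := by
    rw [hA.R_sq hy]
    refine Commute.smul_left ?_ _
    change R A y * R A y * R A z = R A z * (R A y * R A y)
    rw [← mul_assoc, hanti, neg_mul, mul_assoc (R A y) (R A z), hanti, mul_assoc]
    simp
  have hZp : ∀ (p : Polynomial ℂ) (v : L), R A z (polyAct A y p v) = polyAct A y p (R A z v) :=
    fun p v => (LinearMap.congr_fun (aeval_commute hZc p).eq v).symm
  have hYY : ∀ v, R A y (R A y v) = (1 / 2 : ℂ) • polyAct A y Polynomial.X v := by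
    intro v
    rw [Polynomial.aeval_X, hA.R_sq hy]
    simp
  have hYx : R A y (A.mul y y) = (1 / 2 : ℂ) • polyAct A y Polynomial.X y := hYY y
  obtain ⟨ψ, hψ⟩ := hx.exists_aeval (hA.odd_odd_mem hy hz)
  obtain ⟨η, hη⟩ := hx.exists_aeval (hA.odd_odd_mem hz hz)
  have hZy : R A z y = polyAct A y ψ (R A y y) := hψ
  have hZz : R A z z = polyAct A y η (R A y y) := hη
  -- Anticommutation turns `R_z² y = 0` into `ψ(X)² X y = 0`; applying `R_y` gives the divisibility
  -- of `X ψ²` by `Xⁿ`.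
  have hcoeff : ∀ i, 2 * i + 1 < n → ψ.coeff i = 0 := by
    refine coeff_eq_zero_of_X_pow_dvd_mul_sq ((hx.aeval_eq_zero_iff hA).1 ?_)
    have h1 : R A z (R A z y) = 0 := LinearMap.congr_fun hzz y
    rw [hZy, hZp, hantiv, hZy, hYp, map_neg, neg_eq_zero, hYY, map_smul, map_smul,
      smul_eq_zero] at h1
    have h2 := congrArg (R A y) (h1.resolve_left (by norm_num))
    rw [hYp, hYp, hYp, map_zero] at h2
    have e : Polynomial.X * ψ ^ 2 = ψ * (ψ * Polynomial.X) := by ring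
    rw [e, map_mul, map_mul]
    exact h2
  -- `R_y [z, z] = -R_z [z, y] = 0`; a second `R_y` shows that `η X` kills `x`.
  have hηd : Polynomial.X ^ (n - 1) ∣ η := by
    have h1 : R A y (R A z z) = 0 := by
      have h2 : R A y z = 0 := hzy
      rw [← neg_eq_zero, ← hantiv, h2, map_zero]
    have h2 := congrArg (R A y) h1
    rw [hZz, hYp, hYp, map_zero, hYY, map_smul, smul_eq_zero] at h2
    have h3 : polyAct A y (η * Polynomial.X) (A.mul y y) = 0 := by
      rw [map_mul]
      exact h2.resolve_left (by norm_num)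
    have h4 := (hx.aeval_eq_zero_iff hA).1 h3
    rw [show n = n - 1 + 1 by omega, pow_succ] at h4
    exact (mul_dvd_mul_iff_right Polynomial.X_ne_zero).1 h4
  obtain ⟨g, rfl⟩ := hηd
  have hmem3 : ∀ p : Polynomial ℂ, p.coeff 0 = 0 → polyAct A y p (R A y y) ∈ power A 3 := by
    intro p hp
    obtain ⟨r, rfl⟩ := Polynomial.X_dvd_iff.2 hp
    rw [map_mul, Polynomial.aeval_X]
    exact IsOfType.R_mem_power_three hx hx2 (hx.aeval_mem hA r)
  have hZy3 : R A z y ∈ power A 3 := by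
    rw [hZy]
    exact hmem3 _ (hcoeff 0 (by omega))
  have hZz3 : R A z z ∈ power A 3 := by
    rw [hZz]
    refine hmem3 _ ?_
    rw [Polynomial.mul_coeff_zero, Polynomial.coeff_X_pow, if_neg (by omega), zero_mul]
  -- `[y, z]` and `[z, z]` lie in `L³`, so modulo deeper powers only repeated multiplication by `y`
  -- survives.
  have hchain : ∀ k, power A (1 + (k + 1)) ≤
      Submodule.span ℂ {((R A y) ^ (k + 1)) y} ⊔ power A (1 + (k + 1) + 1) := by
    intro k
    induction k with
    | zero =>
      refine power_step hA (k := 1) le_rfl (by rwa [power_one]) (fun _ _ => trivial) hgen ?_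
      rintro u (rfl | rfl) t (rfl | rfl)
      · exact Submodule.mem_sup_left (Submodule.mem_span_singleton_self _)
      · exact Submodule.mem_sup_right hZy3
      · rw [hzy]
        exact Submodule.zero_mem _
      · exact Submodule.mem_sup_right hZz3
    | succ k ih =>
      refine power_step hA (k := 1 + (k + 1)) (by omega) ih (Set.singleton_subset_iff.2
        (pow_apply_mem_power le_rfl trivial _)) hgen ?_
      rintro _ rfl t (rfl | rfl)
      · refine Submodule.mem_sup_left ?_
        rw [pow_succ' _ (k + 1), Module.End.mul_apply]
        exact Submodule.mem_span_singleton_self _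
      · refine Submodule.mem_sup_right ?_
        have h1 : ∀ j : ℕ, R A t (((R A y) ^ j) y) = (-1 : ℂ) ^ j • ((R A y) ^ j) (R A t y) := by
          intro j
          induction j with
          | zero => simp
          | succ j ihj =>
            rw [pow_succ', Module.End.mul_apply, Module.End.mul_apply, hantiv, ihj, map_smul,
              pow_succ', neg_one_mul, neg_smul]
        have h2 : A.mul (((R A y) ^ (k + 1)) y) t = _ := h1 (k + 1)
        rw [h2]
        have h3 := pow_apply_mem_power (x := y) (by omega) hZy3 (k + 1)
        rw [show 3 + (k + 1) = 1 + (k + 1) + 2 by omega] at h3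
        exact Submodule.smul_mem _ _ h3
  have hspan : ∀ v : L, ∃ p q b, v = comb A y z p q b := by
    let N : Submodule ℂ L :=
      { carrier := {v | ∃ p q b, v = comb A y z p q b}
        zero_mem' := ⟨0, 0, 0, by simp [comb]⟩
        add_mem' := by
          rintro _ _ ⟨p, q, b, rfl⟩ ⟨p', q', b', rfl⟩
          exact ⟨_, _, _, comb_add A y z p q p' q' b b'⟩
        smul_mem' := by
          rintro c _ ⟨p, q, b, rfl⟩
          exact ⟨_, _, _, comb_smul A y z p q b c⟩ }
    have hpow : ∀ k : ℕ, ∃ p q, ((R A y) ^ k) y = polyAct A y p (A.mul y y) + polyAct A y q y := by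
      intro k
      induction k with
      | zero => exact ⟨0, 1, by simp⟩
      | succ k ih =>
        obtain ⟨p, q, e⟩ := ih
        refine ⟨q, Polynomial.C (1 / 2) * (p * Polynomial.X), ?_⟩
        rw [pow_succ', Module.End.mul_apply, e, map_add, hYp, hYp, hYx, map_smul, map_mul,
          map_mul, Polynomial.aeval_C, Module.End.mul_apply, Module.End.mul_apply,
          Module.algebraMap_end_apply, add_comm]
        rfl
    have hpowN : ∀ k : ℕ, ((R A y) ^ k) y ∈ N := by
      intro k
      obtain ⟨p, q, e⟩ := hpow k
      exact ⟨p, q, 0, by rw [e, comb, zero_smul, add_zero]⟩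
    have hle : ∀ k, power A 2 ≤ N ⊔ power A (1 + (k + 1)) := by
      intro k
      induction k with
      | zero => exact le_sup_right
      | succ k ih =>
        refine ih.trans (sup_le le_sup_left ((hchain k).trans (sup_le_sup_right ?_ _)))
        rw [Submodule.span_singleton_le_iff_mem]
        exact hpowN _
    have h2 := hle (2 * n)
    have h3 := power_antitone A (show 1 ≤ 2 * n + 1 by omega)
      (show 2 * n + 1 ≤ 1 + (2 * n + 1) by omega)
    rw [hbot, le_bot_iff] at h3
    rw [h3, sup_bot_eq] at h2
    intro v
    have h4 : ⊤ ≤ N := by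
      refine hgen.trans (sup_le ?_ h2)
      rw [Submodule.span_le, Set.insert_subset_iff, Set.singleton_subset_iff]
      exact ⟨⟨0, 1, 0, (comb_zero_one_zero A y z).symm⟩, ⟨0, 0, 1, (comb_zero_zero_one A y z).symm⟩⟩
    exact h4 (Submodule.mem_top (x := v))
  refine ⟨ψ, g.coeff 0, hy, hz, hzy, hψ, ?_, ?_, hspan, hcoeff, hfr⟩
  · have h1 : A.mul z z = polyAct A y (Polynomial.X ^ (n - 1) * g) (A.mul y y) := hη
    have e : Polynomial.X ^ (n - 1) * g = g.divX * Polynomial.X ^ n +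
        Polynomial.C (g.coeff 0) * Polynomial.X ^ (n - 1) := by
      nth_rw 1 [← Polynomial.divX_mul_X_add g]
      rw [show n = n - 1 + 1 by omega, pow_succ, Nat.add_sub_cancel]
      ring
    rw [h1, e, map_add, LinearMap.add_apply, hx.aeval_of_dvd (Dvd.intro_left _ rfl),
      LinearMap.zero_apply, zero_add, map_mul, Polynomial.aeval_C, Module.End.mul_apply,
      Module.algebraMap_end_apply]
  · rw [hx.aeval_of_dvd dvd_rfl, LinearMap.zero_apply]

theorem IsOfType.exists_isGen (h : IsOfType n (n + 1) A) (hn : 2 ≤ n) :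
    ∃ y z ψ γ, IsGen A n y z ψ γ := by
  have hA := h.isLeibniz
  obtain ⟨x, hx⟩ := h.exists_evenGen hn
  have hx2 : x ∈ power A 2 := by
    by_contra hx2
    exact h.false_of_notMem_power_two hn hx hx2
  obtain ⟨y, hy, z, hz, hg, hyz, hzz, hy2, hgen⟩ := h.exists_odd_generators hn hx hx2
  have hzy0 : R A (A.mul z y) = 0 := by
    rw [hA.R_mul_odd_odd hz hy, add_comm, ← hA.R_mul_odd_odd hy hz, hyz]
  obtain ⟨w, hw, e⟩ := hg.exists_of_R_eq_zero hA hn (hA.odd_odd_mem hz hy) hzy0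
  obtain ⟨p, rfl⟩ := hg.exists_aeval hw
  -- Since `[z, y] = X p(X) x = [X p(X) y, y]`, subtracting `u = X p(X) y` from `z` makes this
  -- product zero. As `R_u = 0` and `u ∈ L²`, the other properties of `z` are kept.
  set u := polyAct A y (Polynomial.X * p) y with hu
  have hu' : u = R A (A.mul y y) (polyAct A y p y) := by
    rw [hu, map_mul, Polynomial.aeval_X, Module.End.mul_apply]
  have hRu : R A u = 0 := by
    rw [hu, hA.R_polyAct_left hy, Polynomial.mul_coeff_zero, Polynomial.coeff_X_zero, zero_mul,
      zero_smul]
  have hRz : R A (z - u) = R A z := by rw [map_sub, hRu, sub_zero]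
  have hzu : A.mul (z - u) y = 0 := by
    have h1 : A.mul u y = polyAct A y (Polynomial.X * p) (A.mul y y) :=
      (LinearMap.congr_fun (aeval_commute (hA.commute_sq hy) (Polynomial.X * p)).eq y).symm
    rw [map_sub, LinearMap.sub_apply, e, h1, map_mul, Polynomial.aeval_X, Module.End.mul_apply,
      sub_self]
  have hgen' : ⊤ ≤ Submodule.span ℂ {y, z - u} ⊔ power A 2 := by
    refine hgen.trans (sup_le ?_ le_sup_right)
    rw [Submodule.span_le, Set.insert_subset_iff, Set.singleton_subset_iff]
    refine ⟨Submodule.mem_sup_left (Submodule.subset_span (by simp)), ?_⟩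
    rw [SetLike.mem_coe, ← sub_add_cancel z u]
    refine Submodule.add_mem_sup (Submodule.subset_span (by simp)) ?_
    rw [hu']
    exact mul_mem_power (k := 1) le_rfl trivial _
  exact ⟨y, z - u, exists_isGen_of_generators hA hn (h.finrank_eq hn) h.power_eq_bot hy
    (Submodule.sub_mem _ hz (hA.polyAct_mem hy _ hy)) hg
    (by rw [show A.mul y (z - u) = A.mul y z from LinearMap.congr_fun hRz y, hyz])
    (by rw [hRz, hzz]) hy2 hgen' hzu⟩

end Generators

end LeibnizSuper

namespace LeibnizSuper

/-! ### Reduction to a torus action and normal forms -/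

section NormalForm

theorem Iso.trans {L M N : Type*} [AddCommGroup L] [Module ℂ L] [AddCommGroup M] [Module ℂ M]
    [AddCommGroup N] [Module ℂ N] {A : SuperProduct L} {B : SuperProduct M} {C : SuperProduct N}
    (h : Iso A B) (h' : Iso B C) : Iso A C := by
  obtain ⟨f, hf, hf'⟩ := h
  obtain ⟨g, hg, hg'⟩ := h'
  refine ⟨f.trans g, fun a x hx => hg a _ (hf a x hx), fun x y => ?_⟩
  simp only [LinearEquiv.trans_apply, hf', hg']

/-- The action of the diagonal changes of generators on the parameters. -/
noncomputable def act (n : ℕ) (u t : ℂ) (P : Param) : Param :=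
  (u ^ 2 * P.1, fun k => u * t ^ (2 * k - (n + 3)) * P.2 k)

/-- `P` and `Q` are related by a diagonal change of generators. -/
def Orbit (n : ℕ) (P Q : Param) : Prop := ∃ u t : ℂ, u ≠ 0 ∧ t ≠ 0 ∧ Q = act n u t P

theorem act_act (n : ℕ) (u t u' t' : ℂ) (P : Param) :
    act n u t (act n u' t' P) = act n (u * u') (t * t') P := by
  refine Prod.ext ?_ (funext fun k => ?_)
  · change u ^ 2 * (u' ^ 2 * P.1) = (u * u') ^ 2 * P.1
    ring
  · change u * t ^ _ * (u' * t' ^ _ * P.2 k) = u * u' * (t * t') ^ _ * P.2 k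
    rw [mul_pow]
    ring

theorem act_one_one (n : ℕ) (P : Param) : act n 1 1 P = P := by
  simp [act]

theorem Orbit.refl (n : ℕ) (P : Param) : Orbit n P P :=
  ⟨1, 1, one_ne_zero, one_ne_zero, (act_one_one n P).symm⟩

theorem Orbit.symm {n : ℕ} {P Q : Param} (h : Orbit n P Q) : Orbit n Q P := by
  obtain ⟨u, t, hu, ht, rfl⟩ := h
  refine ⟨u⁻¹, t⁻¹, inv_ne_zero hu, inv_ne_zero ht, ?_⟩
  rw [act_act, inv_mul_cancel₀ hu, inv_mul_cancel₀ ht, act_one_one]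

theorem Orbit.trans {n : ℕ} {P Q T : Param} (h : Orbit n P Q) (h' : Orbit n Q T) :
    Orbit n P T := by
  obtain ⟨u, t, hu, ht, rfl⟩ := h
  obtain ⟨u', t', hu', ht', rfl⟩ := h'
  exact ⟨u' * u, t' * t, mul_ne_zero hu' hu, mul_ne_zero ht' ht, act_act ..⟩

/-- The obstruction to removing the last parameter. -/
noncomputable def disc (n : ℕ) (P : Param) : ℂ :=
  P.1 - if Odd n then 4 * P.2 ((n + 3) / 2) ^ 2 else 0

/-- For odd `n` the middle entry has exponent `0` in `t`, so its square scales like `γ`. For even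
`n` the hypothesis on that entry is vacuous. -/
theorem disc_eq {n : ℕ} (hn : 2 ≤ n) {P Q : Param} {u : ℂ} (h1 : Q.1 = u ^ 2 * P.1)
    (h2 : (n + 4) / 2 ≤ (n + 3) / 2 → (n + 3) / 2 ≤ n →
      Q.2 ((n + 3) / 2) = u * P.2 ((n + 3) / 2)) : disc n Q = u ^ 2 * disc n P := by
  unfold disc
  split_ifs with h
  · obtain ⟨m, rfl⟩ := h
    rw [h1, h2 (by omega) (by omega)]
    ring
  · rw [h1]
    ring

/-- Parameters with only the meaningful entries, `γ ∈ {0, 1}`, and no removable last entry. -/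
structure IsReduced (n : ℕ) (P : Param) : Prop where
  supp : ∀ k, P.2 k ≠ 0 → (n + 4) / 2 ≤ k ∧ k ≤ n + 1
  fst : P.1 = 0 ∨ P.1 = 1
  last : disc n P ≠ 0 → P.2 (n + 1) = 0

/-- Reduced parameters whose leading entries are normalized to `1`. -/
structure IsNormal (n : ℕ) (P : Param) : Prop extends IsReduced n P where
  lead : P.1 = 1 → ∀ k, n + 3 < 2 * k → (∀ i < k, n + 3 < 2 * i → P.2 i = 0) → P.2 k ≠ 0 → P.2 k = 1
  first : P.1 = 0 → ∀ k, (∀ i < k, P.2 i = 0) → P.2 k ≠ 0 → P.2 k = 1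
  second : P.1 = 0 → ∀ k l, k < l → (∀ i < k, P.2 i = 0) → P.2 k ≠ 0 →
    (∀ i, k < i → i < l → P.2 i = 0) → P.2 l ≠ 0 → P.2 l = 1

theorem paramRel_act {n : ℕ} (hn : 2 ≤ n) {u t : ℂ} (hu : u ≠ 0) (ht : t ≠ 0) (P : Param) :
    ParamRel n P (act n u t P) := by
  -- Solve `t = a⁻¹` and `u = d a⁻ⁿ` for `a` and `d`.
  refine ⟨t⁻¹, 0, u * t⁻¹ ^ n, inv_ne_zero ht, mul_ne_zero hu (pow_ne_zero _ (inv_ne_zero ht)),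
    ?_, ?_, ?_⟩
  · change u ^ 2 * P.1 * t⁻¹ ^ (2 * n) = (u * t⁻¹ ^ n) ^ 2 * P.1
    ring
  · intro k hk hk'
    change t⁻¹ ^ (2 * k - 3) * (u * t ^ (2 * k - (n + 3)) * P.2 k) = u * t⁻¹ ^ n * P.2 k
    rw [show 2 * k - 3 = n + (2 * k - (n + 3)) by omega, pow_add]
    have : t⁻¹ ^ (2 * k - (n + 3)) * t ^ (2 * k - (n + 3)) = 1 := by
      rw [← mul_pow, inv_mul_cancel₀ ht, one_pow]
    linear_combination (t⁻¹ ^ n * u * P.2 k) * this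
  · change t⁻¹ ^ (2 * n) * (u * t ^ (2 * (n + 1) - (n + 3)) * P.2 (n + 1)) =
      u * t⁻¹ ^ n * (t⁻¹ * P.2 (n + 1) + 0 * _)
    rw [show 2 * (n + 1) - (n + 3) = n - 1 by omega, show 2 * n = n + 1 + (n - 1) by omega, pow_add]
    have : t⁻¹ ^ (n - 1) * t ^ (n - 1) = 1 := by
      rw [← mul_pow, inv_mul_cancel₀ ht, one_pow]
    rw [pow_succ]
    linear_combination (t⁻¹ ^ n * t⁻¹ * u * P.2 (n + 1)) * this

/-- `b` occurs only in the last equation, multiplied by `disc`. If `disc = 0` it drops out;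
otherwise `disc` is nonzero for both parameters and both last entries are zero. -/
theorem ParamRel.orbit {n : ℕ} (hn : 2 ≤ n) {P Q : Param} (hP : IsReduced n P)
    (hQ : IsReduced n Q) (h : ParamRel n P Q) : Orbit n P Q := by
  obtain ⟨a, b, d, ha, hd, h1, h2, h3⟩ := h
  have hu : d * a⁻¹ ^ n ≠ 0 := mul_ne_zero hd (pow_ne_zero _ (inv_ne_zero ha))
  have hinv : ∀ k : ℕ, a ^ k * a⁻¹ ^ k = 1 := fun k => by
    rw [← mul_pow, mul_inv_cancel₀ ha, one_pow]
  have e1 : Q.1 = (d * a⁻¹ ^ n) ^ 2 * P.1 := by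
    have := hinv (2 * n)
    have e : (d * a⁻¹ ^ n) ^ 2 * P.1 = d ^ 2 * P.1 * a⁻¹ ^ (2 * n) := by ring
    rw [e, ← h1, mul_assoc, this, mul_one]
  have e2 : ∀ k, (n + 4) / 2 ≤ k → k ≤ n →
      Q.2 k = d * a⁻¹ ^ n * a⁻¹ ^ (2 * k - (n + 3)) * P.2 k := by
    intro k hk hk'
    have := hinv (2 * k - 3)
    rw [mul_assoc d, ← pow_add, show n + (2 * k - (n + 3)) = 2 * k - 3 by omega]
    linear_combination (-Q.2 k) * this + a⁻¹ ^ (2 * k - 3) * h2 k hk hk'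
  refine ⟨d * a⁻¹ ^ n, a⁻¹, hu, inv_ne_zero ha, Prod.ext e1 (funext fun k => ?_)⟩
  change Q.2 k = d * a⁻¹ ^ n * a⁻¹ ^ (2 * k - (n + 3)) * P.2 k
  by_cases hk : (n + 4) / 2 ≤ k ∧ k ≤ n + 1
  · obtain ⟨hk, hk'⟩ := hk
    rcases Nat.lt_or_ge n k with hk'' | hk''
    · obtain rfl : k = n + 1 := by omega
      by_cases hD : disc n P = 0
      · have h4 : a ^ (2 * n) * Q.2 (n + 1) = d * (a * P.2 (n + 1) + b * disc n P) := h3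
        rw [hD, mul_zero, add_zero] at h4
        rw [mul_assoc d, ← pow_add, show n + (2 * (n + 1) - (n + 3)) = 2 * n - 1 by omega]
        have e3 := hinv (2 * n)
        have e4 : a⁻¹ ^ (2 * n) * a = a⁻¹ ^ (2 * n - 1) := by
          nth_rw 1 [show 2 * n = 2 * n - 1 + 1 by omega]
          rw [pow_succ, inv_mul_cancel_right₀ ha]
        linear_combination (-Q.2 (n + 1)) * e3 + a⁻¹ ^ (2 * n) * h4 + (d * P.2 (n + 1)) * e4
      · rw [hP.last hD, hQ.last, mul_zero]
        rw [disc_eq hn e1]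
        · exact mul_ne_zero (pow_ne_zero _ hu) hD
        · intro h5 h6
          rw [e2 _ h5 h6, show 2 * ((n + 3) / 2) - (n + 3) = 0 by omega, pow_zero, mul_one]
    · exact e2 k hk hk''
  · rw [not_imp_comm.1 (hP.supp k) hk, not_imp_comm.1 (hQ.supp k) hk, mul_zero]

theorem exists_isReduced {n : ℕ} (hn : 2 ≤ n) (P : Param) :
    ∃ Q, IsReduced n Q ∧ ParamRel n P Q := by
  obtain ⟨u, hu, hu'⟩ : ∃ u : ℂ, u ≠ 0 ∧ (u ^ 2 * P.1 = 0 ∨ u ^ 2 * P.1 = 1) := by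
    rcases eq_or_ne P.1 0 with h0 | h0
    · exact ⟨1, one_ne_zero, Or.inl (by rw [h0, mul_zero])⟩
    · obtain ⟨u, hu⟩ := IsAlgClosed.exists_pow_nat_eq P.1⁻¹ (n := 2) (by omega)
      refine ⟨u, ?_, Or.inr (by rw [hu, inv_mul_cancel₀ h0])⟩
      rintro rfl
      exact inv_ne_zero h0 (by rw [← hu]; norm_num)
  let β : ℕ → ℂ := fun k => if (n + 4) / 2 ≤ k ∧ k ≤ n then u * P.2 k
    else if k = n + 1 ∧ disc n P = 0 then u * P.2 k else 0
  have hβ : ∀ k, (n + 4) / 2 ≤ k → k ≤ n → β k = u * P.2 k := fun k h1 h2 => if_pos ⟨h1, h2⟩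
  have hβ' : β (n + 1) = if disc n P = 0 then u * P.2 (n + 1) else 0 := by
    simp only [β]
    rw [if_neg (by omega)]
    simp
  -- With `a = 1` and `d = u`, the choice `b = -β_{n+1} / disc` cancels the last entry whenever
  -- `disc ≠ 0`.
  refine ⟨(u ^ 2 * P.1, β), ⟨?_, hu', ?_⟩, 1,
    if disc n P = 0 then 0 else -(P.2 (n + 1) / disc n P), u, one_ne_zero, hu, ?_, ?_, ?_⟩
  · intro k hk
    by_contra hcon
    refine hk ?_
    change β k = 0
    simp only [β]
    rw [if_neg (by omega), if_neg (by omega)]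
  · intro hD
    change β (n + 1) = 0
    rw [hβ', if_neg]
    intro h0
    rw [disc_eq (P := P) (u := u) hn rfl fun h1 h2 => hβ _ h1 h2, h0, mul_zero] at hD
    exact hD rfl
  · change u ^ 2 * P.1 * 1 ^ (2 * n) = _
    rw [one_pow, mul_one]
  · intro k h1 h2
    change 1 ^ _ * β k = _
    rw [hβ k h1 h2, one_pow, one_mul]
  · change 1 ^ _ * β (n + 1) = u * (1 * P.2 (n + 1) + _ * disc n P)
    rw [hβ', one_pow, one_mul]
    split_ifs with h0
    · ring
    · rw [neg_mul, div_mul_cancel₀ _ h0]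
      ring

theorem IsReduced.act {n : ℕ} (hn : 2 ≤ n) {P : Param} (h : IsReduced n P) {u t : ℂ}
    (h1 : P.1 = 1 → u ^ 2 = 1) : IsReduced n (act n u t P) := by
  refine ⟨fun k hk => h.supp k (right_ne_zero_of_mul hk), ?_, ?_⟩
  · rcases h.fst with h0 | h0
    · left
      change u ^ 2 * P.1 = 0
      rw [h0, mul_zero]
    · right
      change u ^ 2 * P.1 = 1
      rw [h0, h1 h0, mul_one]
  · intro hD
    change _ * P.2 (n + 1) = 0
    rw [h.last, mul_zero]
    rw [disc_eq (P := P) (u := u) hn rfl] at hD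
    · exact right_ne_zero_of_mul hD
    · intro _ _
      change u * t ^ _ * _ = _
      rw [show 2 * ((n + 3) / 2) - (n + 3) = 0 by omega, pow_zero, mul_one]

theorem IsReduced.isNormal_act {n : ℕ} (hn : 2 ≤ n) {P : Param} (h : IsReduced n P) {u t : ℂ}
    (hu : u ≠ 0) (ht : t ≠ 0) (h1 : P.1 = 1 → u ^ 2 = 1)
    (lead : P.1 = 1 → ∀ k, n + 3 < 2 * k → (∀ i < k, n + 3 < 2 * i → P.2 i = 0) → P.2 k ≠ 0 →
      u * t ^ (2 * k - (n + 3)) * P.2 k = 1)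
    (first : P.1 = 0 → ∀ k, (∀ i < k, P.2 i = 0) → P.2 k ≠ 0 →
      u * t ^ (2 * k - (n + 3)) * P.2 k = 1)
    (second : P.1 = 0 → ∀ k l, k < l → (∀ i < k, P.2 i = 0) → P.2 k ≠ 0 →
      (∀ i, k < i → i < l → P.2 i = 0) → P.2 l ≠ 0 → u * t ^ (2 * l - (n + 3)) * P.2 l = 1) :
    IsNormal n (LeibnizSuper.act n u t P) := by
  have hz : ∀ k, (LeibnizSuper.act n u t P).2 k = 0 ↔ P.2 k = 0 := fun k =>
    ⟨fun h => (mul_eq_zero.1 h).resolve_left (mul_ne_zero hu (pow_ne_zero _ ht)),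
      fun h => mul_eq_zero_of_right _ h⟩
  have hone : (LeibnizSuper.act n u t P).1 = 1 → P.1 = 1 := by
    intro h0
    rcases h.fst with h2 | h2
    · change u ^ 2 * P.1 = 1 at h0
      rw [h2, mul_zero] at h0
      exact absurd h0 zero_ne_one
    · exact h2
  have hzero : (LeibnizSuper.act n u t P).1 = 0 → P.1 = 0 := fun h0 =>
    (mul_eq_zero.1 h0).resolve_left (pow_ne_zero _ hu)
  refine ⟨h.act hn h1, ?_, ?_, ?_⟩
  · simp only [ne_eq, hz]
    exact fun h0 => lead (hone h0)
  · simp only [ne_eq, hz]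
    exact fun h0 => first (hzero h0)
  · simp only [ne_eq, hz]
    exact fun h0 => second (hzero h0)

theorem IsReduced.exists_isNormal {n : ℕ} (hn : 2 ≤ n) {P : Param} (h : IsReduced n P) :
    ∃ Q, IsNormal n Q ∧ Orbit n P Q := by
  classical
  rcases h.fst with h0 | h0
  · have hP1 : P.1 ≠ 1 := by rw [h0]; exact zero_ne_one
    by_cases hk : ∃ k, P.2 k ≠ 0
    · have hk1 := Nat.find_spec hk
      have hk2 := fun i hi => not_not.1 (Nat.find_min (m := i) hk hi)
      set k := Nat.find hk with hkdef
      have huniq : ∀ k', (∀ i < k', P.2 i = 0) → P.2 k' ≠ 0 → k' = k := by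
        intro k' h1 h2
        rcases lt_trichotomy k' k with h3 | h3 | h3
        · exact absurd (hk2 _ h3) h2
        · exact h3
        · exact absurd (h1 _ h3) hk1
      by_cases hl : ∃ l, k < l ∧ P.2 l ≠ 0
      · obtain ⟨hl1, hl1'⟩ := Nat.find_spec hl
        have hl2 := fun i hi => Nat.find_min (m := i) hl hi
        set l := Nat.find hl with hldef
        have hkr := h.supp k hk1
        -- This `t` makes the first two nonzero entries equal, and `u` then makes them `1`.
        obtain ⟨t, htt⟩ := IsAlgClosed.exists_pow_nat_eq (P.2 k / P.2 l)
          (n := 2 * l - 2 * k) (by omega)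
        have ht : t ≠ 0 := by
          rintro rfl
          rw [zero_pow (by omega)] at htt
          exact div_ne_zero hk1 hl1' htt.symm
        have hpk := pow_ne_zero (2 * k - (n + 3)) ht
        refine ⟨_, h.isNormal_act hn (u := (t ^ (2 * k - (n + 3)) * P.2 k)⁻¹) (t := t)
          (inv_ne_zero (mul_ne_zero hpk hk1)) ht
          (fun h1 => absurd h1 hP1) (fun h1 => absurd h1 hP1) ?_ ?_,
          _, t, inv_ne_zero (mul_ne_zero hpk hk1), ht, rfl⟩
        · intro _ k' h1 h2
          rw [huniq k' h1 h2, mul_assoc, inv_mul_cancel₀ (mul_ne_zero hpk hk1)]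
        · intro _ k' l' h3 h1 h2 h4 h5
          have e1 := huniq k' h1 h2
          have e2 : l' = l := by
            rcases lt_trichotomy l' l with h6 | h6 | h6
            · exact absurd ⟨e1 ▸ h3, h5⟩ (hl2 _ h6)
            · exact h6
            · exact absurd (h4 _ (e1 ▸ hl1) h6) hl1'
          rw [e2, show 2 * l - (n + 3) = 2 * k - (n + 3) + (2 * l - 2 * k) by omega, pow_add, htt]
          field_simp
      · push Not at hl
        refine ⟨_, h.isNormal_act hn (u := (P.2 k)⁻¹) (t := 1) (inv_ne_zero hk1) one_ne_zero
          (fun h1 => absurd h1 hP1) (fun h1 => absurd h1 hP1) ?_ ?_,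
          _, 1, inv_ne_zero hk1, one_ne_zero, rfl⟩
        · intro _ k' h1 h2
          rw [huniq k' h1 h2, one_pow, mul_one, inv_mul_cancel₀ hk1]
        · intro _ k' l' h3 h1 h2 h4 h5
          obtain rfl := huniq k' h1 h2
          exact absurd (hl l' h3) h5
    · push Not at hk
      refine ⟨_, h.isNormal_act hn (u := 1) (t := 1) one_ne_zero one_ne_zero
          (fun h1 => absurd h1 hP1) (fun h1 => absurd h1 hP1) (fun _ k _ h1 => absurd (hk k) h1)
          (fun _ _ l _ _ _ _ h1 => absurd (hk l) h1),
          1, 1, one_ne_zero, one_ne_zero, rfl⟩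
  · have hP0 : P.1 ≠ 0 := by rw [h0]; exact one_ne_zero
    by_cases hk : ∃ k, n + 3 < 2 * k ∧ P.2 k ≠ 0
    · obtain ⟨hk1, hk1'⟩ := Nat.find_spec hk
      have hk2 := fun i hi => Nat.find_min (m := i) hk hi
      set k := Nat.find hk with hkdef
      -- With `γ = 1` only `u = ±1` is left, so `t` must normalize the leading entry. This is
      -- possible only where the exponent of `t` is positive, which excludes the middle entry for
      -- odd `n`.
      obtain ⟨t, htt⟩ := IsAlgClosed.exists_pow_nat_eq (P.2 k)⁻¹
        (n := 2 * k - (n + 3)) (by omega)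
      have ht : t ≠ 0 := by
        rintro rfl
        rw [zero_pow (by omega)] at htt
        exact inv_ne_zero hk1' htt.symm
      refine ⟨_, h.isNormal_act hn (u := 1) (t := t) one_ne_zero ht (fun _ => one_pow 2) ?_
        (fun h1 => absurd h1 hP0) (fun h1 => absurd h1 hP0), 1, t, one_ne_zero, ht, rfl⟩
      intro _ k' h3 h1 h2
      obtain rfl : k' = k := by
        rcases lt_trichotomy k' k with h6 | h6 | h6
        · exact absurd ⟨h3, h2⟩ (hk2 _ h6)
        · exact h6
        · exact absurd (h1 _ h6 hk1) hk1'
      rw [htt, one_mul, inv_mul_cancel₀ hk1']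
    · push Not at hk
      refine ⟨_, h.isNormal_act hn (u := 1) (t := 1) one_ne_zero one_ne_zero (fun _ => one_pow 2)
        (fun _ k h3 _ h2 => absurd (hk k h3) h2)
        (fun h1 => absurd h1 hP0) (fun h1 => absurd h1 hP0), 1, 1, one_ne_zero, one_ne_zero, rfl⟩

end NormalForm

end LeibnizSuper

namespace LeibnizSuper

/-! ### Roots of unity and the vectors of the list -/

section Vectors

theorem pow_eq_iff_exists_root {j : ℕ} (hj : 1 ≤ j) {δ w : ℂ} (hδ : δ ≠ 0) :
    w ^ j = δ ↔ ∃ m < j, w = δ ^ (1 / (j : ℂ)) * S m j := by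
  have hj0 : j ≠ 0 := by omega
  have hroot : (δ ^ (1 / (j : ℂ))) ^ j = δ := by
    rw [one_div]
    exact Complex.cpow_nat_inv_pow δ hj0
  have hS : ∀ m, Complex.exp (2 * Real.pi * Complex.I / j) ^ m = S m j := by
    intro m
    rw [← Complex.exp_nat_mul, S]
    congr 1
    ring
  have hprim := Complex.isPrimitiveRoot_exp j hj0
  have hne : δ ^ (1 / (j : ℂ)) ≠ 0 := by
    intro h0
    rw [h0, zero_pow hj0] at hroot
    exact hδ hroot.symm
  constructor
  · intro hw
    have : NeZero j := ⟨hj0⟩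
    obtain ⟨m, hm, e⟩ := hprim.eq_pow_of_pow_eq_one (ξ := w / δ ^ (1 / (j : ℂ)))
      (by rw [div_pow, hroot, hw, div_self hδ])
    refine ⟨m, hm, ?_⟩
    rw [← hS, e, mul_div_cancel₀ _ hne]
  · rintro ⟨m, -, rfl⟩
    rw [mul_pow, hroot, ← hS, ← pow_mul, mul_comm m, pow_mul, hprim.pow_eq_one, one_pow, mul_one]

theorem pow_eq_one_iff_exists_root {j : ℕ} (hj : 1 ≤ j) {w : ℂ} :
    w ^ j = 1 ↔ ∃ m < j, w = S m j := by
  simpa using pow_eq_iff_exists_root hj (w := w) one_ne_zero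

theorem S_pow {j : ℕ} (hj : 1 ≤ j) {m : ℕ} (hm : m < j) : S m j ^ j = 1 :=
  (pow_eq_one_iff_exists_root hj).2 ⟨m, hm, rfl⟩

theorem S_zero (j : ℕ) : S 0 j = 1 := by
  simp [S]

theorem S_ne_zero (m j : ℕ) : S m j ≠ 0 := Complex.exp_ne_zero _

theorem exists_sq_eq {w : ℂ} (hw : w ≠ 0) : ∃ t : ℂ, t ≠ 0 ∧ t ^ 2 = w := by
  obtain ⟨t, rfl⟩ := IsAlgClosed.exists_pow_nat_eq w (n := 2) (by omega)
  exact ⟨t, by rintro rfl; exact hw (by norm_num), rfl⟩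

/-- The formula includes position `j`, where the factor is `δ · δ = 1`. So `V⁰` is a diagonal
rescaling of one fixed vector; `V1_eq`, `V2_eq` and `W_eq` serve the same purpose. -/
theorem V0_eq {j k : ℕ} (hj : 1 ≤ j) {δ : ℂ} (hδ : δ = 1 ∨ δ = -1) {m : ℕ} (hm : m < j)
    (α : ℕ → ℂ) (i : ℕ) :
    V0 j k δ m α i = δ * (δ ^ (1 / (j : ℂ)) * S m j) ^ i * V1 j k 0 α i := by
  have hδ0 : δ ≠ 0 := by rcases hδ with rfl | rfl <;> norm_num
  have hδ2 : δ * δ = 1 := by rcases hδ with rfl | rfl <;> norm_num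
  unfold V0 V1
  split_ifs with h1 h2
  · rw [h1.1, (pow_eq_iff_exists_root hj hδ0).2 ⟨m, hm, rfl⟩, hδ2, mul_one]
  · rw [S_zero, one_pow, one_mul, mul_pow]
    ring
  · rw [mul_zero]

theorem V1_eq {j k : ℕ} (hj : 1 ≤ j) {m : ℕ} (hm : m < j) (α : ℕ → ℂ) (i : ℕ) :
    V1 j k m α i = S m j ^ i * V1 j k 0 α i := by
  unfold V1
  split_ifs with h1 h2
  · rw [h1.1, S_pow hj hm, mul_one]
  · rw [S_zero, one_pow, one_mul]
  · rw [mul_zero]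

theorem V2_eq {j k m : ℕ} (hm : m < 2 * j - 1) (α : ℕ → ℂ) (i : ℕ) :
    V2 j k m α i = S m (2 * j - 1) ^ (2 * i - 1) * V1 j k 0 α i := by
  unfold V2 V1
  split_ifs with h1 h2
  · rw [h1.1, S_pow (by omega) hm, mul_one]
  · rw [S_zero, one_pow, one_mul]
  · rw [mul_zero]

theorem W_eq {s j k : ℕ} (hj : 1 ≤ j) {m : ℕ} (hm : m < j) (α : ℕ → ℂ) (i : ℕ) :
    W s j k m α i = S m j ^ (i - s) * W s j k 0 α i := by
  unfold W
  split_ifs with h1 h2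
  · rw [h1, Nat.sub_self, pow_zero, mul_one]
  · exact V1_eq hj hm _ _
  · rw [mul_zero]

theorem V1_of_lt {j k i : ℕ} (h : i < j) (m : ℕ) (α : ℕ → ℂ) : V1 j k m α i = 0 := by
  rw [V1, if_neg (by omega), if_neg (by omega)]

theorem V1_of_gt {j k i : ℕ} (h : k < i) (m : ℕ) (α : ℕ → ℂ) : V1 j k m α i = 0 := by
  rw [V1, if_neg (by omega), if_neg (by omega)]

theorem V1_self {j k : ℕ} (h : j ≤ k) (m : ℕ) (α : ℕ → ℂ) : V1 j k m α j = 1 :=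
  if_pos ⟨rfl, h⟩

theorem W_of_lt {s j k i : ℕ} (h : i < s) (m : ℕ) (α : ℕ → ℂ) : W s j k m α i = 0 := by
  rw [W, if_neg (by omega), if_neg (by omega)]

theorem W_self (s j k m : ℕ) (α : ℕ → ℂ) : W s j k m α s = 1 := if_pos rfl

theorem W_of_between {s j k i : ℕ} (h : s < i) (h' : i < s + j) (m : ℕ) (α : ℕ → ℂ) :
    W s j k m α i = 0 := by
  rw [W, if_neg (by omega)]
  split_ifs
  · exact V1_of_lt (by omega) _ _
  · rfl

theorem W_add {s j k : ℕ} (hj : 1 ≤ j) (h : s + j ≤ k) (m : ℕ) (α : ℕ → ℂ) :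
    W s j k m α (s + j) = 1 := by
  rw [W, if_neg (by omega), if_pos ⟨by omega, h⟩, Nat.add_sub_cancel_left]
  exact V1_self (by omega) _ _

theorem W_of_gt {s j k i : ℕ} (hs : s ≤ k) (h : k < i) (m : ℕ) (α : ℕ → ℂ) :
    W s j k m α i = 0 := by
  rw [W, if_neg (by omega), if_neg (by omega)]

/-- The first nonzero entry is `1`. -/
def FirstOne (v : ℕ → ℂ) : Prop := ∀ k, (∀ i < k, v i = 0) → v k ≠ 0 → v k = 1

/-- The second nonzero entry is `1`. -/
def SecondOne (v : ℕ → ℂ) : Prop := ∀ k l, k < l → (∀ i < k, v i = 0) → v k ≠ 0 →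
  (∀ i, k < i → i < l → v i = 0) → v l ≠ 0 → v l = 1

theorem firstOne_of_lead {v : ℕ → ℂ} {j k : ℕ} (h0 : ∀ i < j, v i = 0) (hk : ∀ i, k < i → v i = 0)
    (h1 : j ≤ k → v j = 1) : FirstOne v := by
  intro i hi hvi
  have hik : i ≤ k := by
    by_contra hc
    exact hvi (hk i (by omega))
  have hji : j ≤ i := by
    by_contra hc
    exact hvi (h0 i (by omega))
  rcases eq_or_lt_of_le hji with rfl | hlt
  · exact h1 hik
  · have := hi j hlt
    rw [h1 (by omega)] at this
    exact absurd this one_ne_zero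

theorem V1_firstOne (j k m : ℕ) (α : ℕ → ℂ) : FirstOne (V1 j k m α) :=
  firstOne_of_lead (fun _ hi => V1_of_lt hi _ _) (fun _ hi => V1_of_gt hi _ _)
    fun h => V1_self h _ _

theorem V0_firstOne (j k : ℕ) (δ : ℂ) (m : ℕ) (α : ℕ → ℂ) : FirstOne (V0 j k δ m α) := by
  refine firstOne_of_lead (j := j) (k := k) (fun i hi => ?_) (fun i hi => ?_)
    fun h => if_pos ⟨rfl, h⟩
  all_goals rw [V0, if_neg (by omega), if_neg (by omega)]

theorem V2_firstOne (j k m : ℕ) (α : ℕ → ℂ) : FirstOne (V2 j k m α) := by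
  refine firstOne_of_lead (j := j) (k := k) (fun i hi => ?_) (fun i hi => ?_)
    fun h => if_pos ⟨rfl, h⟩
  all_goals rw [V2, if_neg (by omega), if_neg (by omega)]

theorem W_firstOne {s k : ℕ} (hs : s ≤ k) (j m : ℕ) (α : ℕ → ℂ) : FirstOne (W s j k m α) :=
  firstOne_of_lead (fun _ hi => W_of_lt hi _ _) (fun _ hi => W_of_gt hs hi _ _)
    fun _ => W_self _ _ _ _ _

theorem W_secondOne {s k j : ℕ} (hs : s ≤ k) (hj : 1 ≤ j) (m : ℕ) (α : ℕ → ℂ) :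
    SecondOne (W s j k m α) := by
  intro a b hab h1 h2 h3 h4
  have hbk : b ≤ k := by
    by_contra hc
    exact h4 (W_of_gt hs (by omega) _ _)
  have hsa : s ≤ a := by
    by_contra hc
    exact h2 (W_of_lt (by omega) _ _)
  obtain rfl : s = a := by
    by_contra hc
    have := h1 s (by omega)
    rw [W_self] at this
    exact one_ne_zero this
  have hsb : s + j ≤ b := by
    by_contra hc
    exact h4 (W_of_between hab (by omega) _ _)
  rcases eq_or_lt_of_le hsb with rfl | hlt
  · exact W_add hj hbk _ _
  · have := h3 (s + j) (by omega) hlt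
    rw [W_add hj (by omega)] at this
    exact absurd this one_ne_zero

/-- The value `j = k + 1` stands for the zero vector, as in the convention of the list. -/
theorem exists_lead (v : ℕ → ℂ) (k : ℕ) : ∃ j, 1 ≤ j ∧ j ≤ k + 1 ∧
    (∀ i, 1 ≤ i → i < j → v i = 0) ∧ (j ≤ k → v j ≠ 0) := by
  classical
  have hex : ∃ j, 1 ≤ j ∧ (j = k + 1 ∨ v j ≠ 0) := ⟨k + 1, by omega, Or.inl rfl⟩
  obtain ⟨h1, h2⟩ := Nat.find_spec hex
  have hmin := fun i hi => Nat.find_min (m := i) hex hi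
  refine ⟨Nat.find hex, h1, Nat.find_min' hex ⟨by omega, Or.inl rfl⟩, ?_, ?_⟩
  · intro i hi hij
    by_contra hc
    exact hmin i hij ⟨hi, Or.inr hc⟩
  · intro h3
    exact h2.resolve_left (by omega)

/-- The vector itself serves as the sequence `α`, with `m = 0`. -/
theorem FirstOne.eq_V1 {v : ℕ → ℂ} (h : FirstOne v) (h0 : v 0 = 0) {k : ℕ}
    (hk : ∀ i, k < i → v i = 0) : ∃ j, 1 ≤ j ∧ j ≤ k + 1 ∧ v = V1 j k 0 v := by
  obtain ⟨j, hj, hjk, h1, h2⟩ := exists_lead v k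
  have h1' : ∀ i < j, v i = 0 := by
    intro i hi
    rcases Nat.eq_zero_or_pos i with rfl | hi0
    · exact h0
    · exact h1 i hi0 hi
  refine ⟨j, hj, hjk, funext fun i => ?_⟩
  unfold V1
  split_ifs with h3 h4
  · obtain ⟨rfl, h3⟩ := h3
    exact h _ h1' (h2 h3)
  · rw [S_zero, one_pow, one_mul]
  · rcases Nat.lt_or_ge k i with h5 | h5
    · exact hk i h5
    · exact h1' i (by omega)

theorem FirstOne.eq_W {v : ℕ → ℂ} (h : FirstOne v) (h' : SecondOne v) (h0 : v 0 = 0) {k : ℕ}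
    (hk : ∀ i, k < i → v i = 0) :
    v = 0 ∨ ∃ s j, 1 ≤ s ∧ 1 ≤ j ∧ s + j ≤ k + 1 ∧ v = W s j k 0 v := by
  obtain ⟨s, hs, hsk, h1, h2⟩ := exists_lead v k
  have h1' : ∀ i < s, v i = 0 := by
    intro i hi
    rcases Nat.eq_zero_or_pos i with rfl | hi0
    · exact h0
    · exact h1 i hi0 hi
  rcases Nat.lt_or_ge k s with hks | hks
  · left
    funext i
    rcases Nat.lt_or_ge k i with h5 | h5
    · exact hk i h5
    · exact h1' i (by omega)
  · right
    obtain ⟨j, hj, hjk, h3, h4⟩ := exists_lead (fun i => v (s + i)) (k - s)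
    refine ⟨s, j, hs, hj, by omega, funext fun i => ?_⟩
    have hbet : ∀ i, s < i → i < s + j → v i = 0 := by
      intro i hi hi'
      have := h3 (i - s) (by omega) (by omega)
      rwa [Nat.add_sub_cancel' hi.le] at this
    unfold W
    split_ifs with h5 h6
    · rw [h5]
      exact h s h1' (h2 hks)
    · unfold V1
      split_ifs with h7 h8
      · obtain rfl : i = s + j := by omega
        exact h' s (s + j) (by omega) h1' (h2 hks) hbet (h4 (by omega))
      · rw [S_zero, one_pow, one_mul]
        exact congrArg v (Nat.add_sub_cancel' h6.1.le).symm
      · exact hbet i (by omega) (by omega)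
    · rcases Nat.lt_or_ge k i with h7 | h7
      · exact hk i h7
      · exact h1' i (by omega)

/-- The diagonal changes which preserve the normalization of `W_{s,k}(V¹_{j,k})`. -/
theorem exists_W_eq {s j k : ℕ} (hj : 1 ≤ j) (hsk : s + j ≤ k + 1) {u w : ℂ} (hu : u ≠ 0)
    (hw : w ≠ 0) {α : ℕ → ℂ} (h1 : FirstOne fun i => u * w ^ i * W s j k 0 α i)
    (h2 : SecondOne fun i => u * w ^ i * W s j k 0 α i) :
    ∃ m < j, (fun i => u * w ^ i * W s j k 0 α i) = W s j k m α := by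
  have hne : ∀ i, u * w ^ i ≠ 0 := fun i => mul_ne_zero hu (pow_ne_zero i hw)
  have hlt : ∀ i < s, u * w ^ i * W s j k 0 α i = 0 := fun i hi => by
    rw [W_of_lt hi, mul_zero]
  have hs0 : u * w ^ s * W s j k 0 α s ≠ 0 := by
    rw [W_self, mul_one]
    exact hne s
  have hus : u * w ^ s = 1 := by
    have := h1 s hlt hs0
    simpa only [W_self, mul_one] using this
  -- The second leading entry forces `wʲ = 1`. If it does not exist, `w` has no further effect and
  -- `m = 0` will do.
  obtain ⟨m, hm, hm'⟩ : ∃ m < j, s + j ≤ k → w = S m j := by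
    rcases Nat.lt_or_ge k (s + j) with hk | hk
    · exact ⟨0, hj, fun h => by omega⟩
    · have := h2 s (s + j) (by omega) hlt hs0
        (fun i hi hi' => mul_eq_zero_of_right _ (W_of_between hi hi' _ _))
        (mul_ne_zero (hne _) (by rw [W_add hj hk]; exact one_ne_zero))
      simp only [W_add hj hk, mul_one] at this
      rw [pow_add, ← mul_assoc, hus, one_mul] at this
      obtain ⟨m, hm, e⟩ := (pow_eq_one_iff_exists_root hj).1 this
      exact ⟨m, hm, fun _ => e⟩
  refine ⟨m, hm, funext fun i => ?_⟩
  rw [W_eq hj hm]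
  rcases lt_trichotomy i s with hi | rfl | hi
  · rw [W_of_lt hi, mul_zero, mul_zero]
  · rw [hus, Nat.sub_self, pow_zero]
  · rcases Nat.lt_or_ge i (s + j) with hi' | hi'
    · rw [W_of_between hi hi', mul_zero, mul_zero]
    · rcases Nat.lt_or_ge k (s + j) with hk | hk
      · rw [W_of_gt (by omega) (by omega), mul_zero, mul_zero]
      · have e : w ^ i = w ^ s * w ^ (i - s) := by rw [← pow_add, Nat.add_sub_cancel' hi.le]
        rw [e, ← mul_assoc u, hus, one_mul, hm' hk]

theorem W_eq_scale {s j k : ℕ} (hj : 1 ≤ j) {m : ℕ} (hm : m < j) (α : ℕ → ℂ) (i : ℕ) :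
    W s j k m α i = (S m j ^ s)⁻¹ * S m j ^ i * W s j k 0 α i := by
  rw [W_eq hj hm]
  rcases Nat.lt_or_ge i s with hi | hi
  · rw [W_of_lt hi, mul_zero, mul_zero]
  · have e : S m j ^ i = S m j ^ s * S m j ^ (i - s) := by rw [← pow_add, Nat.add_sub_cancel' hi]
    rw [e, inv_mul_cancel_left₀ (pow_ne_zero _ (S_ne_zero m j))]

end Vectors

end LeibnizSuper

namespace LeibnizSuper

/-! ### Normality in terms of the listed vectors -/

section Classification

theorem act_oddParam {q : ℕ} (hq : 1 ≤ q) (u t γ c : ℂ) {v : ℕ → ℂ} (hv : v 0 = 0) :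
    act (2 * q - 1) u t (oddParam q γ c v) =
      oddParam q (u ^ 2 * γ) (u * c) fun i => u * (t ^ 2) ^ i * v i := by
  refine Prod.ext rfl (funext fun k => ?_)
  simp only [act, oddParam]
  split_ifs with hk
  · rw [hk, show 2 * (q + 1) - (2 * q - 1 + 3) = 0 by omega, pow_zero, mul_one]
  · rcases Nat.lt_or_ge k (q + 1) with h | h
    · rw [show k - (q + 1) = 0 by omega, hv, mul_zero, mul_zero]
    · rw [show 2 * k - (2 * q - 1 + 3) = 2 * (k - (q + 1)) by omega, pow_mul]

theorem act_evenParam {q : ℕ} (u t γ : ℂ) {v : ℕ → ℂ} (hv : v 0 = 0) :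
    act (2 * q) u t (evenParam q γ v) =
      evenParam q (u ^ 2 * γ) fun i => u * t ^ (2 * i - 1) * v i := by
  refine Prod.ext rfl (funext fun k => ?_)
  simp only [act, evenParam]
  rcases Nat.lt_or_ge k (q + 1) with h | h
  · rw [show k - (q + 1) = 0 by omega, hv, mul_zero, mul_zero]
  · rw [show 2 * k - (2 * q + 3) = 2 * (k - (q + 1)) - 1 by omega]

theorem oddParam_zero_zero {q : ℕ} {v : ℕ → ℂ} (hv : v 0 = 0) :
    oddParam q 0 0 v = evenParam q 0 v := by
  refine Prod.ext rfl (funext fun k => ?_)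
  simp only [oddParam, evenParam]
  split_ifs with hk
  · rw [hk, Nat.sub_self, hv]
  · rfl

theorem eq_oddParam {q : ℕ} {P : Param} (h : IsReduced (2 * q - 1) P) (hq : 1 ≤ q) :
    P = oddParam q P.1 (P.2 (q + 1)) fun i => if i = 0 then 0 else P.2 (q + 1 + i) := by
  refine Prod.ext rfl (funext fun k => ?_)
  simp only [oddParam]
  split_ifs with h1 h2
  · rw [h1]
  · by_contra hc
    have := h.supp k hc
    omega
  · rw [show q + 1 + (k - (q + 1)) = k by omega]

theorem eq_evenParam {q : ℕ} {P : Param} (h : IsReduced (2 * q) P) :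
    P = evenParam q P.1 fun i => if i = 0 then 0 else P.2 (q + 1 + i) := by
  refine Prod.ext rfl (funext fun k => ?_)
  simp only [evenParam]
  split_ifs with h2
  · by_contra hc
    have := h.supp k hc
    omega
  · rw [show q + 1 + (k - (q + 1)) = k by omega]

theorem shift_zero_iff {q : ℕ} {v : ℕ → ℂ} (hv : v 0 = 0) (k : ℕ) :
    (∀ i < q + 1 + k, v (i - (q + 1)) = 0) ↔ ∀ i < k, v i = 0 := by
  constructor
  · intro h i hi
    have := h (q + 1 + i) (by omega)
    rwa [Nat.add_sub_cancel_left] at this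
  · intro h i hi
    rcases Nat.lt_or_ge i (q + 1) with h1 | h1
    · rw [show i - (q + 1) = 0 by omega, hv]
    · exact h _ (by omega)

theorem firstOne_shift_iff {q : ℕ} {v : ℕ → ℂ} (hv : v 0 = 0) :
    FirstOne (fun k => v (k - (q + 1))) ↔ FirstOne v := by
  constructor
  · intro h k hk hvk
    have := h (q + 1 + k) ((shift_zero_iff hv k).2 hk)
    simp only [Nat.add_sub_cancel_left] at this
    exact this hvk
  · intro h k hk hvk
    simp only at hvk
    have hkq : q + 1 ≤ k := by
      by_contra hc
      exact hvk (by rw [show k - (q + 1) = 0 by omega, hv])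
    obtain ⟨k, rfl⟩ := Nat.exists_eq_add_of_le hkq
    rw [shift_zero_iff hv] at hk
    simp only [Nat.add_sub_cancel_left] at hvk ⊢
    exact h k hk hvk

theorem secondOne_shift_iff {q : ℕ} {v : ℕ → ℂ} (hv : v 0 = 0) :
    SecondOne (fun k => v (k - (q + 1))) ↔ SecondOne v := by
  constructor
  · intro h k l hkl hk hvk hl hvl
    have := h (q + 1 + k) (q + 1 + l) (by omega) ((shift_zero_iff hv k).2 hk)
    simp only [Nat.add_sub_cancel_left] at this
    exact this hvk (fun i h1 h2 => hl _ (by omega) (by omega)) hvl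
  · intro h k l hkl hk hvk hl hvl
    simp only at hvk hvl
    have hkq : q + 1 ≤ k := by
      by_contra hc
      exact hvk (by rw [show k - (q + 1) = 0 by omega, hv])
    obtain ⟨k, rfl⟩ := Nat.exists_eq_add_of_le hkq
    obtain ⟨l, rfl⟩ := Nat.exists_eq_add_of_le (hkq.trans hkl.le)
    rw [shift_zero_iff hv] at hk
    simp only [Nat.add_sub_cancel_left] at hvk hvl ⊢
    refine h k l (by omega) hk hvk (fun i h1 h2 => ?_) hvl
    have := hl (q + 1 + i) (by omega) (by omega)
    simp only [Nat.add_sub_cancel_left] at this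
    exact this

theorem disc_oddParam {q : ℕ} (hq : 1 ≤ q) (γ c : ℂ) (v : ℕ → ℂ) :
    disc (2 * q - 1) (oddParam q γ c v) = γ - 4 * c ^ 2 := by
  have hodd : Odd (2 * q - 1) := ⟨q - 1, by omega⟩
  rw [disc, if_pos hodd, show (2 * q - 1 + 3) / 2 = q + 1 by omega]
  simp [oddParam]

theorem disc_even (q : ℕ) (P : Param) : disc (2 * q) P = P.1 := by
  have hodd : ¬ Odd (2 * q) := by simp
  rw [disc, if_neg hodd, sub_zero]

theorem isReduced_oddParam_iff {q : ℕ} (hq : 2 ≤ q) {γ c : ℂ} {v : ℕ → ℂ} (hv : v 0 = 0) :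
    IsReduced (2 * q - 1) (oddParam q γ c v) ↔ (∀ i, q - 1 < i → v i = 0) ∧ (γ = 0 ∨ γ = 1) ∧
      (γ ≠ 4 * c ^ 2 → v (q - 1) = 0) := by
  have hlast : (oddParam q γ c v).2 (2 * q - 1 + 1) = v (q - 1) := by
    simp only [oddParam]
    rw [if_neg (by omega), show 2 * q - 1 + 1 - (q + 1) = q - 1 by omega]
  constructor
  · intro h
    refine ⟨fun i hi => ?_, h.fst, fun hc => ?_⟩
    · by_contra hc
      have := h.supp (q + 1 + i) (by
        simp only [oddParam]
        rwa [if_neg (by omega), Nat.add_sub_cancel_left])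
      omega
    · rw [← hlast]
      exact h.last (by rwa [disc_oddParam (by omega), sub_ne_zero])
  · rintro ⟨h1, h2, h3⟩
    refine ⟨fun k hk => ?_, h2, fun hc => ?_⟩
    · simp only [oddParam] at hk
      split_ifs at hk with h4
      · omega
      · by_contra hc
        refine hk ?_
        rcases Nat.lt_or_ge k (q + 1) with h5 | h5
        · rw [show k - (q + 1) = 0 by omega, hv]
        · exact h1 _ (by omega)
    · rw [disc_oddParam (by omega), sub_ne_zero] at hc
      rw [hlast, h3 hc]

theorem isReduced_evenParam_iff {q : ℕ} {γ : ℂ} {v : ℕ → ℂ} (hv : v 0 = 0) :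
    IsReduced (2 * q) (evenParam q γ v) ↔ (∀ i, q < i → v i = 0) ∧ (γ = 0 ∨ γ = 1) ∧
      (γ ≠ 0 → v q = 0) := by
  have hlast : (evenParam q γ v).2 (2 * q + 1) = v q := by
    simp only [evenParam]
    rw [show 2 * q + 1 - (q + 1) = q by omega]
  constructor
  · intro h
    refine ⟨fun i hi => ?_, h.fst, fun hc => ?_⟩
    · by_contra hc
      have := h.supp (q + 1 + i) (by
        simp only [evenParam]
        rwa [Nat.add_sub_cancel_left])
      omega
    · rw [← hlast]
      exact h.last (by rwa [disc_even])
  · rintro ⟨h1, h2, h3⟩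
    refine ⟨fun k hk => ?_, h2, fun hc => ?_⟩
    · simp only [evenParam] at hk
      by_contra hc
      refine hk ?_
      rcases Nat.lt_or_ge k (q + 2) with h5 | h5
      · rw [show k - (q + 1) = 0 by omega, hv]
      · exact h1 _ (by omega)
    · rw [disc_even] at hc
      rw [hlast, h3 hc]

/-- The entry `c` has weight `0` in `t`, so only `v` is normalized. The obstruction is `1 - 4c²`,
whence the exceptional values `c = ±1/2`. -/
theorem isNormal_oddParam_one_iff {q : ℕ} (hq : 2 ≤ q) {c : ℂ} {v : ℕ → ℂ} (hv : v 0 = 0) :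
    IsNormal (2 * q - 1) (oddParam q 1 c v) ↔
      (∀ i, q - 1 < i → v i = 0) ∧ (1 ≠ 4 * c ^ 2 → v (q - 1) = 0) ∧ FirstOne v := by
  have hval : ∀ i, i ≠ 0 → (oddParam q 1 c v).2 (q + 1 + i) = v i := fun i hi => by
    simp only [oddParam]
    rw [if_neg (by omega), Nat.add_sub_cancel_left]
  constructor
  · intro h
    obtain ⟨h1, -, h3⟩ := (isReduced_oddParam_iff hq hv).1 h.toIsReduced
    refine ⟨h1, h3, fun k hk hvk => ?_⟩
    have hk0 : k ≠ 0 := by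
      rintro rfl
      exact hvk hv
    have := h.lead rfl (q + 1 + k) (by omega)
    rw [hval k hk0] at this
    refine this (fun i hi hi' => ?_) hvk
    obtain ⟨i, rfl⟩ := Nat.exists_eq_add_of_le (show q + 1 ≤ i by omega)
    rw [hval i (by omega)]
    exact hk i (by omega)
  · rintro ⟨h1, h2, h3⟩
    refine ⟨(isReduced_oddParam_iff hq hv).2 ⟨h1, Or.inr rfl, h2⟩, ?_,
      fun h => absurd h one_ne_zero, fun h => absurd h one_ne_zero⟩
    intro _ k hk hi hvk
    obtain ⟨k, rfl⟩ := Nat.exists_eq_add_of_le (show q + 1 ≤ k by omega)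
    rw [hval k (by omega)] at hvk ⊢
    refine h3 k (fun i hik => ?_) hvk
    rcases Nat.eq_zero_or_pos i with rfl | hi0
    · exact hv
    · rw [← hval i (by omega)]
      exact hi _ (by omega) (by omega)

/-- Here `c = 1` is the first entry, so the second leading entry is the first one of `v`. The
obstruction `-4` is nonzero, so the last entry is removed and the length is `q - 2`. -/
theorem isNormal_oddParam_zero_one_iff {q : ℕ} (hq : 2 ≤ q) {v : ℕ → ℂ} (hv : v 0 = 0) :
    IsNormal (2 * q - 1) (oddParam q 0 1 v) ↔
      (∀ i, q - 2 < i → v i = 0) ∧ FirstOne v := by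
  have hval : ∀ i, i ≠ 0 → (oddParam q 0 1 v).2 (q + 1 + i) = v i := fun i hi => by
    simp only [oddParam]
    rw [if_neg (by omega), Nat.add_sub_cancel_left]
  have hc : (oddParam q 0 1 v).2 (q + 1) = 1 := if_pos rfl
  have hlow : ∀ i < q + 1, (oddParam q 0 1 v).2 i = 0 := fun i hi => by
    simp only [oddParam]
    rw [if_neg (by omega), show i - (q + 1) = 0 by omega, hv]
  have hfirst : ∀ k, (∀ i < k, (oddParam q 0 1 v).2 i = 0) → (oddParam q 0 1 v).2 k ≠ 0 →
      k = q + 1 := by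
    intro k h1 h2
    rcases lt_trichotomy k (q + 1) with h3 | h3 | h3
    · exact absurd (hlow _ h3) h2
    · exact h3
    · have := h1 _ h3
      rw [hc] at this
      exact absurd this one_ne_zero
  constructor
  · intro h
    obtain ⟨h1, -, h3⟩ := (isReduced_oddParam_iff hq hv).1 h.toIsReduced
    refine ⟨fun i hi => ?_, fun k hk hvk => ?_⟩
    · rcases eq_or_ne i (q - 1) with rfl | h4
      · exact h3 (by norm_num)
      · exact h1 i (by omega)
    · have hk0 : k ≠ 0 := by
        rintro rfl
        exact hvk hv
      have := h.second rfl (q + 1) (q + 1 + k) (by omega) hlow (by rw [hc]; exact one_ne_zero)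
      rw [hval k hk0] at this
      refine this (fun i hi hi' => ?_) hvk
      obtain ⟨i, rfl⟩ := Nat.exists_eq_add_of_le (show q + 1 ≤ i by omega)
      rw [hval i (by omega)]
      exact hk i (by omega)
  · rintro ⟨h1, h3⟩
    refine ⟨(isReduced_oddParam_iff hq hv).2 ⟨fun i hi => h1 i (by omega), Or.inl rfl,
      fun _ => h1 _ (by omega)⟩, fun h => absurd h zero_ne_one, ?_, ?_⟩
    · intro _ k hk hvk
      rw [hfirst k hk hvk, hc]
    · intro _ k l hkl hk hvk hl hvl
      obtain rfl := hfirst k hk hvk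
      obtain ⟨l, rfl⟩ := Nat.exists_eq_add_of_le hkl.le
      rw [hval l (by omega)] at hvl ⊢
      refine h3 l (fun i hil => ?_) hvl
      rcases Nat.eq_zero_or_pos i with rfl | hi0
      · exact hv
      · rw [← hval i (by omega)]
        exact hl _ (by omega) (by omega)

theorem isNormal_oddParam_zero_zero_iff {q : ℕ} (hq : 2 ≤ q) {v : ℕ → ℂ} (hv : v 0 = 0) :
    IsNormal (2 * q - 1) (oddParam q 0 0 v) ↔
      (∀ i, q - 1 < i → v i = 0) ∧ FirstOne v ∧ SecondOne v := by
  have hval : (oddParam q 0 0 v).2 = fun k => v (k - (q + 1)) := by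
    rw [oddParam_zero_zero hv, evenParam]
  rw [← firstOne_shift_iff (q := q) hv, ← secondOne_shift_iff (q := q) hv, ← hval]
  constructor
  · intro h
    exact ⟨((isReduced_oddParam_iff hq hv).1 h.toIsReduced).1, h.first rfl, h.second rfl⟩
  · rintro ⟨h1, h2, h3⟩
    exact ⟨(isReduced_oddParam_iff hq hv).2 ⟨h1, Or.inl rfl, fun h => absurd (by norm_num) h⟩,
      fun h => absurd h zero_ne_one, fun _ => h2, fun _ => h3⟩

theorem isNormal_evenParam_one_iff {q : ℕ} {v : ℕ → ℂ} (hv : v 0 = 0) (hq : 1 ≤ q) :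
    IsNormal (2 * q) (evenParam q 1 v) ↔ (∀ i, q - 1 < i → v i = 0) ∧ FirstOne v := by
  have hval : (evenParam q 1 v).2 = fun k => v (k - (q + 1)) := rfl
  have hlow : ∀ i, ¬ 2 * q + 3 < 2 * i → (evenParam q 1 v).2 i = 0 := fun i hi => by
    rw [hval]
    simp only
    rw [show i - (q + 1) = 0 by omega, hv]
  rw [← firstOne_shift_iff (q := q) hv, ← hval]
  constructor
  · intro h
    obtain ⟨h1, -, h3⟩ := (isReduced_evenParam_iff hv).1 h.toIsReduced
    refine ⟨fun i hi => ?_, fun k hk hvk => ?_⟩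
    · rcases eq_or_ne i q with rfl | h4
      · exact h3 one_ne_zero
      · exact h1 i (by omega)
    · refine h.lead rfl k ?_ (fun i hi _ => hk i hi) hvk
      by_contra hc
      exact hvk (hlow k hc)
  · rintro ⟨h1, h2⟩
    refine ⟨(isReduced_evenParam_iff hv).2 ⟨fun i hi => h1 i (by omega), Or.inr rfl,
      fun _ => h1 q (by omega)⟩, ?_, fun h => absurd h one_ne_zero, fun h => absurd h one_ne_zero⟩
    intro _ k hk hi hvk
    refine h2 k (fun i hik => ?_) hvk
    by_cases h4 : 2 * q + 3 < 2 * i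
    · exact hi i hik h4
    · exact hlow i h4

theorem isNormal_evenParam_zero_iff {q : ℕ} {v : ℕ → ℂ} (hv : v 0 = 0) :
    IsNormal (2 * q) (evenParam q 0 v) ↔
      (∀ i, q < i → v i = 0) ∧ FirstOne v ∧ SecondOne v := by
  have hval : (evenParam q 0 v).2 = fun k => v (k - (q + 1)) := rfl
  rw [← firstOne_shift_iff (q := q) hv, ← secondOne_shift_iff (q := q) hv, ← hval]
  constructor
  · intro h
    exact ⟨((isReduced_evenParam_iff hv).1 h.toIsReduced).1, h.first rfl, h.second rfl⟩
  · rintro ⟨h1, h2, h3⟩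
    exact ⟨(isReduced_evenParam_iff hv).2 ⟨h1, Or.inl rfl, fun h => absurd rfl h⟩,
      fun h => absurd h zero_ne_one, fun _ => h2, fun _ => h3⟩

end Classification

end LeibnizSuper

namespace LeibnizSuper

/-! ### The families as sets of normalized points of orbits -/

section Classification

/-- The normalized parameters which give the same superalgebra as `P`. -/
def orbitSet (n : ℕ) (P : Param) : Set Param := {Q | IsNormal n Q ∧ Orbit n P Q}

theorem scale_lead_eq_one {j k : ℕ} {α f : ℕ → ℂ} (hf : ∀ i, f i ≠ 0)
    (h : FirstOne fun i => f i * V1 j k 0 α i) (hjk : j ≤ k) : f j = 1 := by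
  have := h j (fun i hi => mul_eq_zero_of_right _ (V1_of_lt hi _ _))
    (mul_ne_zero (hf j) (by rw [V1_self hjk]; exact one_ne_zero))
  simpa only [V1_self hjk, mul_one] using this

/-- Keeping `γ = 1` forces `u = δ = ±1`; keeping the leading `1` forces `(t²)ʲ = δ`, so `t²` is the
principal root of `δ` times `S_{m,j}`. -/
theorem family_one_eq_orbitSet {q : ℕ} (hq : 2 ≤ q) {b : ℂ} {j k : ℕ} (hj : 1 ≤ j)
    (hk : k ≤ q - 1) (hk' : 1 ≠ 4 * b ^ 2 → k < q - 1) (α : ℕ → ℂ) :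
    {P | ∃ (δ : ℂ) (m : ℕ), (δ = 1 ∨ δ = -1) ∧ m < j ∧
      P = oddParam q 1 (δ * b) (V0 j k δ m α)} =
    orbitSet (2 * q - 1) (oddParam q 1 b (V1 j k 0 α)) := by
  have hV0 : V1 j k 0 α 0 = 0 := V1_of_lt (by omega) _ _
  ext Q
  constructor
  · rintro ⟨δ, m, hδ, hm, rfl⟩
    have hδ2 : δ ^ 2 = 1 := by rcases hδ with rfl | rfl <;> norm_num
    have hδ0 : δ ≠ 0 := by rcases hδ with rfl | rfl <;> norm_num
    have hzero : ∀ i, V1 j k 0 α i = 0 → V0 j k δ m α i = 0 := fun i hi => by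
      rw [V0_eq hj hδ hm, hi, mul_zero]
    constructor
    · rw [isNormal_oddParam_one_iff hq (hzero 0 hV0)]
      refine ⟨fun i hi => hzero i (V1_of_gt (by omega) _ _), fun h => ?_, V0_firstOne _ _ _ _ _⟩
      rw [mul_pow, hδ2, one_mul] at h
      exact hzero _ (V1_of_gt (hk' h) _ _)
    · have hw : (δ ^ (1 / (j : ℂ)) * S m j) ≠ 0 := by
        intro h0
        have := (pow_eq_iff_exists_root hj hδ0).2 ⟨m, hm, rfl⟩
        rw [h0, zero_pow (by omega)] at this
        exact hδ0 this.symm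
      -- For odd `n` only even powers of `t` occur, so a square root of the required factor is
      -- needed.
      obtain ⟨t, ht, htw⟩ := exists_sq_eq hw
      refine ⟨δ, t, hδ0, ht, ?_⟩
      rw [act_oddParam (by omega) _ _ _ _ hV0, hδ2, one_mul, htw]
      exact congrArg _ (funext fun i => V0_eq hj hδ hm α i)
  · rintro ⟨hQ, u, t, hu, ht, rfl⟩
    have hfst : u ^ 2 * 1 = 1 := hQ.fst.resolve_left (mul_ne_zero (pow_ne_zero _ hu) one_ne_zero)
    rw [act_oddParam (by omega) _ _ _ _ hV0, hfst, isNormal_oddParam_one_iff hq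
      (by rw [hV0, mul_zero])] at hQ
    rw [act_oddParam (by omega) _ _ _ _ hV0, hfst]
    rw [mul_one, pow_two, mul_self_eq_one_iff] at hfst
    obtain ⟨m, hm, hm'⟩ : ∃ m < j, j ≤ k → t ^ 2 = u ^ (1 / (j : ℂ)) * S m j := by
      by_cases hjk : j ≤ k
      · have h1 := scale_lead_eq_one (f := fun i => u * (t ^ 2) ^ i)
          (fun i => mul_ne_zero hu (pow_ne_zero _ (pow_ne_zero _ ht))) hQ.2.2 hjk
        have h2 : (t ^ 2) ^ j = u := by
          rcases hfst with rfl | rfl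
          · simpa using h1
          · linear_combination -h1
        obtain ⟨m, hm, e⟩ := (pow_eq_iff_exists_root hj hu).1 h2
        exact ⟨m, hm, fun _ => e⟩
      · exact ⟨0, by omega, fun h => absurd h hjk⟩
    refine ⟨u, m, hfst, hm, congrArg _ (funext fun i => ?_)⟩
    rw [V0_eq hj hfst hm]
    by_cases hjk : j ≤ k
    · rw [hm' hjk]
    · have : V1 j k 0 α i = 0 := by
        rcases Nat.lt_or_ge i j with h | h
        · exact V1_of_lt h _ _
        · exact V1_of_gt (by omega) _ _
      rw [this, mul_zero, mul_zero]

/-- The first entry `c = 1` forces `u = 1`, and the leading entry of `v` forces `(t²)ʲ = 1`. -/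
theorem family_zero_one_eq_orbitSet {q : ℕ} (hq : 2 ≤ q) {j : ℕ} (hj : 1 ≤ j) (α : ℕ → ℂ) :
    {P | ∃ m : ℕ, m < j ∧ P = oddParam q 0 1 (V1 j (q - 2) m α)} =
    orbitSet (2 * q - 1) (oddParam q 0 1 (V1 j (q - 2) 0 α)) := by
  have hV0 : ∀ m, V1 j (q - 2) m α 0 = 0 := fun m => V1_of_lt (by omega) _ _
  ext Q
  constructor
  · rintro ⟨m, hm, rfl⟩
    constructor
    · rw [isNormal_oddParam_zero_one_iff hq (hV0 m)]
      exact ⟨fun i hi => V1_of_gt (by omega) _ _, V1_firstOne _ _ _ _⟩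
    · obtain ⟨t, ht, htw⟩ := exists_sq_eq (S_ne_zero m j)
      refine ⟨1, t, one_ne_zero, ht, ?_⟩
      rw [act_oddParam (by omega) _ _ _ _ (hV0 0), mul_zero, one_mul, htw]
      exact congrArg _ (funext fun i => by rw [one_mul, V1_eq hj hm])
  · rintro ⟨hQ, u, t, hu, ht, rfl⟩
    have hu1 : u = 1 := by
      have h1 := hQ.first (mul_zero _) (q + 1)
      rw [act_oddParam (by omega) _ _ _ _ (hV0 0)] at h1
      have e : ∀ v : ℕ → ℂ, (oddParam q (u ^ 2 * 0) (u * 1) v).2 (q + 1) = u := fun v => by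
        simp [oddParam]
      rw [e] at h1
      refine h1 (fun i hi => ?_) hu
      simp only [oddParam]
      rw [if_neg (by omega), show i - (q + 1) = 0 by omega, hV0, mul_zero]
    subst hu1
    rw [act_oddParam (by omega) _ _ _ _ (hV0 0), mul_zero, one_mul,
      isNormal_oddParam_zero_one_iff hq (by rw [hV0, mul_zero])] at hQ
    rw [act_oddParam (by omega) _ _ _ _ (hV0 0), mul_zero, one_mul]
    obtain ⟨m, hm, hm'⟩ : ∃ m < j, j ≤ q - 2 → t ^ 2 = S m j := by
      by_cases hjk : j ≤ q - 2
      · have h1 := scale_lead_eq_one (f := fun i => 1 * (t ^ 2) ^ i)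
          (fun i => mul_ne_zero hu (pow_ne_zero _ (pow_ne_zero _ ht))) hQ.2 hjk
        obtain ⟨m, hm, e⟩ := (pow_eq_one_iff_exists_root hj).1 ((one_mul _).symm.trans h1)
        exact ⟨m, hm, fun _ => e⟩
      · exact ⟨0, by omega, fun h => absurd h hjk⟩
    refine ⟨m, hm, congrArg _ (funext fun i => ?_)⟩
    rw [V1_eq hj hm, one_mul]
    by_cases hjk : j ≤ q - 2
    · rw [hm' hjk]
    · have : V1 j (q - 2) 0 α i = 0 := by
        rcases Nat.lt_or_ge i j with h | h
        · exact V1_of_lt h _ _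
        · exact V1_of_gt (by omega) _ _
      rw [this, mul_zero, mul_zero]

theorem family_zero_zero_eq_orbitSet {q : ℕ} (hq : 2 ≤ q) {s j : ℕ} (hj : 1 ≤ j) (hs : 1 ≤ s)
    (hsj : s + j ≤ q - 1 + 1) (α : ℕ → ℂ) :
    {P | ∃ m : ℕ, m < j ∧ P = oddParam q 0 0 (W s j (q - 1) m α)} =
    orbitSet (2 * q - 1) (oddParam q 0 0 (W s j (q - 1) 0 α)) := by
  have hW0 : ∀ m, W s j (q - 1) m α 0 = 0 := fun m => W_of_lt (by omega) _ _
  ext Q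
  constructor
  · rintro ⟨m, hm, rfl⟩
    constructor
    · rw [isNormal_oddParam_zero_zero_iff hq (hW0 m)]
      exact ⟨fun i hi => W_of_gt (by omega) hi _ _, W_firstOne (by omega) _ _ _,
        W_secondOne (by omega) hj _ _⟩
    · obtain ⟨t, ht, htw⟩ := exists_sq_eq (S_ne_zero m j)
      refine ⟨(S m j ^ s)⁻¹, t, inv_ne_zero (pow_ne_zero _ (S_ne_zero m j)), ht, ?_⟩
      rw [act_oddParam (by omega) _ _ _ _ (hW0 0), mul_zero, mul_zero, htw]
      exact congrArg _ (funext fun i => W_eq_scale hj hm α i)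
  · rintro ⟨hQ, u, t, hu, ht, rfl⟩
    rw [act_oddParam (by omega) _ _ _ _ (hW0 0), mul_zero, mul_zero] at hQ ⊢
    rw [isNormal_oddParam_zero_zero_iff hq (by rw [hW0, mul_zero])] at hQ
    obtain ⟨m, hm, e⟩ := exists_W_eq hj hsj hu (pow_ne_zero 2 ht) hQ.2.1 hQ.2.2
    exact ⟨m, hm, congrArg _ e⟩

/-- All exponents of `t` are odd, so the sign `u = ±1` is absorbed: `u t^{2i-1} = (u t)^{2i-1}`. The
leading entry makes `u t` a root of unity of order dividing `2j - 1`. -/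
theorem even_family_one_eq_orbitSet {q : ℕ} (hq : 1 ≤ q) {j : ℕ} (hj : 1 ≤ j) (α : ℕ → ℂ) :
    {P | ∃ m : ℕ, m < 2 * j - 1 ∧ P = evenParam q 1 (V2 j (q - 1) m α)} =
    orbitSet (2 * q) (evenParam q 1 (V1 j (q - 1) 0 α)) := by
  have hV0 : V1 j (q - 1) 0 α 0 = 0 := V1_of_lt (by omega) _ _
  ext Q
  constructor
  · rintro ⟨m, hm, rfl⟩
    have hzero : ∀ i, V1 j (q - 1) 0 α i = 0 → V2 j (q - 1) m α i = 0 := fun i hi => by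
      rw [V2_eq hm, hi, mul_zero]
    constructor
    · rw [isNormal_evenParam_one_iff (hzero 0 hV0) hq]
      exact ⟨fun i hi => hzero i (V1_of_gt hi _ _), V2_firstOne _ _ _ _⟩
    · refine ⟨1, S m (2 * j - 1), one_ne_zero, S_ne_zero _ _, ?_⟩
      rw [act_evenParam _ _ _ hV0, one_pow, one_mul]
      exact congrArg _ (funext fun i => by rw [one_mul, V2_eq hm])
  · rintro ⟨hQ, u, t, hu, ht, rfl⟩
    have hfst : u ^ 2 * 1 = 1 := hQ.fst.resolve_left (mul_ne_zero (pow_ne_zero _ hu) one_ne_zero)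
    rw [act_evenParam _ _ _ hV0, hfst] at hQ ⊢
    rw [isNormal_evenParam_one_iff (by rw [hV0, mul_zero]) hq] at hQ
    rw [mul_one, pow_two] at hfst
    have hodd : ∀ i, 1 ≤ i → u * t ^ (2 * i - 1) = (u * t) ^ (2 * i - 1) := by
      intro i hi
      obtain ⟨i, rfl⟩ := Nat.exists_eq_add_of_le hi
      rw [show 2 * (1 + i) - 1 = 2 * i + 1 by omega, mul_pow, pow_succ u, pow_mul u, pow_two, hfst,
        one_pow, one_mul]
    obtain ⟨m, hm, hm'⟩ : ∃ m < 2 * j - 1, j ≤ q - 1 → u * t = S m (2 * j - 1) := by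
      by_cases hjk : j ≤ q - 1
      · have h1 := scale_lead_eq_one (f := fun i => u * t ^ (2 * i - 1))
          (fun i => mul_ne_zero hu (pow_ne_zero _ ht)) hQ.2 hjk
        obtain ⟨m, hm, e⟩ := (pow_eq_one_iff_exists_root (by omega)).1 ((hodd j hj).symm.trans h1)
        exact ⟨m, hm, fun _ => e⟩
      · exact ⟨0, by omega, fun h => absurd h hjk⟩
    refine ⟨m, hm, congrArg _ (funext fun i => ?_)⟩
    rw [V2_eq hm]
    rcases Nat.lt_or_ge i j with h | h
    · rw [V1_of_lt h, mul_zero, mul_zero]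
    · by_cases hjk : j ≤ q - 1
      · rw [hodd i (by omega), hm' hjk]
      · rw [V1_of_gt (by omega), mul_zero, mul_zero]

theorem even_family_zero_eq_orbitSet {q : ℕ} {s j : ℕ} (hj : 1 ≤ j) (hs : 1 ≤ s)
    (hsj : s + j ≤ q + 1) (α : ℕ → ℂ) :
    {P | ∃ m : ℕ, m < j ∧ P = evenParam q 0 (W s j q m α)} =
    orbitSet (2 * q) (evenParam q 0 (W s j q 0 α)) := by
  have hW0 : ∀ m, W s j q m α 0 = 0 := fun m => W_of_lt (by omega) _ _
  ext Q
  constructor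
  · rintro ⟨m, hm, rfl⟩
    constructor
    · rw [isNormal_evenParam_zero_iff (hW0 m)]
      exact ⟨fun i hi => W_of_gt (by omega) hi _ _, W_firstOne (by omega) _ _ _,
        W_secondOne (by omega) hj _ _⟩
    · obtain ⟨t, ht, htw⟩ := exists_sq_eq (S_ne_zero m j)
      refine ⟨(S m j ^ s)⁻¹ * t, t,
        mul_ne_zero (inv_ne_zero (pow_ne_zero _ (S_ne_zero m j))) ht, ht, ?_⟩
      rw [act_evenParam _ _ _ (hW0 0), mul_zero]
      refine congrArg _ (funext fun i => ?_)
      rcases Nat.eq_zero_or_pos i with rfl | hi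
      · rw [hW0, hW0, mul_zero]
      · have e : t * t ^ (2 * i - 1) = S m j ^ i := by
          rw [← htw, ← pow_mul, ← pow_succ', show 2 * i - 1 + 1 = 2 * i by omega]
        rw [mul_assoc _ t, e, W_eq_scale hj hm]
  · rintro ⟨hQ, u, t, hu, ht, rfl⟩
    -- Writing `u t^{2i-1} = (u t⁻¹)(t²)ⁱ` reduces the even case to the same rescaling as for odd
    -- `n`. At `i = 0`, where the exponent is truncated, the entry is zero.
    have e : (fun i => u * t ^ (2 * i - 1) * W s j q 0 α i) =
        fun i => u * t⁻¹ * (t ^ 2) ^ i * W s j q 0 α i := by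
      funext i
      rcases Nat.eq_zero_or_pos i with rfl | hi
      · rw [hW0, mul_zero, mul_zero]
      · rw [← pow_mul, show 2 * i = 2 * i - 1 + 1 by omega, pow_succ', Nat.add_sub_cancel,
          ← mul_assoc (u * t⁻¹), inv_mul_cancel_right₀ ht]
    rw [act_evenParam _ _ _ (hW0 0), mul_zero, e] at hQ ⊢
    rw [isNormal_evenParam_zero_iff (by rw [hW0, mul_zero])] at hQ
    obtain ⟨m, hm, e⟩ := exists_W_eq hj hsj (mul_ne_zero hu (inv_ne_zero ht)) (pow_ne_zero 2 ht)
      hQ.2.1 hQ.2.2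
    exact ⟨m, hm, congrArg _ e⟩

theorem orbitSet_zero (n : ℕ) : orbitSet n (0, 0) = {(0, 0)} := by
  have hact : ∀ u t, act n u t (0, 0) = (0, 0) := fun u t =>
    Prod.ext (mul_zero _) (funext fun k => mul_zero _)
  ext Q
  constructor
  · rintro ⟨-, u, t, -, -, rfl⟩
    exact hact u t
  · rintro rfl
    refine ⟨⟨⟨fun k h => absurd rfl h, Or.inl rfl, fun _ => rfl⟩, fun h => absurd h zero_ne_one,
      fun _ k _ h => absurd rfl h, fun _ k l _ _ h => absurd rfl h⟩, Orbit.refl _ _⟩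

theorem IsNormal.mem_orbitSet {n : ℕ} {P : Param} (h : IsNormal n P) : P ∈ orbitSet n P :=
  ⟨h, Orbit.refl n P⟩

/-- The sets in the list for odd `n`. -/
theorem mem_oddList_iff {q : ℕ} (hq : 2 ≤ q) (F : Set Param) :
    F ∈ oddList q ↔ ∃ P, IsNormal (2 * q - 1) P ∧ F = orbitSet (2 * q - 1) P := by
  -- The condition `b = ±1/2` is the vanishing of the obstruction `1 - 4b²`.
  have hb : ∀ b : ℂ, 1 = 4 * b ^ 2 ↔ b = 1 / 2 ∨ b = -1 / 2 := by
    intro b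
    constructor
    · intro h
      have : (b - 1 / 2) * (b + 1 / 2) = 0 := by linear_combination (-1 / 4) * h
      rcases mul_eq_zero.1 this with h1 | h1
      · exact Or.inl (by linear_combination h1)
      · exact Or.inr (by linear_combination h1)
    · rintro (rfl | rfl) <;> norm_num
  constructor
  · rintro (⟨b, j, α, h1, h2, hj, hj', rfl⟩ | ⟨b, j, α, h1, hj, hj', rfl⟩ | ⟨j, α, hj, hj', rfl⟩ |
      ⟨j, s, α, hj, hj', hs, hs', rfl⟩ | rfl)
    · refine ⟨_, ?_, family_one_eq_orbitSet hq hj (by omega) (fun _ => by omega) α⟩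
      rw [isNormal_oddParam_one_iff hq (V1_of_lt (by omega) _ _)]
      exact ⟨fun i hi => V1_of_gt (by omega) _ _, fun _ => V1_of_gt (by omega) _ _,
        V1_firstOne _ _ _ _⟩
    · have h1' := (hb b).2 h1
      refine ⟨_, ?_, family_one_eq_orbitSet hq hj le_rfl (fun h => absurd h1' h) α⟩
      rw [isNormal_oddParam_one_iff hq (V1_of_lt (by omega) _ _)]
      exact ⟨fun i hi => V1_of_gt (by omega) _ _, fun h => absurd h1' h, V1_firstOne _ _ _ _⟩
    · refine ⟨_, ?_, family_zero_one_eq_orbitSet hq hj α⟩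
      rw [isNormal_oddParam_zero_one_iff hq (V1_of_lt (by omega) _ _)]
      exact ⟨fun i hi => V1_of_gt (by omega) _ _, V1_firstOne _ _ _ _⟩
    · refine ⟨_, ?_, family_zero_zero_eq_orbitSet hq hj hs (by omega) α⟩
      rw [isNormal_oddParam_zero_zero_iff hq (W_of_lt (by omega) _ _)]
      exact ⟨fun i hi => W_of_gt (by omega) hi _ _, W_firstOne (by omega) _ _ _,
        W_secondOne (by omega) hj _ _⟩
    · refine ⟨(0, 0), ?_, (orbitSet_zero _).symm⟩
      have : ((0, 0) : Param) ∈ orbitSet (2 * q - 1) (0, 0) := by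
        rw [orbitSet_zero _]
        rfl
      exact this.1
  · rintro ⟨P, hP, rfl⟩
    obtain ⟨γ, c, v, hv, rfl⟩ : ∃ γ c v, v 0 = 0 ∧ P = oddParam q γ c v :=
      ⟨_, _, _, if_pos rfl, eq_oddParam hP.toIsReduced (by omega)⟩
    have hγ : γ = 0 ∨ γ = 1 := hP.fst
    rcases hγ with rfl | rfl
    · rcases eq_or_ne c 0 with rfl | hc
      · obtain ⟨h1, h2, h3⟩ := (isNormal_oddParam_zero_zero_iff hq hv).1 hP
        rcases h2.eq_W h3 hv h1 with rfl | ⟨s, j, hs, hj, hsj, e⟩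
        · refine Or.inr (Or.inr (Or.inr (Or.inr ?_)))
          have e : oddParam q 0 0 0 = (0, 0) :=
            Prod.ext rfl (funext fun k => by simp [oddParam])
          rw [e, orbitSet_zero _]
        · refine Or.inr (Or.inr (Or.inr (Or.inl ⟨j, s, v, hj, by omega, hs, by omega, ?_⟩)))
          rw [family_zero_zero_eq_orbitSet hq hj hs (by omega), ← e]
      · have hval : (oddParam q 0 c v).2 (q + 1) = c := if_pos rfl
        have hc1 : c = 1 := by
          have := hP.first rfl (q + 1)
          rw [hval] at this
          refine this (fun i hi => ?_) hc
          simp only [oddParam]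
          rw [if_neg (by omega), show i - (q + 1) = 0 by omega, hv]
        subst hc1
        obtain ⟨h1, h2⟩ := (isNormal_oddParam_zero_one_iff hq hv).1 hP
        obtain ⟨j, hj, hjk, e⟩ := h2.eq_V1 hv h1
        refine Or.inr (Or.inr (Or.inl ⟨j, v, hj, by omega, ?_⟩))
        rw [family_zero_one_eq_orbitSet hq hj, ← e]
    · obtain ⟨h1, h2, h3⟩ := (isNormal_oddParam_one_iff hq hv).1 hP
      by_cases hc : 1 = 4 * c ^ 2
      · obtain ⟨j, hj, hjk, e⟩ := h3.eq_V1 hv h1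
        refine Or.inr (Or.inl ⟨c, j, v, (hb c).1 hc, hj, by omega, ?_⟩)
        rw [family_one_eq_orbitSet hq hj le_rfl (fun h => absurd hc h), ← e]
      · obtain ⟨j, hj, hjk, e⟩ := h3.eq_V1 hv (k := q - 2) (fun i hi => by
          rcases eq_or_ne i (q - 1) with rfl | h4
          · exact h2 hc
          · exact h1 i (by omega))
        have hc' := mt (hb c).2 hc
        push Not at hc'
        refine Or.inl ⟨c, j, v, hc'.1, hc'.2, hj, by omega, ?_⟩
        rw [family_one_eq_orbitSet hq hj (by omega) (fun _ => by omega), ← e]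

/-- The sets in the list for even `n`. -/
theorem mem_evenList_iff {q : ℕ} (hq : 1 ≤ q) (F : Set Param) :
    F ∈ evenList q ↔ ∃ P, IsNormal (2 * q) P ∧ F = orbitSet (2 * q) P := by
  constructor
  · rintro (⟨j, α, hj, hj', rfl⟩ | ⟨j, s, α, hj, hj', hs, hs', rfl⟩ | rfl)
    · refine ⟨_, ?_, even_family_one_eq_orbitSet hq hj α⟩
      rw [isNormal_evenParam_one_iff (V1_of_lt (by omega) _ _) hq]
      exact ⟨fun i hi => V1_of_gt (by omega) _ _, V1_firstOne _ _ _ _⟩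
    · refine ⟨_, ?_, even_family_zero_eq_orbitSet hj hs (by omega) α⟩
      rw [isNormal_evenParam_zero_iff (W_of_lt (by omega) _ _)]
      exact ⟨fun i hi => W_of_gt (by omega) hi _ _, W_firstOne (by omega) _ _ _,
        W_secondOne (by omega) hj _ _⟩
    · refine ⟨(0, 0), ?_, (orbitSet_zero _).symm⟩
      have : ((0, 0) : Param) ∈ orbitSet (2 * q) (0, 0) := by
        rw [orbitSet_zero _]
        rfl
      exact this.1
  · rintro ⟨P, hP, rfl⟩
    obtain ⟨γ, v, hv, rfl⟩ : ∃ γ v, v 0 = 0 ∧ P = evenParam q γ v :=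
      ⟨_, _, if_pos rfl, eq_evenParam hP.toIsReduced⟩
    have hγ : γ = 0 ∨ γ = 1 := hP.fst
    rcases hγ with rfl | rfl
    · obtain ⟨h1, h2, h3⟩ := (isNormal_evenParam_zero_iff hv).1 hP
      rcases h2.eq_W h3 hv h1 with rfl | ⟨s, j, hs, hj, hsj, e⟩
      · refine Or.inr (Or.inr ?_)
        have e : evenParam q 0 0 = (0, 0) := rfl
        rw [e, orbitSet_zero _]
      · refine Or.inr (Or.inl ⟨j, s, v, hj, by omega, hs, by omega, ?_⟩)
        rw [even_family_zero_eq_orbitSet hj hs (by omega), ← e]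
    · obtain ⟨h1, h2⟩ := (isNormal_evenParam_one_iff hv hq).1 hP
      obtain ⟨j, hj, hjk, e⟩ := h2.eq_V1 hv h1
      refine Or.inl ⟨j, v, hj, by omega, ?_⟩
      rw [even_family_one_eq_orbitSet hq hj, ← e]

theorem mem_classList_iff {n : ℕ} (hn : 2 ≤ n) (F : Set Param) :
    F ∈ classList n ↔ ∃ P, IsNormal n P ∧ F = orbitSet n P := by
  constructor
  · rintro (⟨q, rfl, -, hF⟩ | ⟨q, rfl, hF⟩)
    · exact (mem_oddList_iff (by omega) F).1 hF
    · exact (mem_evenList_iff (by omega) F).1 hF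
  · rintro ⟨P, hP, hF⟩
    rcases Nat.even_or_odd' n with ⟨q, rfl | rfl⟩
    · exact Or.inr ⟨q, rfl, (mem_evenList_iff (by omega) F).2 ⟨P, hP, hF⟩⟩
    · have e : 2 * q + 1 = 2 * (q + 1) - 1 := by omega
      refine Or.inl ⟨q + 1, e, ⟨q, rfl⟩, (mem_oddList_iff (by omega) F).2 ⟨P, ?_, ?_⟩⟩
      · rwa [← e]
      · rwa [← e]

end Classification

end LeibnizSuper

/-! ### Proof of the classification -/

theorem theorem3p3 (n : ℕ) (hn : 2 ≤ n) :
    (∀ (L : Type*) [AddCommGroup L] [Module ℂ L] (A : LeibnizSuper.SuperProduct L),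
      LeibnizSuper.IsOfType n (n + 1) A →
        ∃ F ∈ LeibnizSuper.classList n, ∃ P ∈ F,
          LeibnizSuper.Iso A (LeibnizSuper.family n P)) ∧
    (∀ F ∈ LeibnizSuper.classList n, ∀ P ∈ F,
      LeibnizSuper.IsOfType n (n + 1) (LeibnizSuper.family n P)) ∧
    (∀ F ∈ LeibnizSuper.classList n, ∀ G ∈ LeibnizSuper.classList n, ∀ P ∈ F, ∀ Q ∈ G,
      LeibnizSuper.Iso (LeibnizSuper.family n P) (LeibnizSuper.family n Q) ↔ F = G) := by
  -- Since `Orbit` is an equivalence relation, a family is the set of normalized points in the orbit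
  -- of any of its members.
  have hmem : ∀ F ∈ LeibnizSuper.classList n, ∀ P ∈ F,
      F = LeibnizSuper.orbitSet n P ∧ LeibnizSuper.IsNormal n P := by
    intro F hF P hP
    obtain ⟨P₀, -, rfl⟩ := (LeibnizSuper.mem_classList_iff hn F).1 hF
    exact ⟨Set.ext fun Q => and_congr_right fun _ =>
      ⟨fun h => hP.2.symm.trans h, fun h => hP.2.trans h⟩, hP.1⟩
  refine ⟨?_, ?_, ?_⟩
  · intro L _ _ A hA
    obtain ⟨y, z, ψ, γ, hG⟩ := hA.exists_isGen hn
    obtain ⟨P, hP⟩ := hG.exists_iso_family hA.isLeibniz hn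
    obtain ⟨Q, hQ, hPQ⟩ := LeibnizSuper.exists_isReduced hn P
    obtain ⟨T, hT, u, t, hu, ht, rfl⟩ := hQ.exists_isNormal hn
    exact ⟨_, (LeibnizSuper.mem_classList_iff hn _).2 ⟨_, hT, rfl⟩, _, hT.mem_orbitSet,
      hP.trans (((LeibnizSuper.iso_family_iff hn P Q).2 hPQ).trans
        ((LeibnizSuper.iso_family_iff hn Q _).2 (LeibnizSuper.paramRel_act hn hu ht Q)))⟩
  · intro F _ P _
    exact (LeibnizSuper.family_isGen hn P).isOfType (LeibnizSuper.family_isLeibniz hn P) hn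
  · intro F hF G hG P hP Q hQ
    rw [LeibnizSuper.iso_family_iff hn]
    obtain ⟨eF, hPn⟩ := hmem F hF P hP
    obtain ⟨eG, hQn⟩ := hmem G hG Q hQ
    constructor
    · intro h
      have hPQ := h.orbit hn hPn.toIsReduced hQn.toIsReduced
      rw [eF, eG]
      exact Set.ext fun T => and_congr_right fun _ =>
        ⟨fun h => hPQ.symm.trans h, fun h => hPQ.trans h⟩
    · rintro rfl
      rw [eF] at hQ
      obtain ⟨-, u, t, hu, ht, rfl⟩ := hQ
      exact LeibnizSuper.paramRel_act hn hu ht P
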